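/- **Setting.** Let $\mathcal G=(\mathcal V,\mathcal E)$ be a strongly connected digraph on $m$ agents; $\mathcal N_i^{in}$, $\mathcal N_i^{out}$ are the in- and out-neighbours of $i$ other than $i$. For $i\in\mathcal V$ let $f_i(\cdot,\theta):\mathbb R^n\to\mathbb R$ be integrable in $\theta$ and, for a.e. $\theta$, differentiable in $x$ with $L_i$-Lipschitz gradient; write $f_i(x)=\mathbb E_\theta f_i(x,\theta)$, and let $F=\sum_i f_i$ be bounded below on $\mathbb R^n$. The matrix $W$ is row-stochastic, $A$ is column-stochastic, and for some $\bar m>0$: $w_{ij},a_{ij}\ge\bar m$ if $j=i$ or $j\in\mathcal N_i^{in}$, and $w_{ij}=a_{ij}=0$ otherwise. **Algorithm.** Start with $x_i^0=0$, $z_i^0=\tilde\nabla f_i(0,\zeta_{init})$, and $v_i^t=0$, $\rho_{ij}^t=\tilde\rho_{ij}^0=0$ for $t\le 0$. In iteration $k\ge0$ one agent $i=i^k$ is active, with delays $d_j^k\ge 0$; it sets $\tau_{ij}^k=\max\{\tau_{ij}^{k-1},k-d_j^k\}$ for $j\in\mathcal N_i^{in}$ (times below $0$ are read as $0$; $\tau^{-1}=0$)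 and $$v_i^{k+1}=x_i^k-\gamma^k z_i^k,\qquad x_i^{k+1}=w_{ii}v_i^{k+1}+\sum_{j\in\mathcal N_i^{in}}w_{ij}v_j^{\tau_{ij}^k},$$ $$z_i^{k+1/2}=z_i^k+\sum_{j\in\mathcal N_i^{in}}\bigl(\rho_{ij}^{\tau_{ij}^k}-\tilde\rho_{ij}^k\bigr)+\tilde\nabla f_i(x_i^{k+1},\zeta^k)-\tilde\nabla f_i(x_i^k,\zeta'),$$ $$z_i^{k+1}=a_{ii}z_i^{k+1/2},\quad \rho_{ji}^{k+1}=\rho_{ji}^k+a_{ji}z_i^{k+1/2}\ (j\in\mathcal N_i^{out}),\quad \tilde\rho_{ij}^{k+1}=\rho_{ij}^{\tau_{ij}^k}\ (j\in\mathcal N_i^{in}),$$ where $\zeta'$ is the sample of the previous activation of $i$ ($\zeta_{init}$ if there is none). All other variables are unchanged. Every agent is active in each window of $T$ consecutive iterations, and $d_j^k\le D$ for $j\in\mathcal N^{in}_{i^k}$. The schedule $(i^k,d^k)_k$ is arbitrary, possibly random. **Samples.** $(\mathcal F_k)_{k\ge0}$ is a filtration; the entire schedule and $\zeta_{init}$ are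 $\mathcal F_0$-measurable, $\zeta^k$ is $\mathcal F_{k+1}$-measurable, each $\tilde\nabla f_i$ is jointly measurable, and for all $k$, with $i=i^k$, $$\mathbb E[\tilde\nabla f_i(x_i^{k+1},\zeta^k)\mid\mathcal F_k]=\nabla f_i(x_i^{k+1}),\qquad \mathbb E\|\tilde\nabla f_i(x_i^{k+1},\zeta^k)-\nabla f_i(x_i^{k+1})\|^2\le\sigma^2;$$ also $\mathbb E\|\tilde\nabla f_i(0,\zeta_{init})-\nabla f_i(0)\|^2\le\sigma^2$ for all $i$. **Augmented matrices.** Let $h^k=[x^k,v^k,v^{k-1},\dots,v^{k-D}]$, and let $\hat W^k$ be the row-stochastic matrix with $h^{k+1}=\hat W^k(h^k+\delta^k)$, where $\delta^k$ is $-\gamma^kz^k_{i^k}$ in the component $x_{i^k}$ and $0$ elsewhere: row $x_i$, $i=i^k$, holds $w_{ii}$ in column $x_i$ and $w_{ij}$ in the column of $v_j^{\tau_{ij}^k}$; row $v_i^{k+1}$ holds $1$ in column $x_i$; all other rows copy or shift. Let $\hat A^k$ be the column-stochastic matrix on the agents and, for each edge $(j,l)$, virtual nodes $0,\dots,D$ that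 describes the movement of mass in iteration $k$: the active agent $i$ collects the mass at the nodes $d\ge k-\tau_{ij}^k$ of each edge $(j,i)$, keeps the fraction $a_{ii}$ of this mass together with its own, and puts the fraction $a_{li}$ into node $0$ of the edge $(i,l)$; mass in any other virtual node $d$ moves to node $\min(d+1,D)$ of its edge; mass at the other agents stays. Write $\hat A^{k:t}=\hat A^k\cdots\hat A^t$ and $\hat W^{k:t}=\hat W^k\cdots\hat W^t$. *Mixing weights* are families of stochastic vectors $\xi^k$ ($k\ge-1$), $\psi^t$ ($t\ge0$), measurable functions of the outcome, such that for some constants $C'>0$, $0<\rho<1$, for every outcome and all $k\ge t\ge 0$: $|\hat A^{k:t}_{ij}-\xi^k_i|\le C'\rho^{k-t}$ for agents $i,j$, and $|\hat W^{k:t}_{rc}-\psi^t_c|\le C'\rho^{k-t}$ for all $r,c$. **Errors.** Let $\bar z_i^k$, with mass counters $\bar\rho$ and buffers $\tilde{\bar\rho}$, be obtained from the tracking recursion above at the same iterates $x_i^k$ and with the same schedule, with exact gradients $\nabla f_i$ in place of $\tilde\nabla f_i$. Let $S^k=\sum_i\bar z_i^k+\sum_{(j,i)\in\mathcal E}(\bar\rho_{ij}^k-\tilde{\bar\rho}_{ij}^k)$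 be the sum of all components of the augmented tracking vector, and $x_\psi^k=\sum_c\psi^k_c h^k_c$. Put $$E_t^k=\|\bar z_{i^k}^k-\xi_{i^k}^{k-1}S^k\|^2,\quad E_c^k=\sum_r\|h_r^k-x_\psi^k\|^2,\quad E_z^k=\|\bar z_{i^k}^k\|^2,\quad M^k=\mathbb E[E_t^k+E_c^k+E_z^k].$$ **Theorem.** Let $\gamma^k>0$ be deterministic step sizes with $\sum_k\gamma^k=\infty$ and $\sum_k(\gamma^k)^2<\infty$ (no smallness of $\gamma^0$ is required). Then mixing weights exist, and for every choice of mixing weights all $E_t^k+E_c^k+E_z^k$ are integrable and there is a constant $C>0$, independent of $k$, with $$\frac{\sum_{l=0}^k\gamma^lM^l}{\sum_{l=0}^k\gamma^l}\le\frac{C}{\sum_{l=0}^k\gamma^l}\qquad\text{for all }k\ge0 .$$ -/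

import Mathlib

open MeasureTheory ProbabilityTheory Filter Topology
open scoped BigOperators ENNReal NNReal

namespace AsyncSGT

noncomputable section

open scoped Classical

/-- The decision space `ℝⁿ` with the Euclidean norm. -/
abbrev Vec (n : ℕ) : Type := EuclideanSpace ℝ (Fin n)

/-! ### The network -/

/-- A digraph is strongly connected: a directed path leads from every vertex to every vertex. -/
def StronglyConnected {V : Type*} (G : Digraph V) : Prop :=
  ∀ i j : V, Relation.ReflTransGen G.Adj i j

variable {V : Type*} [Fintype V]

/-- In-neighbours of `i`: the other agents `j` with an edge `j → i`. -/
def inNbrs (G : Digraph V) (i : V) : Finset V :=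
  Finset.univ.filter fun j => j ≠ i ∧ G.Adj j i

/-- Out-neighbours of `i`: the other agents `j` with an edge `i → j`. -/
def outNbrs (G : Digraph V) (i : V) : Finset V :=
  Finset.univ.filter fun j => j ≠ i ∧ G.Adj i j

/-- The mixing matrices fit the digraph: the entry `(i, j)` is at least `mbar > 0` if `j = i` or
`j` is an in-neighbour of `i`, and zero otherwise; `W` is row stochastic and `A` is column
stochastic. -/
structure IsMixingPair (G : Digraph V) (W A : Matrix V V ℝ) (mbar : ℝ) : Prop where
  pos : 0 < mbar
  W_diag : ∀ i, mbar ≤ W i i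
  A_diag : ∀ i, mbar ≤ A i i
  W_edge : ∀ i, ∀ j ∈ inNbrs G i, mbar ≤ W i j
  A_edge : ∀ i, ∀ j ∈ inNbrs G i, mbar ≤ A i j
  W_zero : ∀ i j, j ≠ i → j ∉ inNbrs G i → W i j = 0
  A_zero : ∀ i j, j ≠ i → j ∉ inNbrs G i → A i j = 0
  W_row : ∀ i, ∑ j, W i j = 1
  A_col : ∀ j, ∑ i, A i j = 1

/-! ### Activations and delays -/

/-- At iteration `k` the agent `active k` is activated and receives from its in-neighbour `j`
a message of age `delay k j`. -/
structure Schedule (V : Type*) where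
  active : ℕ → V
  delay : ℕ → V → ℕ

namespace Schedule

/-- `s.counter k i j` is the local counter of agent `i` for the messages of `j` just before
iteration `k`. Nothing changes before time `0`, so times below `0` are identified with `0`
(the subtraction is truncated, and the counters start at `0`). -/
def counter (s : Schedule V) : ℕ → V → V → ℕ
  | 0 => fun _ _ => 0
  | k + 1 => fun i j =>
      if i = s.active k then max (s.counter k i j) (k - s.delay k j) else s.counter k i j

/-- The counter `τ` of the active agent of iteration `k` for the messages of `j`, after its
update in that iteration: the time stamp of the information of `j` used in iteration `k`. -/
def readTime (s : Schedule V) (k : ℕ) (j : V) : ℕ := s.counter (k + 1) (s.active k) j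

/-- Every agent is active in each window of `T` iterations, and delays are at most `D`. -/
structure IsAdmissible (s : Schedule V) (G : Digraph V) (T D : ℕ) : Prop where
  activation : ∀ (k : ℕ) (i : V), ∃ t, k ≤ t ∧ t < k + T ∧ s.active t = i
  bounded_delay : ∀ k, ∀ j ∈ inNbrs G (s.active k), s.delay k j ≤ D

end Schedule

/-! ### The algorithm -/

/-- The variables of the tracking part: `z i`, the mass counter `ρ i j` of the mass generated by
`j` for `i`, and the buffer `buf i j`, the last value of `ρ i j` which `i` has processed. -/
structure Mass (V : Type*) (n : ℕ) where
  z : V → Vec n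
  ρ : V → V → Vec n
  buf : V → V → Vec n

/-- Initially `z = z₀` and all mass counters and buffers vanish. -/
def Mass.init {n : ℕ} (z₀ : V → Vec n) : Mass V n where
  z := z₀
  ρ := fun _ _ => 0
  buf := fun _ _ => 0

/-- The robust tracking step of iteration `k` (sum step, push step, buffer update) with gradient
correction `Δ`; `past t` is the value of the variables at time `t ≤ k`. -/
def massStep {n : ℕ} (G : Digraph V) (A : Matrix V V ℝ) (s : Schedule V) (k : ℕ)
    (past : ℕ → Mass V n) (Δ : Vec n) : Mass V n :=
  let i : V := s.active k
  let zHalf : Vec n :=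
    (past k).z i + ∑ j ∈ inNbrs G i, ((past (s.readTime k j)).ρ i j - (past k).buf i j) + Δ
  { z := Function.update (past k).z i (A i i • zHalf)
    ρ := fun l j =>
      if j = i ∧ l ∈ outNbrs G i then (past k).ρ l j + A l i • zHalf else (past k).ρ l j
    buf := fun l j =>
      if l = i ∧ j ∈ inNbrs G i then (past (s.readTime k j)).ρ i j else (past k).buf l j }

/-- All variables of the algorithm. `smp i` is the sample used in the last stochastic gradient
evaluated by agent `i`. -/
structure State (V Z : Type*) (n : ℕ) where
  x : V → Vec n
  v : V → Vec n
  mass : Mass V n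
  smp : V → Z

/-- Initialization: `x i = 0`, `v i = 0`, and `z i` is the stochastic gradient of agent `i` at `0`
for the initial sample `ζ₀`. -/
def State.init {Z : Type*} {n : ℕ} (g : V → Vec n → Z → Vec n) (ζ₀ : Z) : State V Z n where
  x := fun _ => 0
  v := fun _ => 0
  mass := Mass.init fun i => g i 0 ζ₀
  smp := fun _ => ζ₀

/-- Iteration `k`, with step size `γ k` and sample `ζ k`; `past t` is the state at time
`t ≤ k`. -/
def step {Z : Type*} {n : ℕ} (G : Digraph V) (W A : Matrix V V ℝ) (g : V → Vec n → Z → Vec n)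
    (γ : ℕ → ℝ) (s : Schedule V) (ζ : ℕ → Z) (k : ℕ) (past : ℕ → State V Z n) : State V Z n :=
  let i : V := s.active k
  let vNew : Vec n := (past k).x i - γ k • (past k).mass.z i
  let xNew : Vec n := W i i • vNew + ∑ j ∈ inNbrs G i, W i j • (past (s.readTime k j)).v j
  { x := Function.update (past k).x i xNew
    v := Function.update (past k).v i vNew
    mass := massStep G A s k (fun t => (past t).mass)
      (g i xNew (ζ k) - g i ((past k).x i) ((past k).smp i))
    smp := Function.update (past k).smp i (ζ k) }

/-- The state of the algorithm at time `k`. (Times read in iteration `k` are at most `k`, so that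
the minimum only serves the recursion.) -/
def run {Z : Type*} {n : ℕ} (G : Digraph V) (W A : Matrix V V ℝ) (g : V → Vec n → Z → Vec n)
    (γ : ℕ → ℝ) (s : Schedule V) (ζ₀ : Z) (ζ : ℕ → Z) : ℕ → State V Z n
  | 0 => State.init g ζ₀
  | k + 1 => step G W A g γ s ζ k fun t => run G W A g γ s ζ₀ ζ (min t k)
termination_by k => k
decreasing_by omega

/-- The exact tracking variables `z̄`, `ρ̄` and their buffers at time `k`: the tracking recursion
driven by the exact gradients `dF i` at the given points `x t i`, in place of the stochastic
ones. -/
def exactMass {n : ℕ} (G : Digraph V) (A : Matrix V V ℝ) (dF : V → Vec n → Vec n)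
    (s : Schedule V) (x : ℕ → V → Vec n) : ℕ → Mass V n
  | 0 => Mass.init fun i => dF i (x 0 i)
  | k + 1 =>
      massStep G A s k (fun t => exactMass G A dF s x (min t k))
        (dF (s.active k) (x (k + 1) (s.active k)) - dF (s.active k) (x k (s.active k)))
termination_by k => k
decreasing_by omega

/-- The sum of all components of the augmented tracking vector: the masses `z i` of the agents
and, for each edge `j → i`, the mass generated by `j` for `i` and not yet collected by `i`. -/
def Mass.total {n : ℕ} (G : Digraph V) (y : Mass V n) : Vec n :=
  ∑ i, y.z i + ∑ i, ∑ j ∈ inNbrs G i, (y.ρ i j - y.buf i j)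

/-! ### The augmented mixing matrices -/

/-- `prodFrom M t r = M (t + r - 1) * ⋯ * M (t + 1) * M t` (`r` factors). -/
def prodFrom {I : Type*} [Fintype I] (M : ℕ → Matrix I I ℝ) (t : ℕ) : ℕ → Matrix I I ℝ
  | 0 => 1
  | r + 1 => M (t + r) * prodFrom M t r

/-- Index set of the augmented consensus vector `h`: `inl i` stands for `x i` and `inr (i, b)` for
`v i` as it was `b` iterations ago, `0 ≤ b ≤ D`. -/
abbrev ConsIdx (V : Type*) (D : ℕ) : Type _ := V ⊕ (V × Fin (D + 1))

/-- The consensus matrix of iteration `k`: `h (k + 1) = consMatrix k * (h k + δ k)`, where `δ k`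
adds `- γ k • z i` to the component `x i` of the active agent `i`. -/
def consMatrix (G : Digraph V) (W : Matrix V V ℝ) (s : Schedule V) (D k : ℕ) :
    Matrix (ConsIdx V D) (ConsIdx V D) ℝ :=
  fun r c =>
    match r with
    | Sum.inl i =>
        if i = s.active k then
          match c with
          | Sum.inl j => if j = i then W i i else 0
          | Sum.inr (j, b) =>
              if j ∈ inNbrs G i ∧ (b : ℕ) = k - s.readTime k j then W i j else 0
        else if c = Sum.inl i then 1 else 0
    | Sum.inr (i, b) =>
        if (b : ℕ) = 0 then
          if i = s.active k then (if c = Sum.inl i then 1 else 0)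
          else (if c = Sum.inr (i, b) then 1 else 0)
        else
          match c with
          | Sum.inl _ => 0
          | Sum.inr (j, b₁) => if j = i ∧ (b₁ : ℕ) + 1 = b then 1 else 0

/-- The edges `j → i` of the digraph, as pairs `(j, i)`. -/
abbrev Edge (G : Digraph V) : Type _ := {e : V × V // e.1 ∈ inNbrs G e.2}

/-- Index set of the augmented tracking vector: the agents, and for each edge `D + 1` virtual
nodes; the node `(e, d)` holds the mass on its way along `e` since `d` iterations (for `d = D`:
since at least `D` iterations). -/
abbrev MassIdx (G : Digraph V) (D : ℕ) : Type _ := V ⊕ (Edge G × Fin (D + 1))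

/-- How the active agent `i` distributes a unit of mass in the push step: `A i i` stays with `i`
and `A l i` enters the edge `i → l`. -/
def pushVec (G : Digraph V) (A : Matrix V V ℝ) (D : ℕ) (i : V) : MassIdx G D → ℝ
  | Sum.inl r => if r = i then A i i else 0
  | Sum.inr (e, d) => if e.1.1 = i ∧ (d : ℕ) = 0 then A e.1.2 i else 0

/-- The mixing matrix of the tracking recursion in iteration `k`; the column `c` says where the
mass at the node `c` goes. The active agent `i` collects the mass which is on its way to `i` and
was generated up to the time read by `i`, and pushes it together with its own; the remaining
mass on its way gets older by one iteration. -/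
def massMatrix (G : Digraph V) (A : Matrix V V ℝ) (s : Schedule V) (D k : ℕ) :
    Matrix (MassIdx G D) (MassIdx G D) ℝ :=
  fun r c =>
    match c with
    | Sum.inl j =>
        if j = s.active k then pushVec G A D j r else if r = Sum.inl j then 1 else 0
    | Sum.inr (e, d) =>
        if e.1.2 = s.active k ∧ k - s.readTime k e.1.1 ≤ d then pushVec G A D e.1.2 r
        else
          match r with
          | Sum.inl _ => 0
          | Sum.inr (e₁, d₁) => if e₁ = e ∧ (d₁ : ℕ) = min ((d : ℕ) + 1) D then 1 else 0

/-- Stochastic vectors `ξ` which the products of the tracking matrices approach at the geometric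
rate `C * q ^ ·` on the agents. Here `ξ k` belongs to the products of the matrices of the
iterations `t, …, k - 1`, that is, of all iterations before time `k`. -/
def IsTrackingLimit (G : Digraph V) (A : Matrix V V ℝ) (s : Schedule V) (D : ℕ) (C q : ℝ)
    (ξ : ℕ → MassIdx G D → ℝ) : Prop :=
  (∀ k, ξ k ∈ stdSimplex ℝ (MassIdx G D)) ∧
  ∀ t k, t ≤ k → ∀ i j : V,
    |prodFrom (massMatrix G A s D) t (k - t) (Sum.inl i) (Sum.inl j) - ξ k (Sum.inl i)|
      ≤ C * q ^ (k - t)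

/-- Stochastic vectors `ψ` such that the products of the consensus matrices of the iterations
`t, …, k - 1` approach `1 (ψ t)ᵀ` at the geometric rate `C * q ^ ·`. -/
def IsConsensusLimit (G : Digraph V) (W : Matrix V V ℝ) (s : Schedule V) (D : ℕ) (C q : ℝ)
    (ψ : ℕ → ConsIdx V D → ℝ) : Prop :=
  (∀ t, ψ t ∈ stdSimplex ℝ (ConsIdx V D)) ∧
  ∀ t k, t ≤ k → ∀ r c : ConsIdx V D,
    |prodFrom (consMatrix G W s D) t (k - t) r c - ψ t c| ≤ C * q ^ (k - t)

/-- `ξ` and `ψ` are tracking and consensus weights of the random schedule `s`: measurable, and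
for every outcome limits in the above sense, with common constants. -/
def IsMixingLimits {Ω : Type*} [MeasurableSpace Ω] (G : Digraph V) (W A : Matrix V V ℝ)
    (s : Ω → Schedule V) (D : ℕ) (ξ : Ω → ℕ → MassIdx G D → ℝ)
    (ψ : Ω → ℕ → ConsIdx V D → ℝ) : Prop :=
  (∀ k r, Measurable fun ω => ξ ω k r) ∧ (∀ k r, Measurable fun ω => ψ ω k r) ∧
  ∃ C q : ℝ, 0 < C ∧ 0 < q ∧ q < 1 ∧
    ∀ ω, IsTrackingLimit G A (s ω) D C q (ξ ω) ∧ IsConsensusLimit G W (s ω) D C q (ψ ω)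

/-! ### The error terms -/

/-- The augmented consensus vector `h` at time `k` (before time `0`, `v` equals its initial
value `v 0 = 0`). -/
def augVec {n : ℕ} (D : ℕ) (x v : ℕ → V → Vec n) (k : ℕ) : ConsIdx V D → Vec n
  | Sum.inl i => x k i
  | Sum.inr (i, b) => v (k - b) i

/-- Consensus error `‖h - 1 ⊗ x_ψ‖²`, with the weighted average `x_ψ = (ψᵀ ⊗ I) h`. -/
def errC {n D : ℕ} (h : ConsIdx V D → Vec n) (ψ : ConsIdx V D → ℝ) : ℝ :=
  ∑ r, ‖h r - ∑ c, ψ c • h c‖ ^ 2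

/-- Tracking error `‖z̄ i - ξ i • (total mass)‖²` of the active agent `i`. -/
def errT {n D : ℕ} (G : Digraph V) (y : Mass V n) (ξ : MassIdx G D → ℝ) (i : V) : ℝ :=
  ‖y.z i - ξ (Sum.inl i) • y.total G‖ ^ 2

/-- Squared norm of the tracked gradient of the active agent `i`. -/
def errZ {n : ℕ} (y : Mass V n) (i : V) : ℝ := ‖y.z i‖ ^ 2

/-- `E_t + E_c + E_z` at time `k`, for the run of the algorithm given by the schedule `s`, the
initial sample `ζ₀` and the samples `ζ`. -/
def errSum {Z : Type*} {n D : ℕ} (G : Digraph V) (W A : Matrix V V ℝ)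
    (g : V → Vec n → Z → Vec n) (dF : V → Vec n → Vec n) (γ : ℕ → ℝ)
    (s : Schedule V) (ζ₀ : Z) (ζ : ℕ → Z)
    (ξ : ℕ → MassIdx G D → ℝ) (ψ : ℕ → ConsIdx V D → ℝ) (k : ℕ) : ℝ :=
  let st : ℕ → State V Z n := run G W A g γ s ζ₀ ζ
  let y : Mass V n := exactMass G A dF s (fun t => (st t).x) k
  let h : ConsIdx V D → Vec n := augVec D (fun t => (st t).x) (fun t => (st t).v) k
  errT G y (ξ k) (s.active k) + errC h (ψ k) + errZ y (s.active k)

/-- The point at which the active agent evaluates its stochastic gradient in iteration `k`: its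
new iterate. -/
def queryPoint {Z : Type*} {n : ℕ} (G : Digraph V) (W A : Matrix V V ℝ)
    (g : V → Vec n → Z → Vec n) (γ : ℕ → ℝ) (s : Schedule V) (ζ₀ : Z) (ζ : ℕ → Z) (k : ℕ) :
    Vec n :=
  (run G W A g γ s ζ₀ ζ (k + 1)).x (s.active k)

/-! ### The objective -/

/-- The local objective `x ↦ 𝔼 f i (x, θ)`. -/
def localObj {Θ : Type*} [MeasurableSpace Θ] {n : ℕ} (P : Measure Θ)
    (f : V → Vec n → Θ → ℝ) (i : V) (x : Vec n) : ℝ :=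
  ∫ θ, f i x θ ∂P

/-- The exact local gradient. -/
def localGrad {Θ : Type*} [MeasurableSpace Θ] {n : ℕ} (P : Measure Θ)
    (f : V → Vec n → Θ → ℝ) (i : V) (x : Vec n) : Vec n :=
  gradient (localObj P f i) x

end

end AsyncSGT

/-!
The theorem rests on the linear structure of the two recursions: the augmented consensus vector `h`
obeys `h (k + 1) = consMatrix k * (h k + δ k)` with `δ k` of length `γ k * ‖z‖`
(`IsPath.augVec_succ`; the length is `moveLen`), and the augmented tracking vector obeys a recursion
with the matrices `massMatrix k`, driven by gradient increments of the active agent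
(`augMass_succ`).

*Mixing.* Within boundedly many iterations, mass and information have reached every agent, uniformly
in the schedule (`exists_entry_lower_bound`). Hence products of these stochastic matrices contract
geometrically, mixing weights exist (`exists_isMixingLimits`), and from some time on the weights of
the agents are bounded away from zero (`IsRandomPath.exists_le_weights`).

*Quadratic errors.* Consequently the consensus and the tracking error at time `k` are bounded by
geometric convolutions of the previous moves. By Young's inequality their sums up to any time are at
most a constant plus a constant times the sum of the squared moves (`IsPath.sum_errC_le`,
`IsPath.sum_errT_le`). The difference between the stochastic and the exact tracked gradient is a
geometric convolution of the noise (`IsPath.norm_z_sub_le`), so that the expected squared move is at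
most a constant times `(γ k) ^ 2 * 𝔼 errZ + (γ k) ^ 2` (`IsRandomPath.integral_moveLen_sq_le`).

*Descent.* The `ψ`-weighted average of `h`, called `center`, moves only by the weighted gradient
step of the active agent. The tracked gradient of that agent is close to a positive multiple of the
gradient of the objective `F` at the center, so that `F (center k)` decreases by a multiple of
`γ k * errZ`, up to the quadratic errors and an inner product with the noise (`IsPath.descent`).
In the tracked gradient, summation by parts expresses the noise through the noise which the agents
hold at the times `t ≤ k`, with weights which decay geometrically in `k - t`; in the inner product,
the gradient at time `k` is replaced by the one at time `t - T`, at the price of further quadratic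
errors. Since every agent is active in each window of `T` iterations, the noise held at a time
`t ≥ T` has arisen after time `t - T`, and the inner product has mean zero
(`IsRandomPath.integral_inner_noise`). The finitely many terms with `t < T` are
geometrically small (`IsRandomPath.integral_noise_sum`).

*Absorption.* The step sizes are square summable and thus tend to zero, so that from some time on
all quadratic errors are absorbed by the decrease (`exists_sum_le_of_descent`). The initial
iterations contribute a constant, since all errors are integrable. As `F` is bounded below, the
partial sums of `γ k * M k`, with `M k` the expected errors at time `k`, are bounded, which is the claim.
-/

namespace AsyncSGT

noncomputable section

set_option linter.unusedSectionVars false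

open scoped Classical

section

/-! ### Products of stochastic matrices -/

section Products

variable {I : Type*} [Fintype I]

/-- Nonnegative entries and row sums one. -/
structure RowStoch (M : Matrix I I ℝ) : Prop where
  nonneg : ∀ r c, 0 ≤ M r c
  sum_row : ∀ r, ∑ c, M r c = 1

/-- Nonnegative entries and column sums one. -/
structure ColStoch (M : Matrix I I ℝ) : Prop where
  nonneg : ∀ r c, 0 ≤ M r c
  sum_col : ∀ c, ∑ r, M r c = 1

theorem RowStoch.le_one {M : Matrix I I ℝ} (h : RowStoch M) (r c : I) : M r c ≤ 1 := by
  rw [← h.sum_row r]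
  exact Finset.single_le_sum (fun c _ => h.nonneg r c) (Finset.mem_univ c)

theorem ColStoch.le_one {M : Matrix I I ℝ} (h : ColStoch M) (r c : I) : M r c ≤ 1 := by
  rw [← h.sum_col c]
  exact Finset.single_le_sum (f := fun r => M r c) (fun r _ => h.nonneg r c) (Finset.mem_univ r)

theorem RowStoch.one : RowStoch (1 : Matrix I I ℝ) where
  nonneg r c := by rw [Matrix.one_apply]; split_ifs <;> norm_num
  sum_row r := by simp [Matrix.one_apply]

theorem RowStoch.mul {M N : Matrix I I ℝ} (hM : RowStoch M) (hN : RowStoch N) :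
    RowStoch (M * N) where
  nonneg r c := Finset.sum_nonneg fun a _ => mul_nonneg (hM.nonneg r a) (hN.nonneg a c)
  sum_row r := by
    simp only [Matrix.mul_apply]
    rw [Finset.sum_comm]
    simp [← Finset.mul_sum, hN.sum_row, hM.sum_row]

theorem ColStoch.one : ColStoch (1 : Matrix I I ℝ) where
  nonneg r c := by rw [Matrix.one_apply]; split_ifs <;> norm_num
  sum_col r := by simp [Matrix.one_apply]

theorem ColStoch.mul {M N : Matrix I I ℝ} (hM : ColStoch M) (hN : ColStoch N) :
    ColStoch (M * N) where
  nonneg r c := Finset.sum_nonneg fun a _ => mul_nonneg (hM.nonneg r a) (hN.nonneg a c)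
  sum_col r := by
    simp only [Matrix.mul_apply]
    rw [Finset.sum_comm]
    simp [← Finset.sum_mul, hN.sum_col, hM.sum_col]

theorem RowStoch.prodFrom {M : ℕ → Matrix I I ℝ} (hM : ∀ k, RowStoch (M k)) (t r : ℕ) :
    RowStoch (prodFrom M t r) := by
  induction r with
  | zero => exact RowStoch.one
  | succ r ih => exact (hM _).mul ih

theorem ColStoch.prodFrom {M : ℕ → Matrix I I ℝ} (hM : ∀ k, ColStoch (M k)) (t r : ℕ) :
    ColStoch (prodFrom M t r) := by
  induction r with
  | zero => exact ColStoch.one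
  | succ r ih => exact (hM _).mul ih

theorem prodFrom_zero_apply (M : ℕ → Matrix I I ℝ) (t : ℕ) (a c : I) :
    prodFrom M t 0 a c = if a = c then 1 else 0 := by
  rw [prodFrom, Matrix.one_apply]

theorem prodFrom_add (M : ℕ → Matrix I I ℝ) (t r r' : ℕ) :
    prodFrom M t (r + r') = prodFrom M (t + r) r' * prodFrom M t r := by
  induction r' with
  | zero => simp [prodFrom]
  | succ r' ih => rw [← add_assoc, prodFrom, ih, prodFrom, Matrix.mul_assoc, add_assoc]

theorem prodFrom_succ_left (M : ℕ → Matrix I I ℝ) (t r : ℕ) :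
    prodFrom M t (r + 1) = prodFrom M (t + 1) r * M t := by
  rw [add_comm, prodFrom_add]
  simp [prodFrom]

/-- Two convex combinations of the values of `f` which both give weight `η` to the same point
differ by at most `1 - η` times the oscillation of `f`. -/
theorem sum_mul_sub_sum_mul_le {p p' f : I → ℝ} {c₀ : I} {η B : ℝ}
    (hp : ∀ c, 0 ≤ p c) (hp1 : ∑ c, p c = 1) (hp' : ∀ c, 0 ≤ p' c) (hp1' : ∑ c, p' c = 1)
    (h : η ≤ p c₀) (h' : η ≤ p' c₀) (hf : ∀ c c', f c - f c' ≤ B) (hη : η ≤ 1) :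
    ∑ c, p c * f c - ∑ c, p' c * f c ≤ (1 - η) * B := by
  obtain ⟨cM, -, hM⟩ := Finset.exists_max_image Finset.univ f ⟨c₀, Finset.mem_univ _⟩
  obtain ⟨cm, -, hm⟩ := Finset.exists_min_image Finset.univ f ⟨c₀, Finset.mem_univ _⟩
  have e1 : ∑ c, p c * (f cM - f c) ≥ η * (f cM - f c₀) := by
    refine le_trans (mul_le_mul_of_nonneg_right h ?_)
      (Finset.single_le_sum (f := fun c => p c * (f cM - f c)) (fun c _ => ?_)
        (Finset.mem_univ c₀))
    · linarith [hM c₀ (Finset.mem_univ _)]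
    · exact mul_nonneg (hp c) (by linarith [hM c (Finset.mem_univ _)])
  have e2 : ∑ c, p' c * (f c - f cm) ≥ η * (f c₀ - f cm) := by
    refine le_trans (mul_le_mul_of_nonneg_right h' ?_)
      (Finset.single_le_sum (f := fun c => p' c * (f c - f cm)) (fun c _ => ?_)
        (Finset.mem_univ c₀))
    · linarith [hm c₀ (Finset.mem_univ _)]
    · exact mul_nonneg (hp' c) (by linarith [hm c (Finset.mem_univ _)])
  simp only [mul_sub, Finset.sum_sub_distrib, ← Finset.sum_mul, hp1, hp1', one_mul] at e1 e2
  nlinarith [hf cM cm]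

/-- A convex combination of values which are all `δ`-close to `x` is `δ`-close to `x`. -/
theorem abs_sum_mul_sub_le {p f : I → ℝ} {x δ : ℝ} (hp : ∀ c, 0 ≤ p c) (hp1 : ∑ c, p c = 1)
    (hf : ∀ c, |f c - x| ≤ δ) : |∑ c, p c * f c - x| ≤ δ := by
  have : ∑ c, p c * f c - x = ∑ c, p c * (f c - x) := by
    simp [mul_sub, ← Finset.sum_mul, hp1]
  rw [this]
  refine (Finset.abs_sum_le_sum_abs _ _).trans ?_
  calc ∑ c, |p c * (f c - x)| ≤ ∑ c, p c * δ := by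
        refine Finset.sum_le_sum fun c _ => ?_
        rw [abs_mul, abs_of_nonneg (hp c)]
        exact mul_le_mul_of_nonneg_left (hf c) (hp c)
    _ = δ := by rw [← Finset.sum_mul, hp1, one_mul]

theorem RowStoch.prodFrom_sub_le {M : ℕ → Matrix I I ℝ} (hM : ∀ k, RowStoch (M k)) {R : ℕ}
    {η : ℝ} (hη : η ≤ 1) (hR : ∀ t, ∃ c₀, ∀ r, η ≤ AsyncSGT.prodFrom M t R r c₀) (t j : ℕ) :
    ∀ r, j * R ≤ r → ∀ a b c,
      AsyncSGT.prodFrom M t r a c - AsyncSGT.prodFrom M t r b c ≤ (1 - η) ^ j := by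
  induction j with
  | zero =>
    intro r _ a b c
    have h := RowStoch.prodFrom hM t r
    rw [pow_zero]
    linarith [h.le_one a c, h.nonneg b c]
  | succ j ih =>
    intro r hr a b c
    obtain ⟨r', rfl⟩ : ∃ r', r = r' + R := ⟨r - R, by rw [add_mul] at hr; omega⟩
    obtain ⟨c₀, hc₀⟩ := hR (t + r')
    have h := RowStoch.prodFrom hM (t + r') R
    rw [prodFrom_add, Matrix.mul_apply, Matrix.mul_apply, pow_succ']
    exact sum_mul_sub_sum_mul_le (h.nonneg a) (h.sum_row a) (h.nonneg b) (h.sum_row b)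
      (hc₀ a) (hc₀ b) (fun x y => ih r' (by rw [add_mul] at hr; omega) x y c) hη

theorem ColStoch.prodFrom_sub_le {M : ℕ → Matrix I I ℝ} (hM : ∀ k, ColStoch (M k)) {R : ℕ}
    {η : ℝ} (hη : η ≤ 1) (hR : ∀ t, ∃ r₀, ∀ c, η ≤ AsyncSGT.prodFrom M t R r₀ c) (j : ℕ) :
    ∀ t r, j * R ≤ r → ∀ a b c,
      AsyncSGT.prodFrom M t r c a - AsyncSGT.prodFrom M t r c b ≤ (1 - η) ^ j := by
  induction j with
  | zero =>
    intro t r _ a b c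
    have h := ColStoch.prodFrom hM t r
    rw [pow_zero]
    linarith [h.le_one c a, h.nonneg c b]
  | succ j ih =>
    intro t r hr a b c
    obtain ⟨r', rfl⟩ : ∃ r', r = R + r' := ⟨r - R, by rw [add_mul] at hr; omega⟩
    obtain ⟨c₀, hc₀⟩ := hR t
    have h := ColStoch.prodFrom hM t R
    rw [prodFrom_add, Matrix.mul_apply, Matrix.mul_apply, pow_succ']
    simp only [mul_comm (AsyncSGT.prodFrom M (t + R) r' c _)]
    exact sum_mul_sub_sum_mul_le (fun x => h.nonneg x a) (h.sum_col a) (fun x => h.nonneg x b)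
      (h.sum_col b) (hc₀ a) (hc₀ b)
      (fun x y => ih (t + R) r' (by rw [add_mul] at hr; omega) x y c) hη

/-- Powers of `1 - η` once per `R` steps are a geometric rate per step. -/
theorem exists_geometric_rate {R : ℕ} (hR : 0 < R) {η : ℝ} (h0 : 0 < η) (h1 : η ≤ 1) :
    ∃ C q : ℝ, 0 < C ∧ 0 < q ∧ q < 1 ∧ ∀ r, (1 - η) ^ (r / R) ≤ C * q ^ r := by
  -- half of `η` keeps the base positive even if `η = 1`
  have hb : 0 < 1 - η / 2 := by linarith
  have hb1 : 1 - η / 2 < 1 := by linarith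
  set q : ℝ := (1 - η / 2) ^ ((R : ℝ)⁻¹) with hq
  have hq0 : 0 < q := Real.rpow_pos_of_pos hb _
  have hq1 : q < 1 := Real.rpow_lt_one hb.le hb1 (by positivity)
  have hqR : q ^ R = 1 - η / 2 := Real.rpow_inv_natCast_pow hb.le hR.ne'
  refine ⟨(q ^ R)⁻¹, q, by positivity, hq0, hq1, fun r => ?_⟩
  have e1 : (1 - η) ^ (r / R) ≤ q ^ (R * (r / R)) := by
    rw [pow_mul, hqR]
    exact pow_le_pow_left₀ (by linarith) (by linarith) _
  refine e1.trans ?_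
  rw [inv_mul_eq_div, le_div_iff₀ (by positivity), ← pow_add]
  apply pow_le_pow_of_le_one hq0.le hq1.le
  have := Nat.div_add_mod r R
  have := Nat.mod_lt r hR
  omega

/-- The unrolled linear recursion `u (k + 1) = M k (u k + d k • e (idx k))`. -/
theorem eq_sum_prodFrom {E : Type*} [AddCommGroup E] [Module ℝ E] (M : ℕ → Matrix I I ℝ)
    (u : ℕ → I → E) (idx : ℕ → I) (d : ℕ → E)
    (hu : ∀ k r, u (k + 1) r = ∑ c, M k r c • u k c + M k r (idx k) • d k) (k : ℕ) (a : I) :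
    u k a = ∑ c, prodFrom M 0 k a c • u 0 c +
      ∑ t ∈ Finset.range k, prodFrom M t (k - t) a (idx t) • d t := by
  induction k generalizing a with
  | zero => simp [prodFrom, Matrix.one_apply]
  | succ k ih =>
    have e : ∀ t ∈ Finset.range k, prodFrom M t (k + 1 - t) a (idx t) • d t
        = ∑ c, M k a c • prodFrom M t (k - t) c (idx t) • d t := by
      intro t ht
      have ht' := Finset.mem_range.mp ht
      rw [show k + 1 - t = (k - t) + 1 by omega, prodFrom, show t + (k - t) = k by omega,
        Matrix.mul_apply, Finset.sum_smul]
      simp [mul_smul]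
    rw [hu, Finset.sum_range_succ, Finset.sum_congr rfl e]
    simp only [ih, smul_add, Finset.sum_add_distrib]
    rw [Finset.sum_comm (s := Finset.range k)]
    simp only [← Finset.smul_sum]
    rw [show k + 1 - k = 0 + 1 by omega, prodFrom, prodFrom]
    simp only [add_zero, Matrix.mul_one, zero_add, prodFrom]
    rw [← add_assoc]
    congr 2
    simp only [Matrix.mul_apply, Finset.sum_smul, mul_smul]
    rw [Finset.sum_comm]
    simp [Finset.smul_sum]

end Products

/-! ### Geometric convolutions -/

/-- The convolution of the sequence `a` with the powers of `q`. -/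
def conv (q : ℝ) (a : ℕ → ℝ) (k : ℕ) : ℝ := ∑ t ∈ Finset.range k, q ^ (k - t) * a t

section Conv

variable {q : ℝ}

theorem conv_nonneg (hq : 0 ≤ q) {a : ℕ → ℝ} (ha : ∀ t, 0 ≤ a t) (k : ℕ) : 0 ≤ conv q a k :=
  Finset.sum_nonneg fun t _ => mul_nonneg (pow_nonneg hq _) (ha t)

theorem conv_succ (q : ℝ) (a : ℕ → ℝ) (k : ℕ) : conv q a (k + 1) = q * (conv q a k + a k) := by
  rw [conv, Finset.sum_range_succ, conv, mul_add, Finset.mul_sum]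
  congr 1
  · refine Finset.sum_congr rfl fun t ht => ?_
    rw [show k + 1 - t = (k - t) + 1 by have := Finset.mem_range.mp ht; omega, pow_succ']
    ring
  · simp

theorem sum_conv_le (h0 : 0 ≤ q) (h1 : q < 1) {a : ℕ → ℝ} (ha : ∀ t, 0 ≤ a t) (N : ℕ) :
    ∑ k ∈ Finset.range N, conv q a k ≤ (1 - q)⁻¹ * ∑ k ∈ Finset.range N, a k := by
  have h : ∀ N, ∑ k ∈ Finset.range N, conv q a k + (1 - q)⁻¹ * conv q a N
      ≤ (1 - q)⁻¹ * ∑ k ∈ Finset.range N, a k := by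
    intro N
    induction N with
    | zero => simp [conv]
    | succ N ih =>
      rw [Finset.sum_range_succ, Finset.sum_range_succ, conv_succ]
      have hi : (1 - q)⁻¹ * (1 - q) = 1 := inv_mul_cancel₀ (by linarith)
      have hp : 0 ≤ (1 - q)⁻¹ := inv_nonneg.mpr (by linarith)
      have e : (1 - q)⁻¹ * (q * (conv q a N + a N))
          = (1 - q)⁻¹ * (conv q a N + a N) - (conv q a N + a N) := by
        linear_combination (-(conv q a N + a N)) * hi
      rw [e]
      linarith [ha N]
  have := mul_nonneg (inv_nonneg.mpr (sub_nonneg.mpr h1.le)) (conv_nonneg h0 ha N)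
  linarith [h N]

theorem conv_one_le (h0 : 0 ≤ q) (h1 : q < 1) (k : ℕ) : conv q (fun _ => 1) k ≤ (1 - q)⁻¹ := by
  have hp : 0 < 1 - q := by linarith
  induction k with
  | zero => simpa [conv] using hp.le
  | succ k ih =>
    rw [conv_succ]
    have hi : (1 - q)⁻¹ * (1 - q) = 1 := inv_mul_cancel₀ hp.ne'
    nlinarith

/-- Jensen's inequality for the geometric weights. -/
theorem conv_sq_le (h0 : 0 ≤ q) (h1 : q < 1) (a : ℕ → ℝ) (k : ℕ) :
    conv q a k ^ 2 ≤ (1 - q)⁻¹ * conv q (fun t => a t ^ 2) k := by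
  have h := Finset.sum_sq_le_sum_mul_sum_of_sq_le_mul (Finset.range k)
    (r := fun t => q ^ (k - t) * a t) (f := fun t => q ^ (k - t) * 1)
    (g := fun t => q ^ (k - t) * a t ^ 2)
    (fun t _ => by positivity) (fun t _ => by positivity) (fun t _ => le_of_eq (by ring))
  refine h.trans (mul_le_mul_of_nonneg_right (conv_one_le h0 h1 k) ?_)
  exact conv_nonneg h0 (fun t => sq_nonneg _) k

/-- Young's inequality: convolution with a geometric sequence is bounded on `ℓ²`. -/
theorem sum_conv_sq_le (h0 : 0 ≤ q) (h1 : q < 1) (a : ℕ → ℝ) (N : ℕ) :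
    ∑ k ∈ Finset.range N, conv q a k ^ 2
      ≤ (1 - q)⁻¹ ^ 2 * ∑ k ∈ Finset.range N, a k ^ 2 := by
  calc ∑ k ∈ Finset.range N, conv q a k ^ 2
      ≤ ∑ k ∈ Finset.range N, (1 - q)⁻¹ * conv q (fun t => a t ^ 2) k :=
        Finset.sum_le_sum fun k _ => conv_sq_le h0 h1 a k
    _ ≤ (1 - q)⁻¹ * ((1 - q)⁻¹ * ∑ k ∈ Finset.range N, a k ^ 2) := by
        rw [← Finset.mul_sum]
        exact mul_le_mul_of_nonneg_left (sum_conv_le h0 h1 (fun t => sq_nonneg _) N)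
          (inv_nonneg.mpr (by linarith))
    _ = _ := by ring

theorem conv_mono (hq : 0 ≤ q) {a b : ℕ → ℝ} (h : ∀ t, a t ≤ b t) (k : ℕ) :
    conv q a k ≤ conv q b k :=
  Finset.sum_le_sum fun t _ => mul_le_mul_of_nonneg_left (h t) (pow_nonneg hq _)

end Conv

end

section

variable {V : Type*} [Fintype V]

/-! ### The augmented matrices -/

theorem mem_inNbrs {G : Digraph V} {i j : V} : j ∈ inNbrs G i ↔ j ≠ i ∧ G.Adj j i := by
  simp [inNbrs]

theorem mem_outNbrs {G : Digraph V} {i j : V} : j ∈ outNbrs G i ↔ j ≠ i ∧ G.Adj i j := by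
  simp [outNbrs]

theorem mem_outNbrs_iff_mem_inNbrs {G : Digraph V} {i j : V} :
    j ∈ outNbrs G i ↔ i ∈ inNbrs G j := by
  rw [mem_inNbrs, mem_outNbrs, ne_comm]

namespace Schedule

variable (s : Schedule V)

theorem counter_le (k : ℕ) (i j : V) : s.counter k i j ≤ k - 1 := by
  induction k with
  | zero => simp [counter]
  | succ k ih =>
    simp only [counter]
    split_ifs <;> omega

theorem counter_mono (k : ℕ) (i j : V) : s.counter k i j ≤ s.counter (k + 1) i j := by
  simp only [counter]
  split_ifs <;> omega

theorem readTime_le (k : ℕ) (j : V) : s.readTime k j ≤ k := s.counter_le (k + 1) _ j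

theorem counter_le_readTime (k : ℕ) (j : V) : s.counter k (s.active k) j ≤ s.readTime k j :=
  s.counter_mono k _ j

theorem counter_succ_of_ne {k : ℕ} {i : V} (h : i ≠ s.active k) (j : V) :
    s.counter (k + 1) i j = s.counter k i j := by
  simp [counter, h]

theorem IsAdmissible.sub_readTime_le {s : Schedule V} {G : Digraph V} {T D : ℕ}
    (hs : s.IsAdmissible G T D) {k : ℕ} {j : V} (hj : j ∈ inNbrs G (s.active k)) :
    k - s.readTime k j ≤ D := by
  have h1 := hs.bounded_delay k j hj
  have h2 : k - s.delay k j ≤ s.readTime k j := by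
    simp [readTime, counter]
  omega

end Schedule

variable {G : Digraph V} {W A : Matrix V V ℝ} {mbar : ℝ} {s : Schedule V} {T D : ℕ}

namespace IsMixingPair

theorem W_nonneg (h : IsMixingPair G W A mbar) (i j : V) : 0 ≤ W i j := by
  by_cases h1 : j = i
  · exact h1 ▸ h.pos.le.trans (h.W_diag j)
  · by_cases h2 : j ∈ inNbrs G i
    · exact h.pos.le.trans (h.W_edge i j h2)
    · exact (h.W_zero i j h1 h2).ge

theorem A_nonneg (h : IsMixingPair G W A mbar) (i j : V) : 0 ≤ A i j := by
  by_cases h1 : j = i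
  · exact h1 ▸ h.pos.le.trans (h.A_diag j)
  · by_cases h2 : j ∈ inNbrs G i
    · exact h.pos.le.trans (h.A_edge i j h2)
    · exact (h.A_zero i j h1 h2).ge

theorem sum_W (h : IsMixingPair G W A mbar) (i : V) : W i i + ∑ j ∈ inNbrs G i, W i j = 1 := by
  have hi : i ∉ inNbrs G i := by simp [mem_inNbrs]
  rw [← Finset.sum_insert hi, ← h.W_row i]
  refine Finset.sum_subset (Finset.subset_univ _) fun j _ hj => ?_
  rw [Finset.mem_insert, not_or] at hj
  exact h.W_zero i j hj.1 hj.2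

theorem sum_A (h : IsMixingPair G W A mbar) (i : V) : A i i + ∑ l ∈ outNbrs G i, A l i = 1 := by
  have hi : i ∉ outNbrs G i := by simp [mem_outNbrs]
  rw [← Finset.sum_insert (f := fun l => A l i) hi, ← h.A_col i]
  refine Finset.sum_subset (Finset.subset_univ _) fun j _ hj => ?_
  rw [Finset.mem_insert, not_or, mem_outNbrs_iff_mem_inNbrs] at hj
  exact h.A_zero j i (Ne.symm hj.1) hj.2

theorem mbar_le_one (h : IsMixingPair G W A mbar) (i : V) : mbar ≤ 1 := by
  refine (h.W_diag i).trans ?_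
  rw [← h.W_row i]
  exact Finset.single_le_sum (fun j _ => h.W_nonneg i j) (Finset.mem_univ i)

end IsMixingPair

/-- The new iterate of the active agent as a combination of the entries of the augmented
consensus vector. -/
theorem sum_consMatrix_active {E : Type*} [AddCommGroup E] [Module ℝ E]
    (hs : s.IsAdmissible G T D) (k : ℕ) (u : ConsIdx V D → E) :
    ∑ c, consMatrix G W s D k (Sum.inl (s.active k)) c • u c
      = W (s.active k) (s.active k) • u (Sum.inl (s.active k))
        + ∑ j ∈ (inNbrs G (s.active k)).attach, W (s.active k) j •
          u (Sum.inr (j.1, ⟨k - s.readTime k j.1,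
            Nat.lt_succ_of_le (hs.sub_readTime_le j.2)⟩)) := by
  rw [Fintype.sum_sum_type, Fintype.sum_prod_type]
  congr 1
  · simp [consMatrix]
  · rw [← Finset.sum_subset (Finset.subset_univ (inNbrs G (s.active k))), ← Finset.sum_attach]
    · refine Finset.sum_congr rfl fun j _ => ?_
      rw [Finset.sum_eq_single ⟨k - s.readTime k j.1,
            Nat.lt_succ_of_le (hs.sub_readTime_le j.2)⟩]
      · simp [consMatrix]
      · intro b _ hb
        have : (b : ℕ) ≠ k - s.readTime k j.1 := fun h => hb (Fin.ext h)
        simp [consMatrix, this]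
      · simp
    · intro j _ hj
      simp [consMatrix, hj]

theorem consMatrix_row_of_ne {k : ℕ} {i : V} (hi : i ≠ s.active k) (c : ConsIdx V D) :
    consMatrix G W s D k (Sum.inl i) c = if c = Sum.inl i then 1 else 0 := by
  simp [consMatrix, hi]

/-- The row of `v i`, which either takes over `x i` or is a copy. -/
theorem consMatrix_row_inr (k : ℕ) (i : V) (b : Fin (D + 1)) (c : ConsIdx V D) :
    consMatrix G W s D k (Sum.inr (i, b)) c =
      if c = (if (b : ℕ) = 0 then (if i = s.active k then Sum.inl i else Sum.inr (i, b))
        else Sum.inr (i, ⟨b - 1, by omega⟩)) then 1 else 0 := by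
  by_cases hb : (b : ℕ) = 0
  · by_cases hi : i = s.active k <;> simp [consMatrix, hb, hi]
  · rcases c with j | ⟨j, b₁⟩
    · simp [consMatrix, hb]
    · simp only [consMatrix, hb, if_false, Sum.inr.injEq, Prod.mk.injEq, Fin.ext_iff]
      congr 1
      rw [eq_iff_iff]
      constructor <;> rintro ⟨h1, h2⟩ <;> exact ⟨h1, by omega⟩

theorem consMatrix_rowStoch (hWA : IsMixingPair G W A mbar) (hs : s.IsAdmissible G T D) (k : ℕ) :
    RowStoch (consMatrix G W s D k) where
  nonneg r c := by
    rcases r with i | ⟨i, b⟩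
    · by_cases hi : i = s.active k
      · subst hi
        rcases c with j | ⟨j, b⟩ <;> simp only [consMatrix, if_true] <;> split_ifs <;>
          first | exact hWA.W_nonneg _ _ | exact le_rfl
      · rw [consMatrix_row_of_ne hi]; split_ifs <;> norm_num
    · rw [consMatrix_row_inr]; split_ifs <;> norm_num
  sum_row r := by
    rcases r with i | ⟨i, b⟩
    · by_cases hi : i = s.active k
      · subst hi
        have h := sum_consMatrix_active (W := W) hs k (fun _ => (1 : ℝ))
        simp only [smul_eq_mul, mul_one] at h
        rw [h, Finset.sum_attach (inNbrs G (s.active k)) (fun j => W (s.active k) j), hWA.sum_W]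
      · simp [consMatrix_row_of_ne hi]
    · simp [consMatrix_row_inr]

/-- A path of length `r` from the column `c` to the row `b` along entries `≥ η` is prolonged by
one more such entry. -/
theorem le_prodFrom_succ {I : Type*} [Fintype I] {M : ℕ → Matrix I I ℝ}
    (hM : ∀ k a c, 0 ≤ M k a c) {η : ℝ} (hη : 0 ≤ η) {t r : ℕ} {a b c : I}
    (h1 : η ^ r ≤ prodFrom M t r b c) (h2 : η ≤ M (t + r) a b) (h3 : ∀ x, 0 ≤ prodFrom M t r x c) :
    η ^ (r + 1) ≤ prodFrom M t (r + 1) a c := by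
  rw [prodFrom, Matrix.mul_apply, pow_succ']
  refine (mul_le_mul h2 h1 (by positivity) (hη.trans h2)).trans ?_
  exact Finset.single_le_sum (f := fun x => M (t + r) a x * prodFrom M t r x c)
    (fun x _ => mul_nonneg (hM _ _ _) (h3 x)) (Finset.mem_univ b)

/-! ### Information reaches every agent -/

theorem cons_reach_succ (hWA : IsMixingPair G W A mbar) (hs : s.IsAdmissible G T D)
    {t r : ℕ} {a b c : ConsIdx V D}
    (h1 : mbar ^ r ≤ prodFrom (consMatrix G W s D) t r b c)
    (h2 : mbar ≤ consMatrix G W s D (t + r) a b) :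
    mbar ^ (r + 1) ≤ prodFrom (consMatrix G W s D) t (r + 1) a c :=
  le_prodFrom_succ (fun k => (consMatrix_rowStoch hWA hs k).nonneg) hWA.pos.le h1 h2
    fun x => (RowStoch.prodFrom (consMatrix_rowStoch hWA hs) t r).nonneg x c

theorem cons_reach_agent_mono (hWA : IsMixingPair G W A mbar) (hs : s.IsAdmissible G T D)
    {t r r' : ℕ} {i : V} {c : ConsIdx V D} (hr : r ≤ r')
    (h : mbar ^ r ≤ prodFrom (consMatrix G W s D) t r (Sum.inl i) c) :
    mbar ^ r' ≤ prodFrom (consMatrix G W s D) t r' (Sum.inl i) c := by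
  induction r', hr using Nat.le_induction with
  | base => exact h
  | succ r' _ ih =>
    refine cons_reach_succ hWA hs ih ?_
    by_cases hi : i = s.active (t + r')
    · simp only [consMatrix, hi, if_true]
      exact hWA.W_diag _
    · rw [consMatrix_row_of_ne hi, if_pos rfl]
      exact hWA.mbar_le_one i

/-- An activation passes the weight of `x i` on to `v i`, which keeps it. -/
theorem cons_reach_inr_zero (hWA : IsMixingPair G W A mbar) (hs : s.IsAdmissible G T D)
    {t r r₁ : ℕ} {i : V} {c : ConsIdx V D}
    (h : mbar ^ r ≤ prodFrom (consMatrix G W s D) t r (Sum.inl i) c) (hr : r + T ≤ r₁) :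
    mbar ^ r₁ ≤ prodFrom (consMatrix G W s D) t r₁ (Sum.inr (i, 0)) c := by
  obtain ⟨k, hk1, hk2, hk3⟩ := hs.activation (t + r) i
  have hle : k - t + 1 ≤ r₁ := by omega
  clear hr
  induction r₁, hle using Nat.le_induction with
  | base =>
    refine cons_reach_succ hWA hs (b := Sum.inl i)
      (cons_reach_agent_mono hWA hs (by omega) h) ?_
    rw [show t + (k - t) = k by omega, consMatrix_row_inr]
    simp [hk3, hWA.mbar_le_one i]
  | succ r' hr' ih =>
    by_cases hi : i = s.active (t + r')
    · refine cons_reach_succ hWA hs (b := Sum.inl i)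
        (cons_reach_agent_mono hWA hs (by omega) h) ?_
      rw [consMatrix_row_inr]
      simp [← hi, hWA.mbar_le_one i]
    · refine cons_reach_succ hWA hs ih ?_
      rw [consMatrix_row_inr]
      simp [hi, hWA.mbar_le_one i]

/-- The memory of `v i` is filled one step per iteration. -/
theorem cons_reach_inr (hWA : IsMixingPair G W A mbar) (hs : s.IsAdmissible G T D)
    {t r : ℕ} {i : V} {c : ConsIdx V D}
    (h : mbar ^ r ≤ prodFrom (consMatrix G W s D) t r (Sum.inl i) c) (b : ℕ) :
    ∀ (hb : b < D + 1) (r₁ : ℕ), r + T + b ≤ r₁ →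
      mbar ^ r₁ ≤ prodFrom (consMatrix G W s D) t r₁ (Sum.inr (i, ⟨b, hb⟩)) c := by
  induction b with
  | zero => exact fun hb r₁ hr => cons_reach_inr_zero hWA hs h hr
  | succ b ih =>
    intro hb r₁ hr
    obtain ⟨r', rfl⟩ : ∃ r', r₁ = r' + 1 := ⟨r₁ - 1, by omega⟩
    refine cons_reach_succ hWA hs (ih (by omega) r' (by omega)) ?_
    rw [consMatrix_row_inr]
    simp [hWA.mbar_le_one i]

/-- The value of `j` is in all stored copies of `v j` after `T + D` iterations, and reaches `i` at
the next activation of `i`. -/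
theorem cons_reach_edge (hWA : IsMixingPair G W A mbar) (hs : s.IsAdmissible G T D)
    {t r r₁ : ℕ} {i j : V} {c : ConsIdx V D} (hj : j ∈ inNbrs G i)
    (h : mbar ^ r ≤ prodFrom (consMatrix G W s D) t r (Sum.inl j) c) (hr : r + 2 * T + D ≤ r₁) :
    mbar ^ r₁ ≤ prodFrom (consMatrix G W s D) t r₁ (Sum.inl i) c := by
  obtain ⟨k, hk1, hk2, rfl⟩ := hs.activation (t + r + T + D) i
  have hD := hs.sub_readTime_le hj
  refine cons_reach_agent_mono hWA hs (r := k - t + 1) (by omega) ?_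
  refine cons_reach_succ hWA hs
    (cons_reach_inr hWA hs h (k - s.readTime k j) (by omega) (k - t) (by omega)) ?_
  rw [show t + (k - t) = k by omega]
  simpa [consMatrix, hj] using hWA.W_edge _ _ hj

theorem exists_cons_reach_pair (hWA : IsMixingPair G W A mbar) (T D : ℕ) {i j : V}
    (hij : Relation.ReflTransGen G.Adj j i) :
    ∃ R, ∀ s : Schedule V, s.IsAdmissible G T D → ∀ t r, R ≤ r →
      mbar ^ r ≤ prodFrom (consMatrix G W s D) t r (Sum.inl i) (Sum.inl j) := by
  induction hij with
  | refl =>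
    refine ⟨0, fun s hs t r hr => cons_reach_agent_mono hWA hs hr ?_⟩
    simp [prodFrom]
  | @tail a b _ hab ih =>
    obtain ⟨R, hR⟩ := ih
    by_cases h : a = b
    · exact ⟨R, h ▸ hR⟩
    · exact ⟨R + 2 * T + D, fun s hs t r hr =>
        cons_reach_edge hWA hs (mem_inNbrs.mpr ⟨h, hab⟩) (hR s hs t R le_rfl) hr⟩

/-- After `R` iterations, the value of every agent has reached every entry of the augmented
consensus vector. -/
theorem exists_cons_reach (hG : StronglyConnected G) (hWA : IsMixingPair G W A mbar) (T D : ℕ) :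
    ∃ R, ∀ s : Schedule V, s.IsAdmissible G T D → ∀ t r, R ≤ r → ∀ a j,
      mbar ^ r ≤ prodFrom (consMatrix G W s D) t r a (Sum.inl j) := by
  choose R hR using fun p : V × V => exists_cons_reach_pair hWA T D (hG p.2 p.1)
  refine ⟨Finset.univ.sup R + T + D, fun s hs t r hr a j => ?_⟩
  have hle : ∀ i, R (i, j) ≤ Finset.univ.sup R := fun i => Finset.le_sup (Finset.mem_univ _)
  rcases a with i | ⟨i, b, hb⟩
  · exact hR (i, j) s hs t r (by have := hle i; omega)
  · exact cons_reach_inr hWA hs (hR (i, j) s hs t _ le_rfl) b hb r (by have := hle i; omega)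

/-! ### Mass reaches every agent -/

theorem sum_edge {E : Type*} [AddCommMonoid E] (φ : V → V → E) :
    ∑ e : Edge G, φ e.1.1 e.1.2 = ∑ i, ∑ j ∈ inNbrs G i, φ j i := by
  rw [← Finset.sum_subtype (Finset.univ.filter fun e : V × V => e.1 ∈ inNbrs G e.2)
    (by simp) (fun e : V × V => φ e.1 e.2), Finset.sum_filter, Fintype.sum_prod_type_right]
  refine Finset.sum_congr rfl fun i _ => ?_
  rw [← Finset.sum_filter]
  exact Finset.sum_congr (by ext; simp) fun _ _ => rfl

theorem pushVec_nonneg (hWA : IsMixingPair G W A mbar) (i : V) (r : MassIdx G D) :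
    0 ≤ pushVec G A D i r := by
  rcases r with r | ⟨e, d⟩ <;> simp only [pushVec] <;> split_ifs <;>
    first | exact hWA.A_nonneg _ _ | exact le_rfl

theorem sum_pushVec (hWA : IsMixingPair G W A mbar) (i : V) :
    ∑ r, pushVec G A D i r = 1 := by
  rw [Fintype.sum_sum_type, Fintype.sum_prod_type]
  have h1 : ∀ e : Edge G, ∑ d : Fin (D + 1), pushVec G A D i (Sum.inr (e, d))
      = if e.1.1 = i then A e.1.2 i else 0 := by
    intro e
    rw [Finset.sum_eq_single 0]
    · simp [pushVec]
    · intro d _ hd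
      have : (d : ℕ) ≠ 0 := fun h => hd (Fin.ext h)
      simp [pushVec, this]
    · simp
  rw [Finset.sum_congr rfl fun e _ => h1 e, sum_edge (fun j l => if j = i then A l i else 0),
    ← hWA.sum_A i]
  congr 1
  · simp [pushVec]
  · rw [Finset.sum_congr rfl fun l _ => Finset.sum_ite_eq' (inNbrs G l) i (fun _ => A l i),
      ← Finset.sum_filter]
    refine Finset.sum_congr ?_ fun _ _ => rfl
    ext l
    simp [mem_outNbrs_iff_mem_inNbrs]

/-- Where the mass at the virtual node `(e, d)` goes if it is not collected. -/
theorem massMatrix_inr_of_not {k : ℕ} {e : Edge G} {d : Fin (D + 1)}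
    (h : ¬ (e.1.2 = s.active k ∧ k - s.readTime k e.1.1 ≤ d)) (r : MassIdx G D) :
    massMatrix G A s D k r (Sum.inr (e, d))
      = if r = Sum.inr (e, ⟨min (d + 1) D, by omega⟩) then 1 else 0 := by
  simp only [massMatrix, if_neg h]
  rcases r with r | ⟨e₁, d₁⟩
  · simp
  · simp [Fin.ext_iff]

theorem massMatrix_inr_collected {k : ℕ} {e : Edge G} {d : Fin (D + 1)}
    (h : e.1.2 = s.active k ∧ k - s.readTime k e.1.1 ≤ d) (r : MassIdx G D) :
    massMatrix G A s D k r (Sum.inr (e, d)) = pushVec G A D (s.active k) r := by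
  simp only [massMatrix, if_pos h]
  rw [h.1]

theorem massMatrix_inl_active (k : ℕ) (r : MassIdx G D) :
    massMatrix G A s D k r (Sum.inl (s.active k)) = pushVec G A D (s.active k) r := by
  simp [massMatrix]

theorem massMatrix_inl_of_ne {k : ℕ} {j : V} (hj : j ≠ s.active k) (r : MassIdx G D) :
    massMatrix G A s D k r (Sum.inl j) = if r = Sum.inl j then 1 else 0 := by
  simp [massMatrix, hj]

theorem massMatrix_colStoch (hWA : IsMixingPair G W A mbar) (s : Schedule V) (D k : ℕ) :
    ColStoch (massMatrix G A s D k) := by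
  have key : ∀ c : MassIdx G D,
      (∀ r, massMatrix G A s D k r c = pushVec G A D (s.active k) r) ∨
      ∃ r₀, ∀ r, massMatrix G A s D k r c = if r = r₀ then 1 else 0 := by
    rintro (j | ⟨e, d⟩)
    · by_cases hj : j = s.active k
      · exact Or.inl (by subst hj; exact massMatrix_inl_active k)
      · exact Or.inr ⟨_, massMatrix_inl_of_ne hj⟩
    · by_cases h : e.1.2 = s.active k ∧ k - s.readTime k e.1.1 ≤ d
      · exact Or.inl (massMatrix_inr_collected h)
      · exact Or.inr ⟨_, massMatrix_inr_of_not h⟩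
  refine ⟨fun r c => ?_, fun c => ?_⟩
  · rcases key c with h | ⟨r₀, h⟩
    · rw [h]; exact pushVec_nonneg hWA _ _
    · rw [h]; split_ifs <;> norm_num
  · rcases key c with h | ⟨r₀, h⟩
    · simp only [h]; exact sum_pushVec hWA _
    · simp [h]

theorem mass_reach_succ (hWA : IsMixingPair G W A mbar)
    {t r : ℕ} {a b c : MassIdx G D}
    (h1 : mbar ^ r ≤ prodFrom (massMatrix G A s D) t r b c)
    (h2 : mbar ≤ massMatrix G A s D (t + r) a b) :
    mbar ^ (r + 1) ≤ prodFrom (massMatrix G A s D) t (r + 1) a c :=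
  le_prodFrom_succ (fun k => (massMatrix_colStoch hWA s D k).nonneg) hWA.pos.le h1 h2
    fun x => (ColStoch.prodFrom (massMatrix_colStoch hWA s D) t r).nonneg x c

theorem mass_reach_agent_mono (hWA : IsMixingPair G W A mbar)
    {t r r' : ℕ} {i : V} {c : MassIdx G D} (hr : r ≤ r')
    (h : mbar ^ r ≤ prodFrom (massMatrix G A s D) t r (Sum.inl i) c) :
    mbar ^ r' ≤ prodFrom (massMatrix G A s D) t r' (Sum.inl i) c := by
  induction r', hr using Nat.le_induction with
  | base => exact h
  | succ r' _ ih =>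
    refine mass_reach_succ hWA ih ?_
    by_cases hi : i = s.active (t + r')
    · rw [hi, massMatrix_inl_active]
      simpa [pushVec] using hWA.A_diag _
    · rw [massMatrix_inl_of_ne hi, if_pos rfl]
      exact hWA.mbar_le_one i

/-- Mass on its way along an edge is collected, or it ages. -/
theorem mass_reach_inr_or (hWA : IsMixingPair G W A mbar)
    {t r r' : ℕ} {e : Edge G} {d : Fin (D + 1)} {c : MassIdx G D} (hr : r ≤ r')
    (h : mbar ^ r ≤ prodFrom (massMatrix G A s D) t r (Sum.inr (e, d)) c) :
    mbar ^ r' ≤ prodFrom (massMatrix G A s D) t r' (Sum.inl e.1.2) c ∨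
    mbar ^ r' ≤ prodFrom (massMatrix G A s D) t r'
      (Sum.inr (e, ⟨min (d + (r' - r)) D, by omega⟩)) c := by
  induction r', hr using Nat.le_induction with
  | base =>
    right
    have : (⟨min (d + (r - r)) D, by omega⟩ : Fin (D + 1)) = d := by
      ext; simp; omega
    rwa [this]
  | succ r' hr' ih =>
    rcases ih with ih | ih
    · exact Or.inl (mass_reach_agent_mono hWA (Nat.le_succ _) ih)
    · by_cases hc : e.1.2 = s.active (t + r') ∧
        t + r' - s.readTime (t + r') e.1.1 ≤ min (d + (r' - r)) D
      · refine Or.inl (mass_reach_succ hWA ih ?_)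
        rw [massMatrix_inr_collected hc, hc.1]
        simpa [pushVec] using hWA.A_diag _
      · refine Or.inr (mass_reach_succ hWA ih ?_)
        rw [massMatrix_inr_of_not hc, if_pos]
        · exact hWA.mbar_le_one e.1.2
        · simp only [Sum.inr.injEq, Prod.mk.injEq, Fin.mk.injEq, true_and]
          omega

/-- Mass on its way reaches age `D` if it is not collected before, and is then collected at the next
activation, since the message read has age at most `D`. -/
theorem mass_reach_of_inr (hWA : IsMixingPair G W A mbar) (hs : s.IsAdmissible G T D)
    {t r r₁ : ℕ} {e : Edge G} {d : Fin (D + 1)} {c : MassIdx G D} (hr : r + D + T ≤ r₁)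
    (h : mbar ^ r ≤ prodFrom (massMatrix G A s D) t r (Sum.inr (e, d)) c) :
    mbar ^ r₁ ≤ prodFrom (massMatrix G A s D) t r₁ (Sum.inl e.1.2) c := by
  obtain ⟨k, hk1, hk2, hk3⟩ := hs.activation (t + r + D) e.1.2
  refine mass_reach_agent_mono hWA (r := k - t + 1) (by omega) ?_
  have hk : t + (k - t) = k := by omega
  rcases mass_reach_inr_or hWA (r' := k - t) (by omega) h with h1 | h1
  · exact mass_reach_agent_mono hWA (Nat.le_succ _) h1
  · have hD := hs.sub_readTime_le (k := k) (j := e.1.1) (hk3 ▸ e.2)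
    refine mass_reach_succ hWA h1 ?_
    rw [hk, massMatrix_inr_collected ⟨hk3.symm, by simp only; omega⟩, hk3]
    simpa [pushVec] using hWA.A_diag _

/-- Agent `j` pushes mass into the edge at its next activation, which `i` then collects. -/
theorem mass_reach_edge (hWA : IsMixingPair G W A mbar) (hs : s.IsAdmissible G T D)
    {t r r₁ : ℕ} {i j : V} {c : MassIdx G D} (hj : j ∈ inNbrs G i)
    (h : mbar ^ r ≤ prodFrom (massMatrix G A s D) t r (Sum.inl j) c) (hr : r + 2 * T + D ≤ r₁) :
    mbar ^ r₁ ≤ prodFrom (massMatrix G A s D) t r₁ (Sum.inl i) c := by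
  obtain ⟨k, hk1, hk2, hk3⟩ := hs.activation (t + r) j
  refine mass_reach_of_inr hWA hs (e := ⟨(j, i), hj⟩) (d := 0) (r := k - t + 1) (by omega) ?_
  refine mass_reach_succ hWA (mass_reach_agent_mono hWA (by omega) h) ?_
  subst hk3
  rw [show t + (k - t) = k by omega, massMatrix_inl_active]
  simpa [pushVec] using hWA.A_edge _ _ hj

theorem exists_mass_reach_pair (hWA : IsMixingPair G W A mbar) (T D : ℕ) {i j : V}
    (hij : Relation.ReflTransGen G.Adj j i) :
    ∃ R, ∀ s : Schedule V, s.IsAdmissible G T D → ∀ t r r₁, r + R ≤ r₁ → ∀ c,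
      mbar ^ r ≤ prodFrom (massMatrix G A s D) t r (Sum.inl j) c →
      mbar ^ r₁ ≤ prodFrom (massMatrix G A s D) t r₁ (Sum.inl i) c := by
  induction hij with
  | refl => exact ⟨0, fun s hs t r r₁ hr c h => mass_reach_agent_mono hWA hr h⟩
  | @tail a b _ hab ih =>
    obtain ⟨R, hR⟩ := ih
    by_cases h : a = b
    · exact ⟨R, h ▸ hR⟩
    · exact ⟨R + 2 * T + D, fun s hs t r r₁ hr c hc =>
        mass_reach_edge hWA hs (mem_inNbrs.mpr ⟨h, hab⟩) (hR s hs t r (r + R) le_rfl c hc)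
          (by omega)⟩

/-- After `R` iterations, a part of the mass of every node has reached every agent. -/
theorem exists_mass_reach (hG : StronglyConnected G) (hWA : IsMixingPair G W A mbar) (T D : ℕ) :
    ∃ R, ∀ s : Schedule V, s.IsAdmissible G T D → ∀ t r, R ≤ r → ∀ i c,
      mbar ^ r ≤ prodFrom (massMatrix G A s D) t r (Sum.inl i) c := by
  choose R hR using fun p : V × V => exists_mass_reach_pair (G := G) hWA T D (hG p.2 p.1)
  refine ⟨D + T + Finset.univ.sup R, fun s hs t r hr i c => ?_⟩
  have hle : ∀ j, R (i, j) ≤ Finset.univ.sup R := fun i => Finset.le_sup (Finset.mem_univ _)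
  have h0 : mbar ^ 0 ≤ prodFrom (massMatrix G A s D) t 0 c c := by simp [prodFrom]
  rcases c with j | ⟨e, d⟩
  · exact hR (i, j) s hs t 0 r (by have := hle j; omega) _ h0
  · exact hR (i, e.1.2) s hs t (D + T) r (by have := hle e.1.2; omega) _
      (mass_reach_of_inr hWA hs (by omega) h0)

end

section

variable {V : Type*} [Fintype V] {G : Digraph V} {W A : Matrix V V ℝ} {mbar : ℝ} {T D : ℕ}

/-! ### Mixing rates and lower bounds -/

/-- After `R` iterations, all entries in the agent rows of the tracking products and in the agent
columns of the consensus products are bounded away from zero, uniformly in the schedule. -/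
theorem exists_entry_lower_bound [Nonempty V] (hG : StronglyConnected G)
    (hWA : IsMixingPair G W A mbar) (T D : ℕ) :
    ∃ (R : ℕ) (η : ℝ), 0 < R ∧ 0 < η ∧ η ≤ 1 ∧ ∀ s : Schedule V, s.IsAdmissible G T D →
      (∀ t r, R ≤ r → ∀ i c, η ≤ prodFrom (massMatrix G A s D) t r (Sum.inl i) c) ∧
      (∀ t r, R ≤ r → ∀ a j, η ≤ prodFrom (consMatrix G W s D) t r a (Sum.inl j)) := by
  obtain ⟨R₁, h₁⟩ := exists_mass_reach hG hWA T D
  obtain ⟨R₂, h₂⟩ := exists_cons_reach hG hWA T D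
  -- longer products average the entries of products of `max R₁ R₂ + 1` factors
  refine ⟨max R₁ R₂ + 1, mbar ^ (max R₁ R₂ + 1), Nat.succ_pos _, pow_pos hWA.pos _,
    pow_le_one₀ hWA.pos.le (hWA.mbar_le_one (Classical.arbitrary V)), fun s hs => ⟨?_, ?_⟩⟩
  · intro t r hr i c
    obtain ⟨r', rfl⟩ : ∃ r', r = r' + (max R₁ R₂ + 1) := ⟨r - (max R₁ R₂ + 1), by omega⟩
    have hP := ColStoch.prodFrom (massMatrix_colStoch hWA s D) t r'
    rw [prodFrom_add, Matrix.mul_apply]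
    calc mbar ^ (max R₁ R₂ + 1)
        = ∑ x, mbar ^ (max R₁ R₂ + 1) * prodFrom (massMatrix G A s D) t r' x c := by
          rw [← Finset.mul_sum, hP.sum_col, mul_one]
      _ ≤ _ := Finset.sum_le_sum fun x _ =>
          mul_le_mul_of_nonneg_right (h₁ s hs _ _ (by omega) i x) (hP.nonneg x c)
  · intro t r hr a j
    obtain ⟨r', rfl⟩ : ∃ r', r = (max R₁ R₂ + 1) + r' := ⟨r - (max R₁ R₂ + 1), by omega⟩
    have hP := RowStoch.prodFrom (consMatrix_rowStoch hWA hs) (t + (max R₁ R₂ + 1)) r'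
    rw [prodFrom_add, Matrix.mul_apply]
    calc mbar ^ (max R₁ R₂ + 1)
        = ∑ x, prodFrom (consMatrix G W s D) (t + (max R₁ R₂ + 1)) r' a x
            * mbar ^ (max R₁ R₂ + 1) := by
          rw [← Finset.sum_mul, hP.sum_row, one_mul]
      _ ≤ _ := Finset.sum_le_sum fun x _ =>
          mul_le_mul_of_nonneg_left (h₂ s hs _ _ (by omega) x j) (hP.nonneg a x)

/-- The columns of the tracking products and the rows of the consensus products become equal at a
geometric rate, uniformly in the schedule. -/
theorem exists_mixing_rate [Nonempty V] (hG : StronglyConnected G)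
    (hWA : IsMixingPair G W A mbar) (T D : ℕ) :
    ∃ C q : ℝ, 0 < C ∧ 0 < q ∧ q < 1 ∧ ∀ s : Schedule V, s.IsAdmissible G T D →
      (∀ t r a b c, |prodFrom (massMatrix G A s D) t r c a
        - prodFrom (massMatrix G A s D) t r c b| ≤ C * q ^ r) ∧
      (∀ t r a b c, |prodFrom (consMatrix G W s D) t r a c
        - prodFrom (consMatrix G W s D) t r b c| ≤ C * q ^ r) := by
  obtain ⟨R, η, hR, hη, hη1, h⟩ := exists_entry_lower_bound hG hWA T D
  obtain ⟨C, q, hC, hq, hq1, hCq⟩ := exists_geometric_rate hR hη hη1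
  have j₀ := Classical.arbitrary V
  refine ⟨C, q, hC, hq, hq1, fun s hs => ⟨fun t r a b c => ?_, fun t r a b c => ?_⟩⟩
  · have key := ColStoch.prodFrom_sub_le (massMatrix_colStoch hWA s D) hη1
      (fun t => ⟨Sum.inl j₀, fun c => (h s hs).1 t R le_rfl j₀ c⟩) (r / R) t r
      (Nat.div_mul_le_self r R)
    rw [abs_sub_le_iff]
    exact ⟨(key a b c).trans (hCq r), (key b a c).trans (hCq r)⟩
  · have key := RowStoch.prodFrom_sub_le (consMatrix_rowStoch hWA hs) hη1
      (fun t => ⟨Sum.inl j₀, fun a => (h s hs).2 t R le_rfl a j₀⟩) t (r / R) r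
      (Nat.div_mul_le_self r R)
    rw [abs_sub_le_iff]
    exact ⟨(key a b c).trans (hCq r), (key b a c).trans (hCq r)⟩

/-- If the rows of the products become equal, then each entry converges. -/
theorem exists_tendsto_prodFrom {I : Type*} [Fintype I] {M : ℕ → Matrix I I ℝ}
    (hM : ∀ k, RowStoch (M k)) {C q : ℝ} (hq : 0 < q) (hq1 : q < 1)
    (h : ∀ t r a b c, |prodFrom M t r a c - prodFrom M t r b c| ≤ C * q ^ r) (t : ℕ) (a c : I) :
    ∃ x, Tendsto (fun r => prodFrom M t r a c) atTop (𝓝 x) ∧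
      ∀ r b, |prodFrom M t r b c - x| ≤ C * q ^ r := by
  have key : ∀ r r', r ≤ r' → ∀ b,
      |prodFrom M t r' a c - prodFrom M t r b c| ≤ C * q ^ r := by
    intro r r' hr b
    obtain ⟨r'', rfl⟩ := Nat.exists_eq_add_of_le hr
    have hP := RowStoch.prodFrom hM (t + r) r''
    rw [prodFrom_add, Matrix.mul_apply]
    exact abs_sum_mul_sub_le (hP.nonneg a) (hP.sum_row a) fun x => h t r x b c
  have hc : CauchySeq fun r => prodFrom M t r a c := by
    refine cauchySeq_of_le_tendsto_0' (fun r => C * q ^ r) (fun n m hnm => ?_) ?_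
    · rw [dist_comm]
      exact key n m hnm a
    · simpa using (tendsto_pow_atTop_nhds_zero_of_lt_one hq.le hq1).const_mul C
  obtain ⟨x, hx⟩ := cauchySeq_tendsto_of_complete hc
  refine ⟨x, hx, fun r b => ?_⟩
  rw [abs_sub_comm]
  refine le_of_tendsto (hx.sub_const _).abs ?_
  filter_upwards [eventually_ge_atTop r] with r' hr'
  exact key r r' hr' b

/-! ### Measurability of the random matrices -/

section Measurability

variable {Ω : Type*} {m : MeasurableSpace Ω}

theorem measurable_index {β : Type*} [MeasurableSpace β] {a : Ω → V}
    (ha : ∀ i, MeasurableSet[m] {ω | a ω = i}) {f : V → Ω → β} (hf : ∀ i, Measurable[m] (f i)) :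
    Measurable[m] fun ω => f (a ω) ω := by
  intro S hS
  have : (fun ω => f (a ω) ω) ⁻¹' S = ⋃ i, {ω | a ω = i} ∩ f i ⁻¹' S := by
    ext ω
    simp
  rw [this]
  exact MeasurableSet.iUnion fun i => (ha i).inter (hf i hS)

variable {s : Ω → Schedule V}

theorem measurableSet_eq_active (ha : ∀ k i, MeasurableSet[m] {ω | (s ω).active k = i})
    (k : ℕ) (i : V) : MeasurableSet[m] {ω | i = (s ω).active k} := by
  simpa only [eq_comm] using ha k i

theorem measurable_counter (ha : ∀ k i, MeasurableSet[m] {ω | (s ω).active k = i})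
    (hd : ∀ k j d, MeasurableSet[m] {ω | (s ω).delay k j = d}) (k : ℕ) (i j : V) :
    Measurable[m] fun ω => (s ω).counter k i j := by
  induction k with
  | zero => exact measurable_const
  | succ k ih =>
    have h : Measurable[m] fun ω => (s ω).delay k j := measurable_to_countable' fun d => hd k j d
    exact Measurable.ite (measurableSet_eq_active ha k i) (ih.max (measurable_const.sub h)) ih

theorem measurable_readTime (ha : ∀ k i, MeasurableSet[m] {ω | (s ω).active k = i})
    (hd : ∀ k j d, MeasurableSet[m] {ω | (s ω).delay k j = d}) (k : ℕ) (j : V) :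
    Measurable[m] fun ω => (s ω).readTime k j :=
  measurable_index (ha k) fun i => measurable_counter ha hd (k + 1) i j

theorem measurable_consMatrix (ha : ∀ k i, MeasurableSet[m] {ω | (s ω).active k = i})
    (hd : ∀ k j d, MeasurableSet[m] {ω | (s ω).delay k j = d}) (k : ℕ) (r c : ConsIdx V D) :
    Measurable[m] fun ω => consMatrix G W (s ω) D k r c := by
  have hr := fun j => measurable_readTime ha hd k j
  have hset := measurableSet_eq_active ha k
  rcases r with i | ⟨i, b⟩
  · refine Measurable.ite (hset i) ?_ measurable_const
    rcases c with j | ⟨j, b⟩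
    · exact measurable_const
    · refine Measurable.ite ?_ measurable_const measurable_const
      refine (MeasurableSet.const (j ∈ inNbrs G i)).inter ?_
      exact (measurable_const.sub (hr j)) (t := {x | (b : ℕ) = x}) trivial
  · simp only [consMatrix_row_inr]
    by_cases hb : (b : ℕ) = 0
    · simp only [hb, if_true]
      refine Measurable.ite ?_ measurable_const measurable_const
      by_cases h1 : c = Sum.inl i
      · by_cases h2 : c = Sum.inr (i, b)
        · simp [h1] at h2
        · convert hset i using 2
          ext ω
          split_ifs with h <;> simp_all
      · by_cases h2 : c = Sum.inr (i, b)
        · convert (hset i).compl using 2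
          ext ω
          simp only [Set.mem_ofPred_eq, Set.mem_compl_iff]
          split_ifs with h <;> simp_all
        · convert @MeasurableSet.empty Ω m using 2
          ext ω
          simp only [Set.mem_ofPred_eq, Set.mem_empty_iff_false]
          split_ifs with h <;> simp_all
    · simp only [hb, if_false]
      exact measurable_const

theorem measurable_massMatrix (ha : ∀ k i, MeasurableSet[m] {ω | (s ω).active k = i})
    (hd : ∀ k j d, MeasurableSet[m] {ω | (s ω).delay k j = d}) (k : ℕ) (r c : MassIdx G D) :
    Measurable[m] fun ω => massMatrix G A (s ω) D k r c := by
  have hr := fun j => measurable_readTime ha hd k j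
  have hset := measurableSet_eq_active ha k
  rcases c with j | ⟨e, d⟩
  · exact Measurable.ite (hset j) measurable_const measurable_const
  · refine Measurable.ite ?_ measurable_const measurable_const
    exact (hset _).inter ((measurable_const.sub (hr _)) (t := {x | x ≤ (d : ℕ)}) trivial)

theorem measurable_prodFrom {I : Type*} [Fintype I] {M : Ω → ℕ → Matrix I I ℝ}
    (hM : ∀ k r c, Measurable[m] fun ω => M ω k r c) (t r : ℕ) (a c : I) :
    Measurable[m] fun ω => prodFrom (M ω) t r a c := by
  induction r generalizing a with
  | zero => exact measurable_const
  | succ r ih =>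
    simp only [prodFrom, Matrix.mul_apply]
    exact Finset.measurable_sum _ fun x _ => (hM _ _ _).mul (ih x)

end Measurability

/-! ### Existence of the mixing weights -/

theorem exists_isMixingLimits [Nonempty V] {Ω : Type*} [mΩ : MeasurableSpace Ω]
    (hG : StronglyConnected G) (hWA : IsMixingPair G W A mbar) {s : Ω → Schedule V}
    (hs : ∀ ω, (s ω).IsAdmissible G T D)
    (ha : ∀ k i, MeasurableSet {ω | (s ω).active k = i})
    (hd : ∀ k j d, MeasurableSet {ω | (s ω).delay k j = d}) :
    ∃ (ξ : Ω → ℕ → MassIdx G D → ℝ) (ψ : Ω → ℕ → ConsIdx V D → ℝ),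
      IsMixingLimits G W A s D ξ ψ := by
  obtain ⟨C, q, hC, hq, hq1, hCq⟩ := exists_mixing_rate hG hWA T D
  have j₀ := Classical.arbitrary V
  choose ψ hψ using fun ω => exists_tendsto_prodFrom (consMatrix_rowStoch hWA (hs ω)) hq hq1
    (hCq (s ω) (hs ω)).2
  -- `ξ k` is a column of the product of all matrices before time `k`, `ψ t` the limit of the rows
  refine ⟨fun ω k r => prodFrom (massMatrix G A (s ω) D) 0 k r (Sum.inl j₀),
    fun ω t c => ψ ω t (Sum.inl j₀) c, fun k r => ?_, fun t c => ?_, C, q, hC, hq, hq1,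
    fun ω => ⟨⟨fun k => ?_, fun t k htk i j => ?_⟩, ⟨fun t => ?_, fun t k htk r c => ?_⟩⟩⟩
  · exact measurable_prodFrom (measurable_massMatrix ha hd) 0 k r _
  · exact measurable_of_tendsto_metrizable
      (fun r => measurable_prodFrom (measurable_consMatrix (W := W) (G := G) ha hd) t r _ c)
      (tendsto_pi_nhds.mpr fun ω => (hψ ω t (Sum.inl j₀) c).1)
  · have h := ColStoch.prodFrom (massMatrix_colStoch (G := G) hWA (s ω) D) 0 k
    exact ⟨fun r => h.nonneg r _, h.sum_col _⟩
  · obtain ⟨r, rfl⟩ := Nat.exists_eq_add_of_le htk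
    have hP := ColStoch.prodFrom (massMatrix_colStoch (G := G) hWA (s ω) D) 0 t
    simp only [prodFrom_add, Matrix.mul_apply, Nat.add_sub_cancel_left, zero_add]
    rw [abs_sub_comm]
    simp only [mul_comm (prodFrom (massMatrix G A (s ω) D) t r _ _)]
    exact abs_sum_mul_sub_le (fun x => hP.nonneg x _) (hP.sum_col _)
      fun x => (hCq (s ω) (hs ω)).1 t r x _ _
  · refine (isClosed_stdSimplex ℝ (ConsIdx V D)).mem_of_tendsto
      (tendsto_pi_nhds.mpr fun c => (hψ ω t (Sum.inl j₀) c).1) (Eventually.of_forall fun r => ?_)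
    have h := RowStoch.prodFrom (consMatrix_rowStoch hWA (hs ω)) t r
    exact ⟨h.nonneg _, h.sum_row _⟩
  · exact (hψ ω t (Sum.inl j₀) c).2 (k - t) r

/-! ### Properties of given mixing weights -/

section Weights

variable {s : Schedule V} {C q : ℝ} {ψ : ℕ → ConsIdx V D → ℝ} {ξ : ℕ → MassIdx G D → ℝ}

theorem IsConsensusLimit.tendsto (h : IsConsensusLimit G W s D C q ψ) (hq : 0 < q) (hq1 : q < 1)
    (t : ℕ) (a c : ConsIdx V D) :
    Tendsto (fun r => prodFrom (consMatrix G W s D) t r a c) atTop (𝓝 (ψ t c)) := by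
  rw [tendsto_iff_norm_sub_tendsto_zero]
  refine squeeze_zero (fun _ => norm_nonneg _) (fun r => ?_)
    (by simpa using (tendsto_pow_atTop_nhds_zero_of_lt_one hq.le hq1).const_mul C)
  simpa using h.2 t (t + r) (Nat.le_add_right _ _) a c

/-- The consensus weights are a left fixed sequence of the consensus matrices. -/
theorem IsConsensusLimit.sum_mul (h : IsConsensusLimit G W s D C q ψ) (hq : 0 < q) (hq1 : q < 1)
    [Nonempty V] (t : ℕ) (c : ConsIdx V D) :
    ∑ a, ψ (t + 1) a * consMatrix G W s D t a c = ψ t c := by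
  have a₀ : ConsIdx V D := Sum.inl (Classical.arbitrary V)
  refine tendsto_nhds_unique ?_
    ((h.tendsto hq hq1 t a₀ c).comp (tendsto_add_atTop_nat 1))
  simp only [Function.comp_def, prodFrom_succ_left, Matrix.mul_apply]
  exact tendsto_finsetSum _ fun x _ => (h.tendsto hq hq1 (t + 1) a₀ x).mul_const _

theorem IsConsensusLimit.le_weight (h : IsConsensusLimit G W s D C q ψ) (hq : 0 < q)
    (hq1 : q < 1) {R : ℕ} {η : ℝ} {j : V}
    (hR : ∀ t r, R ≤ r → ∀ a, η ≤ prodFrom (consMatrix G W s D) t r a (Sum.inl j)) (t : ℕ) :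
    η ≤ ψ t (Sum.inl j) := by
  refine ge_of_tendsto (h.tendsto hq hq1 t (Sum.inl j) (Sum.inl j)) ?_
  filter_upwards [eventually_ge_atTop R] with r hr using hR t r hr _

theorem le_one_of_mem_stdSimplex {I : Type*} [Fintype I] {p : I → ℝ} (h : p ∈ stdSimplex ℝ I)
    (i : I) : p i ≤ 1 := by
  rw [← h.2]
  exact Finset.single_le_sum (fun j _ => h.1 j) (Finset.mem_univ i)

end Weights

end

section

variable {V : Type*} [Fintype V] {G : Digraph V} {W A : Matrix V V ℝ} {mbar : ℝ} {T D n : ℕ}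

/-! ### The algorithm as a linear recursion -/

/-- A trajectory of the algorithm for one outcome. The samples enter only through `N k j`, the
error of the last stochastic gradient which agent `j` has evaluated before time `k`; `m` are the
tracking variables of the algorithm and `y` those driven by the exact gradients. -/
structure IsPath (G : Digraph V) (W A : Matrix V V ℝ) (dF : V → Vec n → Vec n) (γ : ℕ → ℝ)
    (s : Schedule V) (x v : ℕ → V → Vec n) (m y : ℕ → Mass V n) (N : ℕ → V → Vec n) : Prop where
  x_zero : ∀ i, x 0 i = 0
  v_zero : ∀ i, v 0 i = 0
  m_zero : m 0 = Mass.init fun i => dF i 0 + N 0 i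
  y_zero : y 0 = Mass.init fun i => dF i 0
  v_succ : ∀ k, v (k + 1) = Function.update (v k) (s.active k)
    (x k (s.active k) - γ k • (m k).z (s.active k))
  x_succ : ∀ k, x (k + 1) = Function.update (x k) (s.active k)
    (W (s.active k) (s.active k) • (x k (s.active k) - γ k • (m k).z (s.active k))
      + ∑ j ∈ inNbrs G (s.active k), W (s.active k) j • v (s.readTime k j) j)
  m_succ : ∀ k, m (k + 1) = massStep G A s k m
    (dF (s.active k) (x (k + 1) (s.active k)) - dF (s.active k) (x k (s.active k))
      + (N (k + 1) (s.active k) - N k (s.active k)))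
  y_succ : ∀ k, y (k + 1) = massStep G A s k y
    (dF (s.active k) (x (k + 1) (s.active k)) - dF (s.active k) (x k (s.active k)))
  N_succ : ∀ k j, j ≠ s.active k → N (k + 1) j = N k j

theorem massStep_congr {s : Schedule V} {k : ℕ} {past past' : ℕ → Mass V n}
    (h : ∀ t, t ≤ k → past t = past' t) (Δ : Vec n) :
    massStep G A s k past Δ = massStep G A s k past' Δ := by
  have h1 : ∀ j, past (s.readTime k j) = past' (s.readTime k j) :=
    fun j => h _ (s.readTime_le k j)
  simp only [massStep, h k le_rfl, h1]

theorem exactMass_succ (dF : V → Vec n → Vec n) (s : Schedule V) (x : ℕ → V → Vec n) (k : ℕ) :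
    exactMass G A dF s x (k + 1) = massStep G A s k (exactMass G A dF s x)
      (dF (s.active k) (x (k + 1) (s.active k)) - dF (s.active k) (x k (s.active k))) := by
  rw [exactMass]
  exact massStep_congr (fun t ht => by rw [min_eq_left ht]) _

section Run

variable {Z : Type*} (g : V → Vec n → Z → Vec n) (γ : ℕ → ℝ) (s : Schedule V) (ζ₀ : Z) (ζ : ℕ → Z)

theorem run_succ (k : ℕ) : run G W A g γ s ζ₀ ζ (k + 1)
    = step G W A g γ s ζ k (run G W A g γ s ζ₀ ζ) := by
  have h1 : ∀ j, min (s.readTime k j) k = s.readTime k j :=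
    fun j => min_eq_left (s.readTime_le k j)
  rw [run]
  simp only [step, h1, min_self]
  congr 1
  exact massStep_congr (fun t ht => by rw [min_eq_left ht]) _

/-- The error of the last stochastic gradient evaluated by agent `j` before time `k`. -/
def noise (G : Digraph V) (W A : Matrix V V ℝ) (g : V → Vec n → Z → Vec n)
    (dF : V → Vec n → Vec n) (γ : ℕ → ℝ) (s : Schedule V) (ζ₀ : Z) (ζ : ℕ → Z) (k : ℕ) (j : V) :
    Vec n :=
  g j ((run G W A g γ s ζ₀ ζ k).x j) ((run G W A g γ s ζ₀ ζ k).smp j)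
    - dF j ((run G W A g γ s ζ₀ ζ k).x j)

theorem isPath_run (dF : V → Vec n → Vec n) :
    IsPath G W A dF γ s (fun k => (run G W A g γ s ζ₀ ζ k).x) (fun k => (run G W A g γ s ζ₀ ζ k).v)
      (fun k => (run G W A g γ s ζ₀ ζ k).mass)
      (exactMass G A dF s fun k => (run G W A g γ s ζ₀ ζ k).x)
      (noise G W A g dF γ s ζ₀ ζ) where
  x_zero i := by rw [run]; rfl
  v_zero i := by rw [run]; rfl
  m_zero := by
    simp only [run, State.init, noise]
    congr 1
    ext i : 1
    simp
  y_zero := by rw [exactMass, run]; rfl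
  v_succ k := by simp only [run_succ, step]
  x_succ k := by simp only [run_succ, step]
  m_succ k := by
    rw [run_succ]
    simp only [step, noise, run_succ, Function.update_self]
    congr 1
    abel
  y_succ k := exactMass_succ _ _ _ _
  N_succ k j hj := by
    simp only [noise, run_succ, step, Function.update_of_ne hj]

end Run

variable {dF : V → Vec n → Vec n} {γ : ℕ → ℝ} {s : Schedule V} {x v : ℕ → V → Vec n}
  {m y : ℕ → Mass V n} {N : ℕ → V → Vec n}

/-- The augmented consensus vector evolves linearly, except that the active agent moves against
its tracked gradient. -/
theorem IsPath.augVec_succ (h : IsPath G W A dF γ s x v m y N) (hs : s.IsAdmissible G T D)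
    (k : ℕ) (r : ConsIdx V D) :
    augVec D x v (k + 1) r = ∑ c, consMatrix G W s D k r c • augVec D x v k c
      + consMatrix G W s D k r (Sum.inl (s.active k)) • (-(γ k • (m k).z (s.active k))) := by
  rcases r with i | ⟨i, b⟩
  · by_cases hi : i = s.active k
    · subst hi
      rw [sum_consMatrix_active hs]
      simp only [augVec]
      rw [h.x_succ, Function.update_self]
      have h1 : ∀ j, k - (k - s.readTime k j) = s.readTime k j := fun j => by
        have := s.readTime_le k j; omega
      simp only [h1]
      rw [Finset.sum_attach (inNbrs G (s.active k))
        (fun j => W (s.active k) j • v (s.readTime k j) j)]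
      simp only [consMatrix, if_true, smul_sub, smul_neg]
      abel
    · simp only [consMatrix_row_of_ne hi, ite_smul, one_smul, zero_smul, Finset.sum_ite_eq',
        Finset.mem_univ, if_true, Sum.inl.injEq, if_neg (Ne.symm hi), add_zero]
      simp only [augVec]
      rw [h.x_succ, Function.update_of_ne hi]
  · simp only [consMatrix_row_inr, ite_smul, one_smul, zero_smul, Finset.sum_ite_eq',
        Finset.mem_univ, if_true]
    by_cases hb : (b : ℕ) = 0
    · by_cases hi : i = s.active k
      · subst hi
        simp only [hb, if_true, augVec, Nat.sub_zero]
        rw [h.v_succ, Function.update_self, sub_eq_add_neg]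
      · simp only [hb, hi, if_true, if_false, augVec, Nat.sub_zero]
        rw [h.v_succ, Function.update_of_ne hi]
        simp
    · simp only [hb, if_false, augVec]
      rw [show k + 1 - (b : ℕ) = k - (b - 1) by omega]
      simp

/-! ### The augmented tracking vector -/

/-- The mass at the nodes of the augmented tracking graph. At time `k`, node `d < D` of the edge
`j → i` holds the mass generated in iteration `k - d - 1` and not yet collected by `i`, and node
`D` all the older mass; `s.counter k i j` is the time up to which the mass has been collected. -/
def augMass (D : ℕ) (s : Schedule V) (m : ℕ → Mass V n) (k : ℕ) : MassIdx G D → Vec n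
  | Sum.inl i => (m k).z i
  | Sum.inr (e, d) =>
      (m (max (k - d) (s.counter k e.1.2 e.1.1))).ρ e.1.2 e.1.1 -
        (m (if (d : ℕ) < D then max (k - (d + 1)) (s.counter k e.1.2 e.1.1)
          else s.counter k e.1.2 e.1.1)).ρ e.1.2 e.1.1

/-- The mass which the active agent holds before the push step. -/
def halfMass (G : Digraph V) (s : Schedule V) (m : ℕ → Mass V n) (k : ℕ) (Δ : Vec n) : Vec n :=
  (m k).z (s.active k) + ∑ j ∈ inNbrs G (s.active k),
    ((m (s.readTime k j)).ρ (s.active k) j - (m k).buf (s.active k) j) + Δ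

section MassRun

variable {Δ : ℕ → Vec n}

theorem buf_eq (h0 : ∃ z₀, m 0 = Mass.init z₀) (hm : ∀ k, m (k + 1) = massStep G A s k m (Δ k))
    (k : ℕ) {i j : V} (hj : j ∈ inNbrs G i) :
    (m k).buf i j = (m (s.counter k i j)).ρ i j := by
  induction k with
  | zero => obtain ⟨z₀, h0⟩ := h0; simp [h0, Schedule.counter, Mass.init]
  | succ k ih =>
    by_cases hi : i = s.active k
    · subst hi
      rw [hm]
      simp only [massStep, hj, and_self, if_true]
      rfl
    · rw [s.counter_succ_of_ne hi, ← ih, hm]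
      simp [massStep, hi]

theorem rho_succ (hm : ∀ k, m (k + 1) = massStep G A s k m (Δ k)) (k : ℕ) {i j : V}
    (hj : j ∈ inNbrs G i) :
    (m (k + 1)).ρ i j = (m k).ρ i j
      + if j = s.active k then A i (s.active k) • halfMass G s m k (Δ k) else 0 := by
  rw [hm]
  simp only [massStep, halfMass]
  by_cases h : j = s.active k
  · subst h
    simp [mem_outNbrs_iff_mem_inNbrs, hj]
  · simp [h]

/-- Telescoping: the mass at the nodes `≥ d₀` of an edge. -/
theorem sum_augMass_edge (k : ℕ) (e : Edge G) {d₀ : ℕ} (hd : d₀ ≤ D) :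
    ∑ d : Fin (D + 1), (if d₀ ≤ d then augMass D s m k (Sum.inr (e, d)) else 0)
      = (m (max (k - d₀) (s.counter k e.1.2 e.1.1))).ρ e.1.2 e.1.1
        - (m (s.counter k e.1.2 e.1.1)).ρ e.1.2 e.1.1 := by
  simp only [augMass]
  rw [Fin.sum_univ_eq_sum_range (fun d => if d₀ ≤ d then
    (m (max (k - d) (s.counter k e.1.2 e.1.1))).ρ e.1.2 e.1.1 -
        (m (if d < D then max (k - (d + 1)) (s.counter k e.1.2 e.1.1)
          else s.counter k e.1.2 e.1.1)).ρ e.1.2 e.1.1 else 0), Finset.sum_range_succ,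
    if_pos hd, if_neg (lt_irrefl D)]
  have key : ∀ D', d₀ ≤ D' → D' ≤ D → ∑ d ∈ Finset.range D', (if d₀ ≤ d then
      (m (max (k - d) (s.counter k e.1.2 e.1.1))).ρ e.1.2 e.1.1 -
        (m (if d < D then max (k - (d + 1)) (s.counter k e.1.2 e.1.1)
          else s.counter k e.1.2 e.1.1)).ρ e.1.2 e.1.1 else 0)
      = (m (max (k - d₀) (s.counter k e.1.2 e.1.1))).ρ e.1.2 e.1.1
        - (m (max (k - D') (s.counter k e.1.2 e.1.1))).ρ e.1.2 e.1.1 := by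
    intro D' hD'
    induction D', hD' using Nat.le_induction with
    | base =>
      intro _
      rw [sub_self]
      exact Finset.sum_eq_zero fun d hd => if_neg (by have := Finset.mem_range.mp hd; omega)
    | succ D' hD' ih =>
      intro hle
      rw [Finset.sum_range_succ, ih (by omega), if_pos hD', if_pos (by omega)]
      abel
  rw [key D hd le_rfl]
  abel

/-- The virtual nodes of an edge together hold the mass which has not yet been collected. -/
theorem total_eq_sum_augMass (h0 : ∃ z₀, m 0 = Mass.init z₀)
    (hm : ∀ k, m (k + 1) = massStep G A s k m (Δ k)) (k : ℕ) :
    (m k).total G = ∑ c : MassIdx G D, augMass D s m k c := by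
  rw [Fintype.sum_sum_type, Fintype.sum_prod_type, Mass.total]
  congr 1
  rw [← sum_edge fun j i => (m k).ρ i j - (m k).buf i j]
  refine Finset.sum_congr rfl fun e _ => ?_
  have h := sum_augMass_edge (D := D) (s := s) (m := m) k e (Nat.zero_le D)
  simp only [Nat.zero_le, if_true] at h
  rw [h, buf_eq h0 hm k e.2, Nat.sub_zero, max_eq_left]
  have := s.counter_le k e.1.2 e.1.1
  omega

/-- The node to which the mass of the node `c` moves if it is not collected. -/
def nextNode : MassIdx G D → MassIdx G D
  | Sum.inl j => Sum.inl j
  | Sum.inr (e, d) => Sum.inr (e, ⟨min (d + 1) D, by omega⟩)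

/-- The mass of the node `c` is collected in iteration `k`. -/
def Collected (s : Schedule V) (k : ℕ) : MassIdx G D → Prop
  | Sum.inl j => j = s.active k
  | Sum.inr (e, d) => e.1.2 = s.active k ∧ k - s.readTime k e.1.1 ≤ d

theorem massMatrix_eq (k : ℕ) (r c : MassIdx G D) :
    massMatrix G A s D k r c = (if Collected s k c then pushVec G A D (s.active k) r else 0)
      + if ¬ Collected s k c ∧ r = nextNode c then 1 else 0 := by
  rcases c with j | ⟨e, d⟩
  · by_cases h : j = s.active k
    · subst h
      simp [massMatrix_inl_active, Collected]
    · simp [massMatrix_inl_of_ne h, Collected, h, nextNode]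
  · by_cases h : e.1.2 = s.active k ∧ k - s.readTime k e.1.1 ≤ d
    · rw [massMatrix_inr_collected h, if_pos (show Collected s k (Sum.inr (e, d)) from h),
        if_neg (by simp [Collected, h]), add_zero]
    · rw [massMatrix_inr_of_not h, if_neg (show ¬ Collected s k (Sum.inr (e, d)) from h),
        zero_add]
      have : ¬ Collected s k (Sum.inr (e, d)) := h
      simp only [this, not_false_eq_true, true_and, nextNode]

/-- The product with the mass matrix: the collected mass is pushed, the other mass moves on. -/
theorem sum_massMatrix_smul (k : ℕ) (u : MassIdx G D → Vec n) (r : MassIdx G D) :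
    ∑ c, massMatrix G A s D k r c • u c
      = pushVec G A D (s.active k) r • (∑ c, if Collected s k c then u c else 0)
        + ∑ c, if ¬ Collected s k c ∧ r = nextNode c then u c else 0 := by
  rw [Finset.smul_sum, ← Finset.sum_add_distrib]
  refine Finset.sum_congr rfl fun c _ => ?_
  rw [massMatrix_eq, add_smul]
  congr 1 <;> split_ifs <;> simp

/-- The active agent collects exactly the mass by which its mass counters have grown between its
last reading and the present one. -/
theorem sum_collected_augMass (h0 : ∃ z₀, m 0 = Mass.init z₀)
    (hm : ∀ k, m (k + 1) = massStep G A s k m (Δ k)) (hs : s.IsAdmissible G T D) (k : ℕ) :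
    (∑ c : MassIdx G D, if Collected s k c then augMass D s m k c else 0) + Δ k
      = halfMass G s m k (Δ k) := by
  rw [Fintype.sum_sum_type, Fintype.sum_prod_type, halfMass]
  congr 2
  · rw [Finset.sum_eq_single (s.active k)]
    · simp [Collected, augMass]
    · exact fun j _ hj => if_neg hj
    · simp
  · have h1 : ∀ e : Edge G, (∑ d : Fin (D + 1), if Collected s k (Sum.inr (e, d)) then
        augMass D s m k (Sum.inr (e, d)) else 0)
        = if e.1.2 = s.active k then
          (m (s.readTime k e.1.1)).ρ e.1.2 e.1.1 - (m k).buf e.1.2 e.1.1 else 0 := by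
      intro e
      by_cases he : e.1.2 = s.active k
      · have hle := hs.sub_readTime_le (k := k) (j := e.1.1) (he ▸ e.2)
        have h := sum_augMass_edge (D := D) (s := s) (m := m) k e hle
        simp only [Collected, he, true_and, if_true] at h ⊢
        rw [h, ← he, buf_eq h0 hm k e.2]
        congr 2
        have h2 := s.readTime_le k e.1.1
        have h3 := s.counter_le_readTime k e.1.1
        rw [← he] at h3
        congr 1
        omega
      · simp [Collected, he]
    rw [Finset.sum_congr rfl fun e _ => h1 e, sum_edge fun j i => if i = s.active k then
          (m (s.readTime k j)).ρ i j - (m k).buf i j else 0,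
      Finset.sum_eq_single (s.active k)]
    · simp
    · intro i _ hi
      simp [hi]
    · simp

/-- The mass which is not collected gets older by one iteration. -/
theorem sum_not_collected_edge (hs : s.IsAdmissible G T D) (k : ℕ) (e : Edge G)
    (d' : Fin (D + 1)) :
    ∑ d : Fin (D + 1), (if ¬ Collected s k (Sum.inr (e, d)) ∧ (d' : ℕ) = min ((d : ℕ) + 1) D then
        augMass D s m k (Sum.inr (e, d)) else 0)
      = (if (d' : ℕ) = 0 then (m k).ρ e.1.2 e.1.1
          else (m (max (k + 1 - d') (s.counter (k + 1) e.1.2 e.1.1))).ρ e.1.2 e.1.1)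
        - (m (if (d' : ℕ) < D then max (k - d') (s.counter (k + 1) e.1.2 e.1.1)
          else s.counter (k + 1) e.1.2 e.1.1)).ρ e.1.2 e.1.1 := by
  set c := s.counter k e.1.2 e.1.1 with hc
  set c' := s.counter (k + 1) e.1.2 e.1.1 with hc'
  set P : ℕ → Vec n := fun t => (m t).ρ e.1.2 e.1.1 with hP
  have hck : c ≤ k := by have := s.counter_le k e.1.2 e.1.1; omega
  have hck' : c' ≤ k := by have := s.counter_le (k + 1) e.1.2 e.1.1; omega
  have hcc : c ≤ c' := s.counter_mono k _ _
  -- collected nodes are those up to time `c'`, and without collection `c' = c`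
  have hcol : ∀ d : ℕ, (e.1.2 = s.active k ∧ k - s.readTime k e.1.1 ≤ d) ∨ c' = c ∨
      (¬ (e.1.2 = s.active k ∧ k - s.readTime k e.1.1 ≤ d) ∧ c' + d < k) := by
    intro d
    by_cases he : e.1.2 = s.active k
    · have : c' = s.readTime k e.1.1 := by rw [hc', he]; rfl
      rw [← this]
      simp only [he, true_and]
      omega
    · exact Or.inr (Or.inl (s.counter_succ_of_ne he _))
  have hcol' : ∀ d : ℕ, (e.1.2 = s.active k ∧ k - s.readTime k e.1.1 ≤ d) → k ≤ c' + d := by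
    rintro d ⟨he, hd⟩
    have : c' = s.readTime k e.1.1 := by rw [hc', he]; rfl
    omega
  have hD : e.1.2 = s.active k → k ≤ c' + D := by
    intro he
    have h1 := hs.sub_readTime_le (k := k) (j := e.1.1) (he ▸ e.2)
    exact hcol' D ⟨he, h1⟩
  have hne : e.1.2 ≠ s.active k → c' = c := fun he => s.counter_succ_of_ne he _
  have hlt : ∀ d : ℕ, e.1.2 = s.active k → ¬ (k - s.readTime k e.1.1 ≤ d) → c' + d < k := by
    intro d he hd
    have : c' = s.readTime k e.1.1 := by rw [hc', he]; rfl
    omega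
  clear_value c c'
  simp only [augMass, Collected, ← hc]
  change ∑ d : Fin (D + 1), (if ¬ (e.1.2 = s.active k ∧ k - s.readTime k e.1.1 ≤ (d : ℕ)) ∧
      (d' : ℕ) = min ((d : ℕ) + 1) D then
      P (max (k - d) c) - P (if (d : ℕ) < D then max (k - (d + 1)) c else c) else 0)
    = (if (d' : ℕ) = 0 then P k else P (max (k + 1 - d') c'))
      - P (if (d' : ℕ) < D then max (k - d') c' else c')
  obtain ⟨d', hd'⟩ := d'
  simp only
  rw [Fin.sum_univ_eq_sum_range (fun d => if ¬ (e.1.2 = s.active k ∧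
      k - s.readTime k e.1.1 ≤ d) ∧ d' = min (d + 1) D then
      P (max (k - d) c) - P (if d < D then max (k - (d + 1)) c else c) else 0)]
  -- below the last node, only the preceding node contributes
  rcases Nat.lt_or_ge d' D with hlt' | hge
  · rw [if_pos hlt']
    rcases Nat.eq_zero_or_pos d' with rfl | hpos
    · rw [if_pos rfl, Finset.sum_eq_zero, Nat.sub_zero, max_eq_left hck', sub_self]
      intro d _
      exact if_neg (by omega)
    · rw [if_neg (by omega), Finset.sum_eq_single (d' - 1)]
      · by_cases hcl : e.1.2 = s.active k ∧ k - s.readTime k e.1.1 ≤ d' - 1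
        · rw [if_neg (by tauto)]
          have := hcol' _ hcl
          rw [max_eq_right (show k + 1 - d' ≤ c' by omega),
            max_eq_right (show k - d' ≤ c' by omega), sub_self]
        · rw [if_pos ⟨hcl, by omega⟩, if_pos (by omega)]
          rcases hcol (d' - 1) with h | h | h
          · exact absurd h hcl
          · rw [h, show k - (d' - 1) = k + 1 - d' by omega, show d' - 1 + 1 = d' by omega]
          · rw [show max (k - (d' - 1)) c = max (k + 1 - d') c' by omega,
              show max (k - (d' - 1 + 1)) c = max (k - d') c' by omega]
      · intro d hd hdd
        exact if_neg (by have := Finset.mem_range.mp hd; omega)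
      · intro h
        exact absurd (Finset.mem_range.mpr (by omega)) h
  -- the last node keeps its mass and receives that of the preceding one
  · obtain rfl : d' = D := by omega
    rw [if_neg (lt_irrefl d')]
    rcases Nat.eq_zero_or_pos d' with rfl | hpos
    · simp only [zero_add, Finset.range_one, Finset.sum_singleton, lt_irrefl, if_false, if_true,
        Nat.sub_zero]
      by_cases he : e.1.2 = s.active k
      · have h1 := hs.sub_readTime_le (k := k) (j := e.1.1) (he ▸ e.2)
        have h2 := hD he
        rw [if_neg (by tauto), show c' = k by omega, sub_self]
      · rw [if_pos ⟨by tauto, by omega⟩, hne he, max_eq_left hck]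
    · obtain ⟨D', rfl⟩ : ∃ D', d' = D' + 1 := ⟨d' - 1, by omega⟩
      rw [Finset.sum_range_succ, Finset.sum_range_succ, Finset.sum_eq_zero, zero_add,
        if_neg (show ¬ (D' + 1 = 0) by omega), if_neg (lt_irrefl (D' + 1)),
        if_pos (Nat.lt_succ_self D')]
      · by_cases he : e.1.2 = s.active k
        · have h1 := hs.sub_readTime_le (k := k) (j := e.1.1) (he ▸ e.2)
          have h2 := hD he
          rw [if_neg (show ¬ (¬ (e.1.2 = s.active k ∧ k - s.readTime k e.1.1 ≤ D' + 1) ∧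
            D' + 1 = min (D' + 1 + 1) (D' + 1)) by tauto), add_zero]
          by_cases hcl : k - s.readTime k e.1.1 ≤ D'
          · rw [if_neg (by tauto)]
            have := hcol' _ ⟨he, hcl⟩
            rw [max_eq_right (show k + 1 - (D' + 1) ≤ c' by omega), sub_self]
          · have := hlt _ he hcl
            rw [if_pos ⟨by tauto, by omega⟩,
              show max (k - D') c = max (k + 1 - (D' + 1)) c' by omega,
              show max (k - (D' + 1)) c = c' by omega]
        · rw [if_pos ⟨by tauto, by omega⟩, if_pos ⟨by tauto, by omega⟩, hne he,
            show k + 1 - (D' + 1) = k - D' by omega]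
          abel
      · intro d hd
        exact if_neg (by have := Finset.mem_range.mp hd; omega)

/-- The robust tracking step is a linear recursion for the augmented vector: a gradient correction
enters like mass of the active agent. -/
theorem augMass_succ (h0 : ∃ z₀, m 0 = Mass.init z₀)
    (hm : ∀ k, m (k + 1) = massStep G A s k m (Δ k)) (hs : s.IsAdmissible G T D) (k : ℕ)
    (r : MassIdx G D) :
    augMass D s m (k + 1) r = ∑ c, massMatrix G A s D k r c • augMass D s m k c
      + massMatrix G A s D k r (Sum.inl (s.active k)) • Δ k := by
  rw [sum_massMatrix_smul, massMatrix_inl_active, add_right_comm, ← smul_add,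
    sum_collected_augMass h0 hm hs]
  rcases r with i | ⟨e, d'⟩
  · rw [Fintype.sum_sum_type]
    have h1 : ∑ x : Edge G × Fin (D + 1), (if ¬ Collected s k (Sum.inr x) ∧
        (Sum.inl i : MassIdx G D) = nextNode (Sum.inr x) then augMass D s m k (Sum.inr x) else 0)
        = 0 := Finset.sum_eq_zero fun x _ => if_neg (by simp [nextNode])
    rw [h1, add_zero]
    simp only [augMass, pushVec, Collected, nextNode, Sum.inl.injEq]
    rw [hm]
    by_cases hi : i = s.active k
    · subst hi
      rw [Finset.sum_eq_zero]
      · simp [massStep, halfMass]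
      · intro j _
        exact if_neg fun h => h.1 h.2.symm
    · rw [Finset.sum_eq_single i]
      · simp [massStep, hi]
      · intro j _ hj
        exact if_neg fun h => hj h.2.symm
      · simp
  · rw [Fintype.sum_sum_type, Fintype.sum_prod_type, Finset.sum_eq_single e]
    · have h1 : ∑ j : V, (if ¬ Collected s k (Sum.inl j : MassIdx G D) ∧
          (Sum.inr (e, d') : MassIdx G D) = nextNode (Sum.inl j) then
          augMass (G := G) D s m k (Sum.inl j) else 0) = 0 :=
        Finset.sum_eq_zero fun x _ => if_neg (by simp [nextNode])
      have h2 := sum_not_collected_edge (m := m) hs k e d'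
      simp only [nextNode, Sum.inr.injEq, Prod.mk.injEq, true_and, Fin.ext_iff] at h1 h2 ⊢
      rw [h1, h2, zero_add]
      simp only [augMass, pushVec]
      by_cases hd : (d' : ℕ) = 0
      · have hc : s.counter (k + 1) e.1.2 e.1.1 ≤ k + 1 := by
          have := s.counter_le (k + 1) e.1.2 e.1.1; omega
        simp only [hd, and_true, if_true, Nat.sub_zero, max_eq_left hc, zero_add]
        rw [rho_succ hm k e.2, show k + 1 - 1 = k by omega]
        by_cases h : e.1.1 = s.active k
        · rw [if_pos h, if_pos h]
          abel
        · rw [if_neg h, if_neg h, zero_smul]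
          abel
      · simp only [hd, and_false, if_false, zero_smul, zero_add]
        rw [show k + 1 - ((d' : ℕ) + 1) = k - d' by omega]
    · intro e' _ he'
      refine Finset.sum_eq_zero fun d _ => if_neg ?_
      simp [nextNode, Ne.symm he']
    · simp

theorem augMass_zero {z₀ : V → Vec n} (h0 : m 0 = Mass.init z₀) (r : MassIdx G D) :
    augMass D s m 0 r = Sum.elim z₀ (fun _ => 0) r := by
  rcases r with i | ⟨e, d⟩ <;> simp [augMass, h0, Mass.init, Schedule.counter]

theorem augMass_eq {z₀ : V → Vec n} (h0 : m 0 = Mass.init z₀)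
    (hm : ∀ k, m (k + 1) = massStep G A s k m (Δ k)) (hs : s.IsAdmissible G T D) (k : ℕ)
    (r : MassIdx G D) :
    augMass D s m k r = ∑ j, prodFrom (massMatrix G A s D) 0 k r (Sum.inl j) • z₀ j
      + ∑ t ∈ Finset.range k,
        prodFrom (massMatrix G A s D) t (k - t) r (Sum.inl (s.active t)) • Δ t := by
  rw [eq_sum_prodFrom (massMatrix G A s D) (augMass D s m) (fun t => Sum.inl (s.active t)) Δ
    (augMass_succ ⟨z₀, h0⟩ hm hs)]
  simp only [augMass_zero h0]
  rw [Fintype.sum_sum_type]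
  simp

/-- Column stochastic matrices preserve mass: the total mass is that of all inputs. -/
theorem total_eq {z₀ : V → Vec n} (h0 : m 0 = Mass.init z₀) (hWA : IsMixingPair G W A mbar)
    (hm : ∀ k, m (k + 1) = massStep G A s k m (Δ k)) (hs : s.IsAdmissible G T D) (k : ℕ) :
    (m k).total G = ∑ j, z₀ j + ∑ t ∈ Finset.range k, Δ t := by
  rw [total_eq_sum_augMass (D := D) ⟨z₀, h0⟩ hm]
  simp only [augMass_eq h0 hm hs, Finset.sum_add_distrib]
  rw [Finset.sum_comm, Finset.sum_comm (t := Finset.range k)]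
  simp only [← Finset.sum_smul,
    (ColStoch.prodFrom (massMatrix_colStoch hWA s D) _ _).sum_col, one_smul]

end MassRun

end

section

/-! ### Smooth objectives -/

theorem abs_sub_sub_inner_le {E : Type*} [NormedAddCommGroup E] [InnerProductSpace ℝ E]
    [CompleteSpace E] {f : E → ℝ} {f' : E → E} {L : ℝ} (hL : 0 ≤ L)
    (hf : ∀ x, HasGradientAt f (f' x) x) (hf' : ∀ x y, ‖f' x - f' y‖ ≤ L * ‖x - y‖) (x y : E) :
    |f y - f x - inner ℝ (f' x) (y - x)| ≤ L * ‖y - x‖ ^ 2 := by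
  have key := Convex.norm_image_sub_le_of_norm_hasFDerivWithin_le' (f := f) (s := segment ℝ x y)
    (f' := fun w => InnerProductSpace.toDual ℝ E (f' w)) (φ := InnerProductSpace.toDual ℝ E (f' x))
    (C := L * ‖y - x‖) (fun w _ => (hf w).hasFDerivAt.hasFDerivWithinAt) (fun w hw => ?_)
    (convex_segment x y) (left_mem_segment ℝ x y) (right_mem_segment ℝ x y)
  · rw [InnerProductSpace.toDual_apply_apply, Real.norm_eq_abs] at key
    linarith [key]
  · rw [← map_sub, LinearIsometryEquiv.norm_map]
    refine (hf' w x).trans (mul_le_mul_of_nonneg_left ?_ hL)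
    obtain ⟨t, ht, rfl⟩ := (segment_eq_image' ℝ x y).subset hw
    rw [add_sub_cancel_left, norm_smul, Real.norm_eq_abs, abs_of_nonneg ht.1]
    exact mul_le_of_le_one_left (norm_nonneg _) ht.2

/-- A quadratic bound on the remainder makes an affine approximation the derivative. -/
theorem hasGradientAt_of_abs_sub_le {E : Type*} [NormedAddCommGroup E] [InnerProductSpace ℝ E]
    [CompleteSpace E] {f : E → ℝ} {x u : E} {L : ℝ}
    (h : ∀ y, |f y - f x - inner ℝ u (y - x)| ≤ L * ‖y - x‖ ^ 2) : HasGradientAt f u x := by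
  rw [hasGradientAt_iff_isLittleO]
  have h1 : (fun y => f y - f x - inner ℝ u (y - x)) =O[𝓝 x] fun y => ‖y - x‖ ^ 2 :=
    Asymptotics.IsBigO.of_bound L (Eventually.of_forall fun y => by
      simpa using h y)
  refine h1.trans_isLittleO ?_
  have h2 : Tendsto (fun y : E => y - x) (𝓝 x) (𝓝 0) := by
    have h3 : Continuous fun y : E => y - x := by fun_prop
    simpa using h3.tendsto x
  exact ((Asymptotics.isLittleO_norm_pow_id (E' := E) (one_lt_two)).comp_tendsto h2)

section Expectation

variable {V : Type*} {n : ℕ} {Θ : Type*} [MeasurableSpace Θ] {P : Measure Θ}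
  [IsProbabilityMeasure P] {f : V → Vec n → Θ → ℝ} {L : V → ℝ≥0}

theorem ae_abs_sub_sub_inner_le (hf_smooth : ∀ i, ∀ᵐ θ ∂P, Differentiable ℝ (fun x => f i x θ) ∧
      LipschitzWith (L i) (gradient fun x => f i x θ)) (i : V) : ∀ᵐ θ ∂P, ∀ x y,
    |f i y θ - f i x θ - inner ℝ (gradient (fun x => f i x θ) x) (y - x)| ≤ L i * ‖y - x‖ ^ 2 := by
  filter_upwards [hf_smooth i] with θ hθ x y
  exact abs_sub_sub_inner_le (L i).coe_nonneg (fun x => (hθ.1 x).hasGradientAt)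
    (fun x y => by simpa [dist_eq_norm] using hθ.2.dist_le_mul x y) x y

/-- Both measurability in `θ` and integrability come from the quadratic bound on the remainder of
the affine approximation. -/
theorem integrable_gradient (hf_int : ∀ i x, Integrable (f i x) P)
    (hf_smooth : ∀ i, ∀ᵐ θ ∂P, Differentiable ℝ (fun x => f i x θ) ∧
      LipschitzWith (L i) (gradient fun x => f i x θ)) (i : V) (x : Vec n) :
    Integrable (fun θ => gradient (fun x => f i x θ) x) P := by
  have hq := ae_abs_sub_sub_inner_le hf_smooth i
  refine Integrable.of_eval_piLp fun c => ?_
  set e : Vec n := EuclideanSpace.single c 1 with he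
  have hin : ∀ w : Vec n, inner ℝ w e = w c := fun w => by
    rw [he, EuclideanSpace.inner_single_right]; simp
  have hnorm : ‖e‖ = 1 := by simp [he]
  -- the partial derivative is the almost sure limit of the difference quotients
  have hmeas : AEStronglyMeasurable (fun θ => gradient (fun x => f i x θ) x c) P := by
    refine aestronglyMeasurable_of_tendsto_ae (u := atTop) (f := fun (k : ℕ) θ =>
      ((k : ℝ) + 1) * (f i (x + ((k : ℝ) + 1)⁻¹ • e) θ - f i x θ)) (fun k => ?_) ?_
    · exact (((hf_int i _).sub (hf_int i x)).const_mul _).aestronglyMeasurable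
    · filter_upwards [hq] with θ hθ
      rw [tendsto_iff_norm_sub_tendsto_zero]
      refine squeeze_zero (fun _ => norm_nonneg _) (fun k => ?_)
        (by simpa only [mul_zero] using
          (tendsto_one_div_add_atTop_nhds_zero_nat (𝕜 := ℝ)).const_mul (L i : ℝ))
      have hk : (0 : ℝ) < (k : ℝ) + 1 := by positivity
      have h := hθ x (x + ((k : ℝ) + 1)⁻¹ • e)
      rw [add_sub_cancel_left, inner_smul_right, hin, norm_smul, hnorm, mul_one,
        Real.norm_eq_abs, abs_of_pos (inv_pos.mpr hk)] at h
      rw [Real.norm_eq_abs]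
      calc _ = ((k : ℝ) + 1) * |f i (x + ((k : ℝ) + 1)⁻¹ • e) θ - f i x θ
              - ((k : ℝ) + 1)⁻¹ * gradient (fun x => f i x θ) x c| := by
            rw [← abs_of_pos hk, ← abs_mul, abs_of_pos hk]
            congr 1
            field_simp
        _ ≤ ((k : ℝ) + 1) * (L i * (((k : ℝ) + 1)⁻¹) ^ 2) :=
            mul_le_mul_of_nonneg_left h hk.le
        _ = L i * (1 / ((k : ℝ) + 1)) := by field_simp
  refine Integrable.mono' (((hf_int i (x + e)).sub (hf_int i x)).abs.add
    (integrable_const ((L i : ℝ)))) hmeas ?_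
  filter_upwards [hq] with θ hθ
  have h := hθ x (x + e)
  rw [add_sub_cancel_left, hin, hnorm, one_pow, mul_one] at h
  rw [Real.norm_eq_abs]
  have h1 := abs_sub_abs_le_abs_sub (gradient (fun x => f i x θ) x c)
    (f i (x + e) θ - f i x θ)
  rw [abs_sub_comm (gradient (fun x => f i x θ) x c)] at h1
  simp only [Pi.add_apply, Pi.sub_apply]
  linarith

theorem abs_localObj_sub_sub_le (hf_int : ∀ i x, Integrable (f i x) P)
    (hf_smooth : ∀ i, ∀ᵐ θ ∂P, Differentiable ℝ (fun x => f i x θ) ∧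
      LipschitzWith (L i) (gradient fun x => f i x θ)) (i : V) (x y : Vec n) :
    |localObj P f i y - localObj P f i x
      - inner ℝ (∫ θ, gradient (fun x => f i x θ) x ∂P) (y - x)| ≤ L i * ‖y - x‖ ^ 2 := by
  have hg := integrable_gradient hf_int hf_smooth i x
  have h1 : inner ℝ (∫ θ, gradient (fun x => f i x θ) x ∂P) (y - x)
      = ∫ θ, inner ℝ (gradient (fun x => f i x θ) x) (y - x) ∂P := by
    rw [real_inner_comm, ← integral_inner hg]
    simp only [real_inner_comm]
  have h2 : Integrable (fun θ => inner ℝ (gradient (fun x => f i x θ) x) (y - x)) P :=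
    hg.inner_const _
  rw [localObj, localObj, h1, ← integral_sub (hf_int i y) (hf_int i x),
    ← integral_sub (f := fun θ => f i y θ - f i x θ) ((hf_int i y).sub (hf_int i x)) h2]
  have h3 := norm_integral_le_of_norm_le_const (μ := P) (C := L i * ‖y - x‖ ^ 2)
    (f := fun θ => f i y θ - f i x θ - inner ℝ (gradient (fun x => f i x θ) x) (y - x)) (by
      filter_upwards [ae_abs_sub_sub_inner_le hf_smooth i] with θ hθ
      exact hθ x y)
  simpa using h3

theorem hasGradientAt_localObj (hf_int : ∀ i x, Integrable (f i x) P)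
    (hf_smooth : ∀ i, ∀ᵐ θ ∂P, Differentiable ℝ (fun x => f i x θ) ∧
      LipschitzWith (L i) (gradient fun x => f i x θ)) (i : V) (x : Vec n) :
    HasGradientAt (localObj P f i) (localGrad P f i x) x := by
  have h := hasGradientAt_of_abs_sub_le (abs_localObj_sub_sub_le hf_int hf_smooth i x)
  rw [localGrad, h.gradient]
  exact h

theorem norm_localGrad_sub_le (hf_int : ∀ i x, Integrable (f i x) P)
    (hf_smooth : ∀ i, ∀ᵐ θ ∂P, Differentiable ℝ (fun x => f i x θ) ∧
      LipschitzWith (L i) (gradient fun x => f i x θ)) (i : V) (x y : Vec n) :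
    ‖localGrad P f i x - localGrad P f i y‖ ≤ L i * ‖x - y‖ := by
  have h : ∀ x, localGrad P f i x = ∫ θ, gradient (fun x => f i x θ) x ∂P := fun x =>
    (hasGradientAt_of_abs_sub_le (abs_localObj_sub_sub_le hf_int hf_smooth i x)).gradient
  rw [h, h, ← integral_sub (integrable_gradient hf_int hf_smooth i x)
    (integrable_gradient hf_int hf_smooth i y)]
  have h3 := norm_integral_le_of_norm_le_const (μ := P) (C := L i * ‖x - y‖)
    (f := fun θ => gradient (fun x => f i x θ) x - gradient (fun x => f i x θ) y) (by
      filter_upwards [hf_smooth i] with θ hθ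
      simpa [dist_eq_norm] using hθ.2.dist_le_mul x y)
  simpa using h3

end Expectation

end

section

variable {V : Type*} [Fintype V] {G : Digraph V} {W A : Matrix V V ℝ} {mbar : ℝ} {T D n : ℕ}
  {dF : V → Vec n → Vec n} {γ : ℕ → ℝ} {s : Schedule V} {x v : ℕ → V → Vec n}
  {m y : ℕ → Mass V n} {N : ℕ → V → Vec n} {C q : ℝ} {ψ : ℕ → ConsIdx V D → ℝ}
  {ξ : ℕ → MassIdx G D → ℝ} {L : V → ℝ≥0}

/-! ### Consensus and tracking errors along a trajectory -/

/-- The length of the move of the active agent in iteration `t`. -/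
def moveLen (γ : ℕ → ℝ) (s : Schedule V) (m : ℕ → Mass V n) (t : ℕ) : ℝ :=
  γ t * ‖(m t).z (s.active t)‖

theorem moveLen_nonneg (hγ : ∀ k, 0 < γ k) (t : ℕ) : 0 ≤ moveLen γ s m t :=
  mul_nonneg (hγ t).le (norm_nonneg _)

theorem norm_neg_smul_z (hγ : ∀ k, 0 < γ k) (t : ℕ) :
    ‖-(γ t • (m t).z (s.active t))‖ = moveLen γ s m t := by
  rw [norm_neg, norm_smul, Real.norm_eq_abs, abs_of_pos (hγ t), moveLen]

/-- The average of the augmented consensus vector with the consensus weights. -/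
def center (x v : ℕ → V → Vec n) (ψ : ℕ → ConsIdx V D → ℝ) (k : ℕ) : Vec n :=
  ∑ c, ψ k c • augVec D x v k c

namespace IsPath

theorem augVec_zero (h : IsPath G W A dF γ s x v m y N) (r : ConsIdx V D) :
    augVec D x v 0 r = 0 := by
  rcases r with i | ⟨i, b⟩
  · exact h.x_zero i
  · simpa [augVec] using h.v_zero i

theorem augVec_eq (h : IsPath G W A dF γ s x v m y N) (hs : s.IsAdmissible G T D) (k : ℕ)
    (r : ConsIdx V D) :
    augVec D x v k r = ∑ t ∈ Finset.range k,
      prodFrom (consMatrix G W s D) t (k - t) r (Sum.inl (s.active t)) •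
        (-(γ t • (m t).z (s.active t))) := by
  rw [eq_sum_prodFrom (consMatrix G W s D) (augVec D x v) (fun t => Sum.inl (s.active t)) _
    (h.augVec_succ hs)]
  simp [h.augVec_zero]

theorem center_zero (h : IsPath G W A dF γ s x v m y N) : center x v ψ 0 = 0 := by
  simp [center, h.augVec_zero]

theorem center_succ [Nonempty V] (h : IsPath G W A dF γ s x v m y N) (hs : s.IsAdmissible G T D)
    (hψ : IsConsensusLimit G W s D C q ψ) (hq : 0 < q) (hq1 : q < 1) (k : ℕ) :
    center x v ψ (k + 1) = center x v ψ k
      + ψ k (Sum.inl (s.active k)) • (-(γ k • (m k).z (s.active k))) := by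
  simp only [center, h.augVec_succ hs, smul_add, Finset.sum_add_distrib, Finset.smul_sum]
  rw [Finset.sum_comm]
  simp only [smul_smul, ← Finset.sum_smul, hψ.sum_mul hq hq1]

theorem center_eq [Nonempty V] (h : IsPath G W A dF γ s x v m y N) (hs : s.IsAdmissible G T D)
    (hψ : IsConsensusLimit G W s D C q ψ) (hq : 0 < q) (hq1 : q < 1) (k : ℕ) :
    center x v ψ k = ∑ t ∈ Finset.range k,
      ψ t (Sum.inl (s.active t)) • (-(γ t • (m t).z (s.active t))) := by
  induction k with
  | zero => simp [h.center_zero]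
  | succ k ih => rw [h.center_succ hs hψ hq hq1, ih, Finset.sum_range_succ]

theorem norm_center_sub_le [Nonempty V] (h : IsPath G W A dF γ s x v m y N)
    (hs : s.IsAdmissible G T D) (hγ : ∀ k, 0 < γ k)
    (hψ : IsConsensusLimit G W s D C q ψ) (hq : 0 < q) (hq1 : q < 1) {t k : ℕ} (htk : t ≤ k) :
    ‖center x v ψ k - center x v ψ t‖ ≤ ∑ l ∈ Finset.Ico t k, moveLen γ s m l := by
  rw [h.center_eq hs hψ hq hq1, h.center_eq hs hψ hq hq1, ← Finset.sum_Ico_eq_sub _ htk]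
  refine norm_sum_le_of_le _ fun l _ => ?_
  rw [norm_smul, norm_neg_smul_z hγ, Real.norm_eq_abs, abs_of_nonneg ((hψ.1 l).1 _)]
  exact mul_le_of_le_one_left (moveLen_nonneg hγ l) (le_one_of_mem_stdSimplex (hψ.1 l) _)

theorem norm_augVec_sub_center_le [Nonempty V] (h : IsPath G W A dF γ s x v m y N)
    (hs : s.IsAdmissible G T D) (hγ : ∀ k, 0 < γ k)
    (hψ : IsConsensusLimit G W s D C q ψ) (hq : 0 < q) (hq1 : q < 1) (k : ℕ)
    (r : ConsIdx V D) :
    ‖augVec D x v k r - center x v ψ k‖ ≤ C * conv q (moveLen γ s m) k := by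
  rw [h.center_eq hs hψ hq hq1, h.augVec_eq hs, ← Finset.sum_sub_distrib, conv, Finset.mul_sum]
  refine norm_sum_le_of_le _ fun t ht => ?_
  rw [← sub_smul, norm_smul, norm_neg_smul_z hγ, Real.norm_eq_abs, ← mul_assoc]
  exact mul_le_mul_of_nonneg_right (hψ.2 t k (Finset.mem_range.mp ht).le r _)
    (moveLen_nonneg hγ t)

theorem errC_le [Nonempty V] (h : IsPath G W A dF γ s x v m y N)
    (hs : s.IsAdmissible G T D) (hγ : ∀ k, 0 < γ k)
    (hψ : IsConsensusLimit G W s D C q ψ) (hq : 0 < q) (hq1 : q < 1) (k : ℕ) :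
    errC (augVec D x v k) (ψ k)
      ≤ Fintype.card (ConsIdx V D) * (C * conv q (moveLen γ s m) k) ^ 2 := by
  rw [errC, ← nsmul_eq_mul]
  refine Finset.sum_le_card_nsmul _ _ _ fun r _ => ?_
  exact pow_le_pow_left₀ (norm_nonneg _) (h.norm_augVec_sub_center_le hs hγ hψ hq hq1 k r) 2

theorem sum_errC_le [Nonempty V] (h : IsPath G W A dF γ s x v m y N)
    (hs : s.IsAdmissible G T D) (hγ : ∀ k, 0 < γ k)
    (hψ : IsConsensusLimit G W s D C q ψ) (hq : 0 < q) (hq1 : q < 1) (K : ℕ) :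
    ∑ k ∈ Finset.range K, errC (augVec D x v k) (ψ k)
      ≤ Fintype.card (ConsIdx V D) * C ^ 2 * (1 - q)⁻¹ ^ 2
        * ∑ k ∈ Finset.range K, moveLen γ s m k ^ 2 := by
  calc _ ≤ ∑ k ∈ Finset.range K, Fintype.card (ConsIdx V D) * C ^ 2
          * conv q (moveLen γ s m) k ^ 2 :=
        Finset.sum_le_sum fun k _ => (h.errC_le hs hγ hψ hq hq1 k).trans (le_of_eq (by ring))
    _ ≤ Fintype.card (ConsIdx V D) * C ^ 2 *
          ((1 - q)⁻¹ ^ 2 * ∑ k ∈ Finset.range K, moveLen γ s m k ^ 2) := by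
        rw [← Finset.mul_sum]
        exact mul_le_mul_of_nonneg_left (sum_conv_sq_le hq.le hq1 _ K) (by positivity)
    _ = _ := by ring

/-- The active agent moves no farther than its gradient step and the consensus error. -/
theorem norm_x_succ_sub_le [Nonempty V] (h : IsPath G W A dF γ s x v m y N)
    (hWA : IsMixingPair G W A mbar)
    (hs : s.IsAdmissible G T D) (hγ : ∀ k, 0 < γ k)
    (hψ : IsConsensusLimit G W s D C q ψ) (hq : 0 < q) (hq1 : q < 1) (k : ℕ) :
    ‖x (k + 1) (s.active k) - x k (s.active k)‖
      ≤ moveLen γ s m k + 2 * (C * conv q (moveLen γ s m) k) := by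
  have hM := consMatrix_rowStoch hWA hs k
  have h1 := h.augVec_succ hs k (Sum.inl (s.active k))
  have hd := fun c => (h.norm_augVec_sub_center_le hs hγ hψ hq hq1 k c)
  have e : x (k + 1) (s.active k) - x k (s.active k)
      = ∑ c, consMatrix G W s D k (Sum.inl (s.active k)) c •
          (augVec D x v k c - augVec D x v k (Sum.inl (s.active k)))
        + consMatrix G W s D k (Sum.inl (s.active k)) (Sum.inl (s.active k)) •
          (-(γ k • (m k).z (s.active k))) := by
    change augVec D x v (k + 1) (Sum.inl (s.active k))
      - augVec D x v k (Sum.inl (s.active k)) = _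
    rw [h1]
    simp only [smul_sub, Finset.sum_sub_distrib, ← Finset.sum_smul, hM.sum_row, one_smul]
    abel
  rw [e, add_comm (moveLen γ s m k)]
  refine norm_add_le_of_le ?_ ?_
  · calc _ ≤ ∑ c, consMatrix G W s D k (Sum.inl (s.active k)) c
            * (2 * (C * conv q (moveLen γ s m) k)) := by
          refine norm_sum_le_of_le _ fun c _ => ?_
          rw [norm_smul, Real.norm_eq_abs, abs_of_nonneg (hM.nonneg _ _)]
          refine mul_le_mul_of_nonneg_left ?_ (hM.nonneg _ _)
          rw [← sub_sub_sub_cancel_right _ _ (center x v ψ k)]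
          refine (norm_sub_le _ _).trans ?_
          linarith [hd c, hd (Sum.inl (s.active k))]
      _ = _ := by rw [← Finset.sum_mul, hM.sum_row, one_mul]
  · rw [norm_smul, norm_neg_smul_z hγ, Real.norm_eq_abs, abs_of_nonneg (hM.nonneg _ _)]
    exact mul_le_of_le_one_left (moveLen_nonneg hγ k) (hM.le_one _ _)

/-- Only the active agent moves. -/
theorem x_succ_of_ne (h : IsPath G W A dF γ s x v m y N) {k : ℕ} {j : V} (hj : j ≠ s.active k) :
    x (k + 1) j = x k j := by
  rw [h.x_succ, Function.update_of_ne hj]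

/-- Conservation of mass: the exact tracking variables sum up to the sum of the gradients. -/
theorem total_y (h : IsPath G W A dF γ s x v m y N) (hWA : IsMixingPair G W A mbar)
    (hs : s.IsAdmissible G T D) (k : ℕ) : (y k).total G = ∑ j, dF j (x k j) := by
  rw [total_eq h.y_zero hWA h.y_succ hs]
  induction k with
  | zero => simp [h.x_zero]
  | succ k ih =>
    rw [Finset.sum_range_succ, ← add_assoc, ih, eq_comm, ← sub_eq_iff_eq_add',
      ← Finset.sum_sub_distrib, Finset.sum_eq_single (s.active k)]
    · intro j _ hj
      rw [h.x_succ_of_ne hj, sub_self]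
    · simp

/-- The exact tracking variable of an agent and its share of the total mass differ by a convolution
of the gradient increments, which are bounded by the moves of the iterates. -/
theorem norm_y_sub_le [Nonempty V] (h : IsPath G W A dF γ s x v m y N)
    (hWA : IsMixingPair G W A mbar)
    (hs : s.IsAdmissible G T D) (hγ : ∀ k, 0 < γ k)
    (hdF : ∀ i x y, ‖dF i x - dF i y‖ ≤ L i * ‖x - y‖)
    (hψ : IsConsensusLimit G W s D C q ψ) (hξ : IsTrackingLimit G A s D C q ξ)
    (hC : 0 < C) (hq : 0 < q) (hq1 : q < 1) (k : ℕ) (i : V) :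
    ‖(y k).z i - ξ k (Sum.inl i) • (y k).total G‖
      ≤ C * (∑ j, ‖dF j 0‖) * q ^ k + C * (∑ j, (L j : ℝ)) *
        conv q (fun t => moveLen γ s m t + 2 * (C * conv q (moveLen γ s m) t)) k := by
  have e : (y k).z i = augMass (G := G) D s y k (Sum.inl i) := rfl
  rw [e, augMass_eq h.y_zero h.y_succ hs, total_eq h.y_zero hWA h.y_succ hs, smul_add,
    add_sub_add_comm, Finset.smul_sum, Finset.smul_sum, ← Finset.sum_sub_distrib,
    ← Finset.sum_sub_distrib]
  refine norm_add_le_of_le ?_ ?_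
  · rw [Finset.mul_sum, Finset.sum_mul]
    refine norm_sum_le_of_le _ fun j _ => ?_
    rw [← sub_smul, norm_smul, Real.norm_eq_abs]
    have := mul_le_mul_of_nonneg_right (hξ.2 0 k (Nat.zero_le k) i j) (norm_nonneg (dF j 0))
    rw [Nat.sub_zero] at this
    linarith
  · rw [conv, Finset.mul_sum]
    refine norm_sum_le_of_le _ fun t ht => ?_
    rw [← sub_smul, norm_smul, Real.norm_eq_abs]
    have hL : (L (s.active t) : ℝ) ≤ ∑ j, (L j : ℝ) :=
      Finset.single_le_sum (f := fun j => (L j : ℝ)) (fun j _ => (L j).coe_nonneg)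
        (Finset.mem_univ _)
    have hm := h.norm_x_succ_sub_le hWA hs hγ hψ hq hq1 t
    calc _ ≤ (C * q ^ (k - t)) * ((∑ j, (L j : ℝ)) *
            (moveLen γ s m t + 2 * (C * conv q (moveLen γ s m) t))) := by
          refine mul_le_mul (hξ.2 t k (Finset.mem_range.mp ht).le i _) ?_ (norm_nonneg _)
            (by positivity)
          exact (hdF _ _ _).trans (mul_le_mul hL hm (norm_nonneg _)
            (Finset.sum_nonneg fun j _ => (L j).coe_nonneg))
      _ = _ := by ring

/-- Summed tracking errors, with a constant which does not depend on the trajectory. -/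
theorem sum_errT_le [Nonempty V] (h : IsPath G W A dF γ s x v m y N)
    (hWA : IsMixingPair G W A mbar)
    (hs : s.IsAdmissible G T D) (hγ : ∀ k, 0 < γ k)
    (hdF : ∀ i x y, ‖dF i x - dF i y‖ ≤ L i * ‖x - y‖)
    (hψ : IsConsensusLimit G W s D C q ψ) (hξ : IsTrackingLimit G A s D C q ξ)
    (hC : 0 < C) (hq : 0 < q) (hq1 : q < 1) (K : ℕ) :
    ∑ k ∈ Finset.range K, errT G (y k) (ξ k) (s.active k)
      ≤ 2 * (C * ∑ j, ‖dF j 0‖) ^ 2 * (1 - q)⁻¹ + 2 * (C * ∑ j, (L j : ℝ)) ^ 2 * (1 - q)⁻¹ ^ 2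
          * (2 + 8 * C ^ 2 * (1 - q)⁻¹ ^ 2) * ∑ k ∈ Finset.range K, moveLen γ s m k ^ 2 := by
  set a := moveLen γ s m with ha
  set b : ℕ → ℝ := fun t => a t + 2 * (C * conv q a t) with hb
  have hgeo : ∑ k ∈ Finset.range K, q ^ k ≤ (1 - q)⁻¹ :=
    (summable_geometric_of_lt_one hq.le hq1).sum_le_tsum _ (fun k _ => by positivity)
      |>.trans_eq (tsum_geometric_of_lt_one hq.le hq1)
  have hb2 : ∑ k ∈ Finset.range K, b k ^ 2
      ≤ (2 + 8 * C ^ 2 * (1 - q)⁻¹ ^ 2) * ∑ k ∈ Finset.range K, a k ^ 2 := by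
    calc _ ≤ ∑ k ∈ Finset.range K, (2 * a k ^ 2 + 8 * C ^ 2 * conv q a k ^ 2) := by
          refine Finset.sum_le_sum fun k _ => ?_
          simp only [hb]
          nlinarith [sq_nonneg (a k - 2 * (C * conv q a k))]
      _ = 2 * ∑ k ∈ Finset.range K, a k ^ 2
          + 8 * C ^ 2 * ∑ k ∈ Finset.range K, conv q a k ^ 2 := by
          rw [Finset.sum_add_distrib, Finset.mul_sum, Finset.mul_sum]
      _ ≤ 2 * ∑ k ∈ Finset.range K, a k ^ 2
          + 8 * C ^ 2 * ((1 - q)⁻¹ ^ 2 * ∑ k ∈ Finset.range K, a k ^ 2) := by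
          gcongr
          exact sum_conv_sq_le hq.le hq1 a K
      _ = _ := by ring
  calc _ ≤ ∑ k ∈ Finset.range K, (2 * (C * ∑ j, ‖dF j 0‖) ^ 2 * q ^ k
          + 2 * (C * ∑ j, (L j : ℝ)) ^ 2 * conv q b k ^ 2) := by
        refine Finset.sum_le_sum fun k _ => ?_
        rw [errT]
        refine (pow_le_pow_left₀ (norm_nonneg _)
          (h.norm_y_sub_le hWA hs hγ hdF hψ hξ hC hq hq1 k _) 2).trans ?_
        have hqk : (q ^ k) ^ 2 ≤ q ^ k :=
          pow_le_of_le_one (by positivity) (pow_le_one₀ hq.le hq1.le) two_ne_zero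
        have h2 := mul_le_mul_of_nonneg_left hqk (sq_nonneg (C * ∑ j, ‖dF j 0‖))
        have h3 := sq_nonneg (C * (∑ j, ‖dF j 0‖) * q ^ k - C * (∑ j, (L j : ℝ)) * conv q b k)
        rw [← ha, ← hb]
        nlinarith
    _ = 2 * (C * ∑ j, ‖dF j 0‖) ^ 2 * ∑ k ∈ Finset.range K, q ^ k
          + 2 * (C * ∑ j, (L j : ℝ)) ^ 2 * ∑ k ∈ Finset.range K, conv q b k ^ 2 := by
        rw [Finset.sum_add_distrib, ← Finset.mul_sum, ← Finset.mul_sum]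
    _ ≤ 2 * (C * ∑ j, ‖dF j 0‖) ^ 2 * (1 - q)⁻¹ + 2 * (C * ∑ j, (L j : ℝ)) ^ 2 *
          ((1 - q)⁻¹ ^ 2 * ((2 + 8 * C ^ 2 * (1 - q)⁻¹ ^ 2)
            * ∑ k ∈ Finset.range K, a k ^ 2)) := by
        gcongr
        refine (sum_conv_sq_le hq.le hq1 b K).trans ?_
        gcongr
    _ = _ := by ring

end IsPath

/-! ### The accumulated gradient noise -/

/-- The weight in the tracked gradient of the active agent of iteration `k` of the noise which
agent `j` holds at time `t`. -/
def noiseCoef (G : Digraph V) (A : Matrix V V ℝ) (s : Schedule V) (D k t : ℕ) (j : V) : ℝ :=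
  (if t = 0 then 0 else
    prodFrom (massMatrix G A s D) (t - 1) (k - (t - 1)) (Sum.inl (s.active k)) (Sum.inl j)
      - prodFrom (massMatrix G A s D) t (k - t) (Sum.inl (s.active k)) (Sum.inl j))
  + if t = k ∧ j = s.active k then 1 else 0

theorem summation_by_parts {E : Type*} [AddCommGroup E] [Module ℝ E] (p : ℕ → ℝ) (N : ℕ → E)
    (k : ℕ) : p 0 • N 0 + ∑ t ∈ Finset.range k, p t • (N (t + 1) - N t)
      = ∑ t ∈ Finset.range (k + 1),
        ((if t = 0 then 0 else p (t - 1) - p t) + if t = k then p k else 0) • N t := by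
  have h1 : p 0 • N 0 + ∑ t ∈ Finset.range k, p t • (N (t + 1) - N t)
      = ∑ t ∈ Finset.range k, (p t - p (t + 1)) • N (t + 1) + p k • N k := by
    induction k with
    | zero => simp
    | succ k ih =>
      rw [Finset.sum_range_succ, ← add_assoc, ih, Finset.sum_range_succ]
      simp only [smul_sub, sub_smul]
      abel
  rw [h1]
  simp only [add_smul, Finset.sum_add_distrib]
  congr 1
  · rw [Finset.sum_range_succ']
    simp
  · rw [Finset.sum_eq_single k]
    · simp
    · intro t _ ht
      simp [ht]
    · simp

namespace IsPath

/-- The noise enters the tracking recursion through its increments; summation by parts turns these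
into the noise held by the agents. -/
theorem z_sub_eq (h : IsPath G W A dF γ s x v m y N) (hs : s.IsAdmissible G T D) (k : ℕ) :
    (m k).z (s.active k) - (y k).z (s.active k)
      = ∑ t ∈ Finset.range (k + 1), ∑ j, noiseCoef G A s D k t j • N t j := by
  have e : ∀ m : ℕ → Mass V n, (m k).z (s.active k)
    = augMass (G := G) D s m k (Sum.inl (s.active k)) := fun _ => rfl
  have hN : ∀ t j, j ≠ s.active t → N (t + 1) j - N t j = 0 := fun t j hj => by
    rw [h.N_succ t j hj, sub_self]
  rw [e, e, augMass_eq h.m_zero h.m_succ hs, augMass_eq h.y_zero h.y_succ hs, add_sub_add_comm,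
    ← Finset.sum_sub_distrib, ← Finset.sum_sub_distrib]
  simp only [← smul_sub, add_sub_cancel_left]
  have e2 : ∀ t ∈ Finset.range k,
      prodFrom (massMatrix G A s D) t (k - t) (Sum.inl (s.active k)) (Sum.inl (s.active t)) •
        (N (t + 1) (s.active t) - N t (s.active t))
      = ∑ j, prodFrom (massMatrix G A s D) t (k - t) (Sum.inl (s.active k)) (Sum.inl j) •
        (N (t + 1) j - N t j) := fun t _ => by
    rw [Finset.sum_eq_single (s.active t)]
    · intro j _ hj
      rw [hN t j hj, smul_zero]
    · simp
  rw [Finset.sum_congr rfl e2, Finset.sum_comm, ← Finset.sum_add_distrib, Finset.sum_comm]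
  refine Finset.sum_congr rfl fun j _ => ?_
  have key := summation_by_parts
    (fun t => prodFrom (massMatrix G A s D) t (k - t) (Sum.inl (s.active k)) (Sum.inl j))
    (fun t => N t j) k
  simp only [Nat.sub_zero] at key
  rw [key]
  refine Finset.sum_congr rfl fun t _ => ?_
  rw [noiseCoef]
  congr 2
  rw [Nat.sub_self, prodFrom_zero_apply]
  by_cases h1 : t = k <;> by_cases h2 : s.active k = j <;> simp [h1, h2, eq_comm]

end IsPath

/-- Consecutive products have almost the same agent entries, as both are close to the mixing
weights. -/
theorem abs_noiseCoef_le (hξ : IsTrackingLimit G A s D C q ξ) (hC : 0 < C) (hq : 0 < q)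
    (hq1 : q < 1) {k t : ℕ} (htk : t ≤ k) (j : V) :
    |noiseCoef G A s D k t j| ≤ (2 * C + 1) * q ^ (k - t) := by
  have hp : 0 < q ^ (k - t) := by positivity
  rw [noiseCoef]
  refine (abs_add_le _ _).trans ?_
  rw [add_mul]
  refine add_le_add ?_ ?_
  · split_ifs with h0
    · rw [abs_zero]; positivity
    · have h1 := hξ.2 (t - 1) k (by omega) (s.active k) j
      have h2 := hξ.2 t k htk (s.active k) j
      have h3 : q ^ (k - (t - 1)) ≤ q ^ (k - t) :=
        pow_le_pow_of_le_one hq.le hq1.le (by omega)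
      have h4 := mul_le_mul_of_nonneg_left h3 hC.le
      rw [abs_le] at *
      constructor <;> linarith [h1.1, h1.2, h2.1, h2.2]
  · split_ifs with h1
    · simp [h1.1]
    · rw [abs_zero]; positivity

/-- The size of all noise vectors held at time `t`. -/
def noiseLen (N : ℕ → V → Vec n) (t : ℕ) : ℝ := ∑ j, ‖N t j‖

theorem noiseLen_nonneg (t : ℕ) : 0 ≤ noiseLen N t := Finset.sum_nonneg fun _ _ => norm_nonneg _

theorem sum_range_succ_eq_conv (q : ℝ) (a : ℕ → ℝ) (k : ℕ) :
    ∑ t ∈ Finset.range (k + 1), q ^ (k - t) * a t = conv q a k + a k := by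
  rw [Finset.sum_range_succ, conv]
  simp

namespace IsPath

theorem norm_z_sub_le (h : IsPath G W A dF γ s x v m y N) (hs : s.IsAdmissible G T D)
    (hξ : IsTrackingLimit G A s D C q ξ) (hC : 0 < C) (hq : 0 < q) (hq1 : q < 1) (k : ℕ) :
    ‖(m k).z (s.active k) - (y k).z (s.active k)‖
      ≤ (2 * C + 1) * (conv q (noiseLen N) k + noiseLen N k) := by
  rw [h.z_sub_eq hs, ← sum_range_succ_eq_conv, Finset.mul_sum]
  refine norm_sum_le_of_le _ fun t ht => ?_
  rw [noiseLen, Finset.mul_sum, Finset.mul_sum]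
  refine norm_sum_le_of_le _ fun j _ => ?_
  rw [norm_smul, Real.norm_eq_abs, ← mul_assoc]
  exact mul_le_mul_of_nonneg_right
    (abs_noiseCoef_le hξ hC hq hq1 (by have := Finset.mem_range.mp ht; omega) j) (norm_nonneg _)

/-- The inner product of the gradient at the center and the accumulated noise, up to replacing
the gradient at time `k` by one evaluated before the noise arose. -/
theorem abs_inner_noise_sub_le [Nonempty V] (h : IsPath G W A dF γ s x v m y N)
    (hs : s.IsAdmissible G T D) (hγ : ∀ k, 0 < γ k)
    (hdF : ∀ i x y, ‖dF i x - dF i y‖ ≤ L i * ‖x - y‖)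
    (hψ : IsConsensusLimit G W s D C q ψ) (hξ : IsTrackingLimit G A s D C q ξ)
    (hC : 0 < C) (hq : 0 < q) (hq1 : q < 1) {p : ℝ} (hp : 0 < p) (hp1 : p < 1) (hpq : p ^ 2 = q)
    (k : ℕ) :
    |inner ℝ (∑ i, dF i (center x v ψ k)) ((m k).z (s.active k) - (y k).z (s.active k))
      - ∑ t ∈ Finset.range (k + 1), ∑ j,
        noiseCoef G A s D k t j * inner ℝ (∑ i, dF i (center x v ψ (t - T))) (N t j)|
    ≤ (2 * C + 1) * (∑ i, (L i : ℝ)) * (p ^ T)⁻¹ * (conv p (noiseLen N) k + noiseLen N k)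
        * conv p (moveLen γ s m) k := by
  rw [h.z_sub_eq hs, inner_sum, ← Finset.sum_sub_distrib, ← sum_range_succ_eq_conv,
    Finset.mul_sum (Finset.range (k + 1)), Finset.sum_mul (Finset.range (k + 1))]
  refine norm_sum_le_of_le (E := ℝ) _ fun t ht => ?_
  have htk : t ≤ k := by have := Finset.mem_range.mp ht; omega
  have hΛ : (0 : ℝ) ≤ ∑ i, (L i : ℝ) := Finset.sum_nonneg fun j _ => (L j).coe_nonneg
  have ha := fun t => moveLen_nonneg (s := s) (m := m) hγ t
  -- the gradient changes little between the times `t - T` and `k`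
  have h1 : ‖∑ i, dF i (center x v ψ k) - ∑ i, dF i (center x v ψ (t - T))‖
      ≤ (∑ i, (L i : ℝ)) * ∑ l ∈ Finset.Ico (t - T) k, moveLen γ s m l := by
    rw [← Finset.sum_sub_distrib, Finset.sum_mul]
    exact norm_sum_le_of_le _ fun i _ => (hdF i _ _).trans (mul_le_mul_of_nonneg_left
      (h.norm_center_sub_le hs hγ hψ hq hq1 (by omega)) (L i).coe_nonneg)
  have h2 : p ^ (k - t) * ∑ l ∈ Finset.Ico (t - T) k, moveLen γ s m l
      ≤ (p ^ T)⁻¹ * conv p (moveLen γ s m) k := by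
    rw [conv, Finset.mul_sum, Finset.mul_sum]
    refine (Finset.sum_le_sum fun l hl => ?_).trans (Finset.sum_le_sum_of_subset_of_nonneg
      (s := Finset.Ico (t - T) k) (fun l hl => ?_) fun l _ _ =>
        mul_nonneg (by positivity) (mul_nonneg (by positivity) (ha l)))
    · rw [Finset.mem_Ico] at hl
      rw [← mul_assoc]
      refine mul_le_mul_of_nonneg_right ?_ (ha l)
      rw [le_inv_mul_iff₀ (by positivity), ← pow_add]
      exact pow_le_pow_of_le_one hp.le hp1.le (by omega)
    · rw [Finset.mem_Ico] at hl
      exact Finset.mem_range.mpr hl.2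
  have h3 : ∀ j, |noiseCoef G A s D k t j *
      inner ℝ (∑ i, dF i (center x v ψ k) - ∑ i, dF i (center x v ψ (t - T))) (N t j)|
      ≤ (2 * C + 1) * (∑ i, (L i : ℝ)) * (p ^ T)⁻¹ * (p ^ (k - t) * ‖N t j‖)
        * conv p (moveLen γ s m) k := by
    intro j
    rw [abs_mul]
    calc _ ≤ ((2 * C + 1) * q ^ (k - t)) * (((∑ i, (L i : ℝ)) *
            ∑ l ∈ Finset.Ico (t - T) k, moveLen γ s m l) * ‖N t j‖) :=
          mul_le_mul (abs_noiseCoef_le hξ hC hq hq1 htk j)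
            ((abs_real_inner_le_norm _ _).trans (mul_le_mul_of_nonneg_right h1 (norm_nonneg _)))
            (abs_nonneg _) (by positivity)
      _ = (2 * C + 1) * (∑ i, (L i : ℝ)) * (p ^ (k - t) * ‖N t j‖) *
            (p ^ (k - t) * ∑ l ∈ Finset.Ico (t - T) k, moveLen γ s m l) := by
          rw [← hpq, ← pow_mul, mul_comm 2, pow_mul]; ring
      _ ≤ (2 * C + 1) * (∑ i, (L i : ℝ)) * (p ^ (k - t) * ‖N t j‖) *
            ((p ^ T)⁻¹ * conv p (moveLen γ s m) k) :=
          mul_le_mul_of_nonneg_left h2 (by positivity)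
      _ = _ := by ring
  have e : inner ℝ (∑ i, dF i (center x v ψ k)) (∑ j, noiseCoef G A s D k t j • N t j)
      - ∑ j, noiseCoef G A s D k t j * inner ℝ (∑ i, dF i (center x v ψ (t - T))) (N t j)
      = ∑ j, noiseCoef G A s D k t j *
        inner ℝ (∑ i, dF i (center x v ψ k) - ∑ i, dF i (center x v ψ (t - T))) (N t j) := by
    rw [inner_sum, ← Finset.sum_sub_distrib]
    refine Finset.sum_congr rfl fun j _ => ?_
    rw [inner_smul_right, inner_sub_left, mul_sub]
  rw [e]
  refine (norm_sum_le_of_le (E := ℝ) _ fun j _ => h3 j).trans_eq ?_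
  rw [noiseLen, ← Finset.sum_mul, ← Finset.mul_sum, ← Finset.mul_sum]

end IsPath

/-! ### Descent of the objective at the center -/

/-- A vector `z` near a multiple `a • u` of the gradient `u`, with `a` bounded below, has a positive
inner product with `u`, up to the error `w`. -/
theorem neg_inner_le {E : Type*} [NormedAddCommGroup E] [InnerProductSpace ℝ E] {u w z : E}
    {a η : ℝ} (hz : z = a • u + w) (hη : 0 < η) (ha : η ≤ a) (ha1 : a ≤ 1) :
    -inner ℝ u z ≤ -(1 / 2) * ‖z‖ ^ 2 + (2 * η)⁻¹ * ‖w‖ ^ 2 := by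
  have ha0 : 0 < a := hη.trans_le ha
  have h1 : a * inner ℝ u z = ‖z‖ ^ 2 - inner ℝ w z := by
    rw [← real_inner_self_eq_norm_sq, ← real_inner_smul_left, ← inner_sub_left]
    congr 1
    rw [hz]; abel
  have h2 : inner ℝ w z ≤ ‖w‖ * ‖z‖ := real_inner_le_norm w z
  have h3 : inner ℝ w z ≤ (1 / 2) * ‖z‖ ^ 2 + (1 / 2) * ‖w‖ ^ 2 := by
    nlinarith [sq_nonneg (‖w‖ - ‖z‖)]
  have h4 : inner ℝ u z = a⁻¹ * (‖z‖ ^ 2 - inner ℝ w z) := by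
    rw [← h1, inv_mul_cancel_left₀ ha0.ne']
  have h5 : 1 ≤ a⁻¹ := (one_le_inv₀ ha0).mpr ha1
  have h6 : a⁻¹ ≤ η⁻¹ := inv_anti₀ hη ha
  have h7 : (2 * η)⁻¹ = (1 / 2) * η⁻¹ := by rw [mul_inv]; norm_num
  rw [h4, h7]
  nlinarith [mul_le_mul_of_nonneg_left h3 (inv_pos.mpr ha0).le,
    mul_le_mul_of_nonneg_right h5 (sq_nonneg ‖z‖), mul_le_mul_of_nonneg_right h6 (sq_nonneg ‖w‖)]

namespace IsPath

/-- The total exact mass is the sum of the gradients at the iterates, which are near the center. -/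
theorem norm_total_sub_sq_le (h : IsPath G W A dF γ s x v m y N)
    (hWA : IsMixingPair G W A mbar) (hs : s.IsAdmissible G T D)
    (hdF : ∀ i x y, ‖dF i x - dF i y‖ ≤ L i * ‖x - y‖) (k : ℕ) :
    ‖(y k).total G - ∑ i, dF i (center x v ψ k)‖ ^ 2
      ≤ (∑ i, (L i : ℝ)) ^ 2 * errC (augVec D x v k) (ψ k) := by
  have h0 : 0 ≤ errC (augVec D x v k) (ψ k) := Finset.sum_nonneg fun _ _ => sq_nonneg _
  have h1 : ∀ i, ‖x k i - center x v ψ k‖ ≤ √(errC (augVec D x v k) (ψ k)) := fun i => by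
    refine Real.le_sqrt_of_sq_le ?_
    have h2 := Finset.single_le_sum (f := fun r => ‖augVec D x v k r - center x v ψ k‖ ^ 2)
      (fun _ _ => sq_nonneg _) (Finset.mem_univ (Sum.inl i : ConsIdx V D))
    exact h2
  have h2 : ‖(y k).total G - ∑ i, dF i (center x v ψ k)‖
      ≤ (∑ i, (L i : ℝ)) * √(errC (augVec D x v k) (ψ k)) := by
    rw [h.total_y hWA hs, ← Finset.sum_sub_distrib, Finset.sum_mul]
    exact norm_sum_le_of_le _ fun i _ => (hdF i _ _).trans
      (mul_le_mul_of_nonneg_left (h1 i) (L i).coe_nonneg)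
  calc _ ≤ ((∑ i, (L i : ℝ)) * √(errC (augVec D x v k) (ψ k))) ^ 2 :=
        pow_le_pow_left₀ (norm_nonneg _) h2 2
    _ = _ := by rw [mul_pow, Real.sq_sqrt h0]

/-- The tracked gradient of the active agent controls the decrease of the objective at the
center, up to errors of second order and a noise term of small mean. -/
theorem descent [Nonempty V] (h : IsPath G W A dF γ s x v m y N)
    (hWA : IsMixingPair G W A mbar) (hs : s.IsAdmissible G T D) (hγ : ∀ k, 0 < γ k)
    (hdF : ∀ i x y, ‖dF i x - dF i y‖ ≤ L i * ‖x - y‖)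
    (hψ : IsConsensusLimit G W s D C q ψ) (hξ : IsTrackingLimit G A s D C q ξ)
    (hC : 0 < C) (hq : 0 < q) (hq1 : q < 1) {p : ℝ} (hp : 0 < p) (hp1 : p < 1) (hpq : p ^ 2 = q)
    {F : Vec n → ℝ} (hF : ∀ x, HasGradientAt F (∑ i, dF i x) x) {η : ℝ} (hη : 0 < η) {k : ℕ}
    (hξη : η ≤ ξ k (Sum.inl (s.active k))) (hψη : η ≤ ψ k (Sum.inl (s.active k))) :
    γ k * (η / 2 * errZ (y k) (s.active k))
      ≤ F (center x v ψ k) - F (center x v ψ (k + 1))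
        + γ k * (η⁻¹ * ((∑ i, (L i : ℝ)) ^ 2 * errC (augVec D x v k) (ψ k)
            + errT G (y k) (ξ k) (s.active k)))
        + (∑ i, (L i : ℝ)) * moveLen γ s m k ^ 2
        + (2 * C + 1) * (∑ i, (L i : ℝ)) * (p ^ T)⁻¹ *
          (γ k ^ 2 * (conv p (noiseLen N) k + noiseLen N k) ^ 2 + conv p (moveLen γ s m) k ^ 2)
        - γ k * ∑ t ∈ Finset.range (k + 1), ∑ j, ψ k (Sum.inl (s.active k)) *
          noiseCoef G A s D k t j * inner ℝ (∑ i, dF i (center x v ψ (t - T))) (N t j) := by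
  set i := s.active k with hi
  set a := ψ k (Sum.inl i) with ha
  set u := ∑ i, dF i (center x v ψ k) with hu
  set Λ := ∑ i, (L i : ℝ) with hΛ
  set Ec := errC (augVec D x v k) (ψ k) with hEc
  set Et := errT G (y k) (ξ k) i with hEt
  set M := ∑ t ∈ Finset.range (k + 1), ∑ j,
    noiseCoef G A s D k t j * inner ℝ (∑ i, dF i (center x v ψ (t - T))) (N t j) with hM
  have hΛ0 : 0 ≤ Λ := Finset.sum_nonneg fun j _ => (L j).coe_nonneg
  have hEc0 : 0 ≤ Ec := Finset.sum_nonneg fun _ _ => sq_nonneg _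
  have hEt0 : 0 ≤ Et := sq_nonneg _
  have ha1 : a ≤ 1 := le_one_of_mem_stdSimplex (hψ.1 k) _
  have ha0 : 0 ≤ a := (hψ.1 k).1 _
  have hγk := hγ k
  -- the descent inequality for the step of the center
  have h1 := (abs_le.mp (abs_sub_sub_inner_le hΛ0 hF (fun x y => by
    rw [← Finset.sum_sub_distrib, hΛ, Finset.sum_mul]
    exact norm_sum_le_of_le _ fun i _ => hdF i x y) (center x v ψ k) (center x v ψ (k + 1)))).2
  rw [h.center_succ hs hψ hq hq1, add_sub_cancel_left, ← h.center_succ hs hψ hq hq1,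
    inner_smul_right, norm_smul, norm_neg_smul_z hγ, Real.norm_eq_abs, ← hi, ← ha,
    abs_of_nonneg ha0, inner_neg_right, inner_smul_right, ← hu] at h1
  have h2 : Λ * (a * moveLen γ s m k) ^ 2 ≤ Λ * moveLen γ s m k ^ 2 := by
    refine mul_le_mul_of_nonneg_left (pow_le_pow_left₀ ?_ ?_ 2) hΛ0
    · exact mul_nonneg ha0 (moveLen_nonneg hγ k)
    · exact mul_le_of_le_one_left (moveLen_nonneg hγ k) ha1
  -- the exact tracked gradient is a descent direction up to the errors
  have h3 := neg_inner_le (u := u) (z := (y k).z i)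
    (w := ((y k).z i - ξ k (Sum.inl i) • (y k).total G)
      + ξ k (Sum.inl i) • ((y k).total G - u))
    (by rw [smul_sub]; abel) hη hξη (le_one_of_mem_stdSimplex (hξ.1 k) _)
  have h4 : ‖((y k).z i - ξ k (Sum.inl i) • (y k).total G)
      + ξ k (Sum.inl i) • ((y k).total G - u)‖ ^ 2 ≤ 2 * (Λ ^ 2 * Ec + Et) := by
    have e1 : ‖ξ k (Sum.inl i) • ((y k).total G - u)‖ ^ 2 ≤ Λ ^ 2 * Ec := by
      refine le_trans ?_ (h.norm_total_sub_sq_le (ψ := ψ) hWA hs hdF k)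
      rw [norm_smul, Real.norm_eq_abs, abs_of_nonneg ((hξ.1 k).1 _)]
      refine pow_le_pow_left₀ (mul_nonneg ((hξ.1 k).1 _) (norm_nonneg _)) ?_ 2
      exact mul_le_of_le_one_left (norm_nonneg _) (le_one_of_mem_stdSimplex (hξ.1 k) _)
    have e2 : ‖(y k).z i - ξ k (Sum.inl i) • (y k).total G‖ ^ 2 = Et := rfl
    have e3 := norm_add_le ((y k).z i - ξ k (Sum.inl i) • (y k).total G)
      (ξ k (Sum.inl i) • ((y k).total G - u))
    have e4 := pow_le_pow_left₀ (norm_nonneg _) e3 2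
    nlinarith [sq_nonneg (‖(y k).z i - ξ k (Sum.inl i) • (y k).total G‖
      - ‖ξ k (Sum.inl i) • ((y k).total G - u)‖)]
  have h5 : a * -inner ℝ u ((y k).z i) ≤ -(η / 2) * errZ (y k) i + η⁻¹ * (Λ ^ 2 * Ec + Et) := by
    have e1 : (2 * η)⁻¹ * (2 * (Λ ^ 2 * Ec + Et)) = η⁻¹ * (Λ ^ 2 * Ec + Et) := by
      rw [mul_inv]; ring
    have e2 := mul_le_mul_of_nonneg_left h4 (by positivity : (0 : ℝ) ≤ (2 * η)⁻¹)
    rw [e1] at e2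
    have e3 : 0 ≤ η⁻¹ * (Λ ^ 2 * Ec + Et) := by positivity
    have e4 : 0 ≤ errZ (y k) i := sq_nonneg _
    have e5 : -inner ℝ u ((y k).z i) ≤ -(1 / 2) * errZ (y k) i + η⁻¹ * (Λ ^ 2 * Ec + Et) := by
      rw [errZ]; linarith
    linarith [mul_le_mul_of_nonneg_left e5 ha0, mul_le_mul_of_nonneg_right ha1 e3,
      mul_le_mul_of_nonneg_right hψη e4]
  -- the noise
  have h6 := h.abs_inner_noise_sub_le hs hγ hdF hψ hξ hC hq hq1 hp hp1 hpq k
  rw [← hM, ← hu, ← hi, ← hΛ] at h6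
  set b := conv p (noiseLen N) k + noiseLen N k with hb
  set c := conv p (moveLen γ s m) k with hc
  set K := (2 * C + 1) * Λ * (p ^ T)⁻¹ with hK
  have hK0 : 0 ≤ K := by positivity
  have hb0 : 0 ≤ b := add_nonneg (conv_nonneg hp.le (fun t => noiseLen_nonneg t) k)
    (noiseLen_nonneg k)
  have hc0 : 0 ≤ c := conv_nonneg hp.le (fun t => moveLen_nonneg hγ t) k
  have h7 : a * -inner ℝ u ((m k).z i - (y k).z i) ≤ K * b * c - a * M := by
    have e1 := (abs_le.mp h6).1
    have e2 : 0 ≤ K * b * c := by positivity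
    linarith [mul_le_mul_of_nonneg_left e1 ha0, mul_le_mul_of_nonneg_right ha1 e2]
  have h8 : γ k * (K * b * c) ≤ K * (γ k ^ 2 * b ^ 2 + c ^ 2) := by
    linarith [mul_nonneg hK0 (sq_nonneg (γ k * b - c)), mul_nonneg hK0 (sq_nonneg (γ k * b)),
      mul_nonneg hK0 (sq_nonneg c)]
  have h9 : ∑ t ∈ Finset.range (k + 1), ∑ j, a * noiseCoef G A s D k t j *
      inner ℝ (∑ i, dF i (center x v ψ (t - T))) (N t j) = a * M := by
    simp only [hM, Finset.mul_sum, mul_assoc]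
  rw [h9]
  have h10 : inner ℝ u ((m k).z i) = inner ℝ u ((y k).z i)
      + inner ℝ u ((m k).z i - (y k).z i) := by rw [← inner_add_right]; congr 1; abel
  rw [h10] at h1
  have h11 := mul_le_mul_of_nonneg_left h5 hγk.le
  have h12 := mul_le_mul_of_nonneg_left h7 hγk.le
  linarith

end IsPath

end

section

variable {V : Type*} [Fintype V] {G : Digraph V} {W A : Matrix V V ℝ} {mbar : ℝ} {T D n : ℕ}
  {dF : V → Vec n → Vec n} {γ : ℕ → ℝ} {L : V → ℝ≥0}
  {Ω : Type*} {mΩ : MeasurableSpace Ω} {μ : Measure Ω} {ℱ : Filtration ℕ mΩ}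
  {s : Ω → Schedule V} {x v : Ω → ℕ → V → Vec n} {m y : Ω → ℕ → Mass V n}
  {N : Ω → ℕ → V → Vec n} {σ : ℝ}

/-! ### Random trajectories -/

section Step

variable {m' : MeasurableSpace Ω}

theorem measurable_augVec_succ (hpath : ∀ ω, IsPath G W A dF γ (s ω) (x ω) (v ω) (m ω) (y ω) (N ω))
    (hs : ∀ ω, (s ω).IsAdmissible G T D)
    (ha : ∀ k i, MeasurableSet[m'] {ω | (s ω).active k = i})
    (hd : ∀ k j d, MeasurableSet[m'] {ω | (s ω).delay k j = d}) {k : ℕ}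
    (hh : ∀ r, Measurable[m'] fun ω => augVec D (x ω) (v ω) k r)
    (hz : ∀ i, Measurable[m'] fun ω => (m ω k).z i) (r : ConsIdx V D) :
    Measurable[m'] fun ω => augVec D (x ω) (v ω) (k + 1) r := by
  have hM := measurable_consMatrix (G := G) (W := W) (D := D) ha hd k r
  simp only [fun ω => (hpath ω).augVec_succ (hs ω) k r]
  refine (Finset.measurable_sum _ fun c _ => (hM c).smul (hh c)).add ?_
  exact measurable_index (ha k)
    (f := fun i ω => consMatrix G W (s ω) D k r (Sum.inl i) • (-(γ k • (m ω k).z i)))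
    fun i => (hM _).smul ((hz i).const_smul (γ k)).neg

theorem measurable_augMass_succ {Δ : Ω → ℕ → Vec n} (h0 : ∀ ω, ∃ z₀, m ω 0 = Mass.init z₀)
    (hm : ∀ ω k, m ω (k + 1) = massStep G A (s ω) k (m ω) (Δ ω k))
    (hs : ∀ ω, (s ω).IsAdmissible G T D)
    (ha : ∀ k i, MeasurableSet[m'] {ω | (s ω).active k = i})
    (hd : ∀ k j d, MeasurableSet[m'] {ω | (s ω).delay k j = d}) {k : ℕ}
    (hu : ∀ r : MassIdx G D, Measurable[m'] fun ω => augMass D (s ω) (m ω) k r)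
    (hΔ : Measurable[m'] fun ω => Δ ω k) (r : MassIdx G D) :
    Measurable[m'] fun ω => augMass D (s ω) (m ω) (k + 1) r := by
  have hM := measurable_massMatrix (G := G) (A := A) (D := D) ha hd k r
  simp only [fun ω => augMass_succ (h0 ω) (hm ω) (hs ω) k r]
  have hw : Measurable[m'] fun ω => massMatrix G A (s ω) D k r (Sum.inl ((s ω).active k)) :=
    measurable_index (ha k) (f := fun i ω => massMatrix G A (s ω) D k r (Sum.inl i)) fun i => hM _
  exact (Finset.measurable_sum _ fun c _ => (hM c).smul (hu c)).add (hw.smul hΔ)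

end Step

theorem continuous_of_lipschitz (hdF : ∀ i x y, ‖dF i x - dF i y‖ ≤ L i * ‖x - y‖) (i : V) :
    Continuous (dF i) :=
  (LipschitzWith.of_dist_le_mul (K := L i) fun x y => by
    simpa [dist_eq_norm] using hdF i x y).continuous

/-- The trajectories of the algorithm as a random process: everything is adapted, the noise of
the gradient evaluated in iteration `k` has conditional mean zero given the past, and all noise
has bounded variance. -/
structure IsRandomPath (μ : Measure Ω) (ℱ : Filtration ℕ mΩ) (G : Digraph V) (W A : Matrix V V ℝ)
    (dF : V → Vec n → Vec n) (γ : ℕ → ℝ) (T D : ℕ) (s : Ω → Schedule V)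
    (x v : Ω → ℕ → V → Vec n) (m y : Ω → ℕ → Mass V n) (N : Ω → ℕ → V → Vec n) (σ : ℝ) :
    Prop where
  path : ∀ ω, IsPath G W A dF γ (s ω) (x ω) (v ω) (m ω) (y ω) (N ω)
  admissible : ∀ ω, (s ω).IsAdmissible G T D
  active_meas : ∀ k i, MeasurableSet[ℱ 0] {ω | (s ω).active k = i}
  delay_meas : ∀ k j d, MeasurableSet[ℱ 0] {ω | (s ω).delay k j = d}
  augVec_meas : ∀ k r, Measurable[ℱ k] fun ω => augVec D (x ω) (v ω) k r
  augMass_meas : ∀ k (r : MassIdx G D), Measurable[ℱ k] fun ω => augMass D (s ω) (m ω) k r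
  noise_meas : ∀ k j, Measurable[ℱ k] fun ω => N ω k j
  var_zero : ∀ j, ∫⁻ ω, ‖N ω 0 j‖ₑ ^ 2 ∂μ ≤ ENNReal.ofReal (σ ^ 2)
  var : ∀ k, ∫⁻ ω, ‖N ω (k + 1) ((s ω).active k)‖ₑ ^ 2 ∂μ ≤ ENNReal.ofReal (σ ^ 2)
  unbiased : ∀ k, μ[fun ω => dF ((s ω).active k) (x ω (k + 1) ((s ω).active k))
      + N ω (k + 1) ((s ω).active k) | ℱ k]
    =ᵐ[μ] fun ω => dF ((s ω).active k) (x ω (k + 1) ((s ω).active k))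

theorem isRandomPath_run {Z : Type*} [MeasurableSpace Z] {g : V → Vec n → Z → Vec n}
    (hg : ∀ i, Measurable (Function.uncurry (g i)))
    (hdF : ∀ i x y, ‖dF i x - dF i y‖ ≤ L i * ‖x - y‖) {ζ₀ : Ω → Z} {ζ : ℕ → Ω → Z}
    (hs : ∀ ω, (s ω).IsAdmissible G T D)
    (hs_active : ∀ k i, MeasurableSet[ℱ 0] {ω | (s ω).active k = i})
    (hs_delay : ∀ k j d, MeasurableSet[ℱ 0] {ω | (s ω).delay k j = d})
    (hζ₀ : Measurable[ℱ 0] ζ₀) (hζ : ∀ k, Measurable[ℱ (k + 1)] (ζ k))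
    (hvar₀ : ∀ i, ∫⁻ ω, ‖g i 0 (ζ₀ ω) - dF i 0‖ₑ ^ 2 ∂μ ≤ ENNReal.ofReal (σ ^ 2))
    (hunbiased : ∀ k,
      μ[fun ω => g ((s ω).active k)
          (queryPoint G W A g γ (s ω) (ζ₀ ω) (fun t => ζ t ω) k) (ζ k ω) | ℱ k]
        =ᵐ[μ] fun ω => dF ((s ω).active k)
          (queryPoint G W A g γ (s ω) (ζ₀ ω) (fun t => ζ t ω) k))
    (hvar : ∀ k,
      ∫⁻ ω, ‖g ((s ω).active k)
            (queryPoint G W A g γ (s ω) (ζ₀ ω) (fun t => ζ t ω) k) (ζ k ω)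
          - dF ((s ω).active k)
            (queryPoint G W A g γ (s ω) (ζ₀ ω) (fun t => ζ t ω) k)‖ₑ ^ 2 ∂μ
        ≤ ENNReal.ofReal (σ ^ 2)) :
    IsRandomPath μ ℱ G W A dF γ T D s
      (fun ω k => (run G W A g γ (s ω) (ζ₀ ω) (fun t => ζ t ω) k).x)
      (fun ω k => (run G W A g γ (s ω) (ζ₀ ω) (fun t => ζ t ω) k).v)
      (fun ω k => (run G W A g γ (s ω) (ζ₀ ω) (fun t => ζ t ω) k).mass)
      (fun ω => exactMass G A dF (s ω)
        fun k => (run G W A g γ (s ω) (ζ₀ ω) (fun t => ζ t ω) k).x)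
      (fun ω => noise G W A g dF γ (s ω) (ζ₀ ω) (fun t => ζ t ω)) σ := by
  have hpath := fun ω => isPath_run (G := G) (W := W) (A := A) g γ (s ω) (ζ₀ ω)
    (fun t => ζ t ω) dF
  have hdFm : ∀ i, Measurable (dF i) := fun i => (continuous_of_lipschitz hdF i).measurable
  have hact : ∀ k t i, MeasurableSet[ℱ k] {ω | (s ω).active t = i} :=
    fun k t i => ℱ.mono (Nat.zero_le k) _ (hs_active t i)
  have hdel : ∀ k t j d, MeasurableSet[ℱ k] {ω | (s ω).delay t j = d} :=
    fun k t j d => ℱ.mono (Nat.zero_le k) _ (hs_delay t j d)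
  have hnoise : ∀ {k : ℕ} {m' : MeasurableSpace Ω} (j : V),
      Measurable[m'] (fun ω => (run G W A g γ (s ω) (ζ₀ ω) (fun t => ζ t ω) k).x j) →
      Measurable[m'] (fun ω => (run G W A g γ (s ω) (ζ₀ ω) (fun t => ζ t ω) k).smp j) →
      Measurable[m'] fun ω => noise G W A g dF γ (s ω) (ζ₀ ω) (fun t => ζ t ω) k j :=
    fun j hx hsm => ((hg j).comp (hx.prodMk hsm)).sub ((hdFm j).comp hx)
  -- at time `k`, all variables including the stored samples are known; the new iterate is known one
  -- step ahead, as the sample of iteration `k` enters only the new gradient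
  have key : ∀ k,
      (∀ r : ConsIdx V D, Measurable[ℱ k] fun ω => augVec D
        (fun k => (run G W A g γ (s ω) (ζ₀ ω) (fun t => ζ t ω) k).x)
        (fun k => (run G W A g γ (s ω) (ζ₀ ω) (fun t => ζ t ω) k).v) k r) ∧
      (∀ r : MassIdx G D, Measurable[ℱ k] fun ω => augMass D (s ω)
        (fun k => (run G W A g γ (s ω) (ζ₀ ω) (fun t => ζ t ω) k).mass) k r) ∧
      (∀ j, Measurable[ℱ k] fun ω =>
        (run G W A g γ (s ω) (ζ₀ ω) (fun t => ζ t ω) k).smp j) := by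
    intro k
    induction k with
    | zero =>
      refine ⟨fun r => ?_, fun r => ?_, fun j => ?_⟩
      · simp only [(hpath _).augVec_zero]
        exact measurable_const
      · simp only [fun ω => augMass_zero (s := s ω)
          (m := fun k => (run G W A g γ (s ω) (ζ₀ ω) (fun t => ζ t ω) k).mass) (hpath ω).m_zero r]
        rcases r with i | r
        · simp only [Sum.elim_inl]
          refine measurable_const.add (hnoise i ?_ ?_)
          · simp only [(hpath _).x_zero]
            exact measurable_const
          · simp only [run, State.init]
            exact hζ₀
        · exact measurable_const
      · simp only [run, State.init]
        exact hζ₀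
    | succ k ih =>
      obtain ⟨ih1, ih2, ih3⟩ := ih
      have hle : ℱ k ≤ ℱ (k + 1) := ℱ.mono (Nat.le_succ k)
      have h1 := measurable_augVec_succ hpath hs (hact k) (hdel k) ih1
        (fun i => ih2 (Sum.inl i))
      have h3 : ∀ j, Measurable[ℱ (k + 1)] fun ω =>
          (run G W A g γ (s ω) (ζ₀ ω) (fun t => ζ t ω) (k + 1)).smp j := by
        intro j
        simp only [run_succ, step, Function.update_apply]
        exact Measurable.ite (measurableSet_eq_active (hact (k + 1)) k j) (hζ k)
          ((ih3 j).mono hle le_rfl)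
      have hx : ∀ j, Measurable[ℱ (k + 1)] fun ω =>
          (run G W A g γ (s ω) (ζ₀ ω) (fun t => ζ t ω) (k + 1)).x j :=
        fun j => (h1 (Sum.inl j)).mono hle le_rfl
      have hx' : ∀ j, Measurable[ℱ (k + 1)] fun ω =>
          (run G W A g γ (s ω) (ζ₀ ω) (fun t => ζ t ω) k).x j :=
        fun j => (ih1 (Sum.inl j)).mono hle le_rfl
      refine ⟨fun r => (h1 r).mono hle le_rfl, fun r => ?_, h3⟩
      refine measurable_augMass_succ (fun ω => ⟨_, (hpath ω).m_zero⟩)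
        (fun ω => (hpath ω).m_succ) hs (hact (k + 1)) (hdel (k + 1))
        (fun r => (ih2 r).mono hle le_rfl) ?_ r
      refine measurable_index (hact (k + 1) k)
        (f := fun i ω => dF i ((run G W A g γ (s ω) (ζ₀ ω) (fun t => ζ t ω) (k + 1)).x i)
          - dF i ((run G W A g γ (s ω) (ζ₀ ω) (fun t => ζ t ω) k).x i)
          + (noise G W A g dF γ (s ω) (ζ₀ ω) (fun t => ζ t ω) (k + 1) i
            - noise G W A g dF γ (s ω) (ζ₀ ω) (fun t => ζ t ω) k i)) fun i => ?_
      exact (((hdFm i).comp (hx i)).sub ((hdFm i).comp (hx' i))).add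
        ((hnoise i (hx i) (h3 i)).sub (hnoise i (hx' i) ((ih3 i).mono hle le_rfl)))
  have hN : ∀ k ω, noise G W A g dF γ (s ω) (ζ₀ ω) (fun t => ζ t ω) (k + 1) ((s ω).active k)
      = g ((s ω).active k) (queryPoint G W A g γ (s ω) (ζ₀ ω) (fun t => ζ t ω) k) (ζ k ω)
        - dF ((s ω).active k) (queryPoint G W A g γ (s ω) (ζ₀ ω) (fun t => ζ t ω) k) := by
    intro k ω
    simp only [noise, queryPoint, run_succ, step, Function.update_self]
  refine ⟨hpath, hs, hs_active, hs_delay, fun k => (key k).1, fun k => (key k).2.1,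
    fun k j => hnoise j ((key k).1 (Sum.inl j)) ((key k).2.2 j), fun j => ?_, fun k => ?_,
    fun k => ?_⟩
  · simpa [noise, run, State.init] using hvar₀ j
  · simpa only [hN] using hvar k
  · simp only [hN]
    have h := hunbiased k
    simp only [queryPoint] at h ⊢
    simpa only [add_sub_cancel] using h

/-! ### Square integrability -/

section MemLp

theorem memLp_two_of_lintegral {E : Type*} [NormedAddCommGroup E] {f : Ω → E}
    (hf : AEStronglyMeasurable f μ) {c : ℝ} (hc : 0 ≤ c)
    (h : ∫⁻ ω, ‖f ω‖ₑ ^ 2 ∂μ ≤ ENNReal.ofReal c) :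
    MemLp f 2 μ ∧ ∫ ω, ‖f ω‖ ^ 2 ∂μ ≤ c := by
  constructor
  · rw [memLp_two_iff_integrable_sq_norm hf]
    refine ⟨hf.norm.pow 2, ?_⟩
    rw [HasFiniteIntegral]
    simp only [enorm_pow, enorm_norm]
    exact h.trans_lt ENNReal.ofReal_lt_top
  · rw [integral_eq_lintegral_of_nonneg_ae (f := fun ω => ‖f ω‖ ^ 2)
      (ae_of_all _ fun ω => sq_nonneg ‖f ω‖) (hf.norm.pow 2)]
    refine ENNReal.toReal_le_of_le_ofReal hc ?_
    simpa only [ENNReal.ofReal_pow (norm_nonneg _), ofReal_norm] using h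

/-- Square integrability is preserved by a linear recursion with random coefficients in `[-1, 1]`
and a dominated input. -/
theorem memLp_linear_step {E : Type*} [NormedAddCommGroup E] [NormedSpace ℝ E]
    {I : Type*} [Fintype I] {u : I → Ω → E} {M : Ω → I → ℝ} {w : Ω → ℝ}
    {d f : Ω → E} {b : Ω → ℝ} (hu : ∀ c, MemLp (u c) 2 μ) (hb : MemLp b 2 μ)
    (hd : ∀ ω, ‖d ω‖ ≤ b ω) (hM : ∀ ω c, |M ω c| ≤ 1) (hw : ∀ ω, |w ω| ≤ 1)
    (hf : AEStronglyMeasurable f μ) (h : ∀ ω, f ω = ∑ c, M ω c • u c ω + w ω • d ω) :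
    MemLp f 2 μ := by
  refine MemLp.mono' (g := fun ω => ∑ c, ‖u c ω‖ + b ω)
    ((memLp_finsetSum _ fun c _ => (hu c).norm).add hb) hf (ae_of_all _ fun ω => ?_)
  rw [h]
  refine norm_add_le_of_le (norm_sum_le_of_le _ fun c _ => ?_) ?_
  · rw [norm_smul, Real.norm_eq_abs]
    exact mul_le_of_le_one_left (norm_nonneg _) (hM ω c)
  · rw [norm_smul, Real.norm_eq_abs]
    exact (mul_le_of_le_one_left (norm_nonneg _) (hw ω)).trans (hd ω)

theorem memLp_comp_lipschitz [IsFiniteMeasure μ]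
    (hdF : ∀ i x y, ‖dF i x - dF i y‖ ≤ L i * ‖x - y‖) (i : V) {f : Ω → Vec n}
    (hf : MemLp f 2 μ) : MemLp (fun ω => dF i (f ω)) 2 μ := by
  have h1 : MemLp (fun _ : Ω => ‖dF i 0‖) 2 μ := memLp_const _
  have h2 : MemLp (fun ω => (L i : ℝ) * ‖f ω‖) 2 μ := hf.norm.const_mul _
  refine MemLp.mono' (h1.add h2)
    ((continuous_of_lipschitz hdF i).comp_aestronglyMeasurable hf.1) (ae_of_all _ fun ω => ?_)
  have h := hdF i (f ω) 0
  rw [sub_zero] at h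
  have h3 := norm_sub_norm_le (dF i (f ω)) (dF i 0)
  simp only [Pi.add_apply]
  linarith

/-- A vector chosen at random among finitely many square integrable ones. -/
theorem memLp_index {E : Type*} [NormedAddCommGroup E] [MeasurableSpace E] [BorelSpace E]
    [SecondCountableTopology E] {a : Ω → V} (ha : ∀ i, MeasurableSet {ω | a ω = i})
    {f : V → Ω → E} (hfm : ∀ i, Measurable (f i)) (hf : ∀ i, MemLp (f i) 2 μ) :
    MemLp (fun ω => f (a ω) ω) 2 μ := by
  refine MemLp.mono' (g := fun ω => ∑ i, ‖f i ω‖) (memLp_finsetSum _ fun i _ => (hf i).norm)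
    (measurable_index ha hfm).aestronglyMeasurable (ae_of_all _ fun ω => ?_)
  exact Finset.single_le_sum (f := fun i => ‖f i ω‖) (fun i _ => norm_nonneg _)
    (Finset.mem_univ (a ω))

end MemLp

namespace IsRandomPath

variable [IsProbabilityMeasure μ]

theorem measurable_active (h : IsRandomPath μ ℱ G W A dF γ T D s x v m y N σ) (k t : ℕ) (i : V) :
    MeasurableSet[ℱ k] {ω | (s ω).active t = i} :=
  ℱ.mono (Nat.zero_le k) _ (h.active_meas t i)

theorem measurable_delay (h : IsRandomPath μ ℱ G W A dF γ T D s x v m y N σ) (k t : ℕ) (j : V)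
    (d : ℕ) : MeasurableSet[ℱ k] {ω | (s ω).delay t j = d} :=
  ℱ.mono (Nat.zero_le k) _ (h.delay_meas t j d)

theorem measurable_augVec_next (h : IsRandomPath μ ℱ G W A dF γ T D s x v m y N σ) (k : ℕ)
    (r : ConsIdx V D) : Measurable[ℱ k] fun ω => augVec D (x ω) (v ω) (k + 1) r :=
  measurable_augVec_succ h.path h.admissible (h.measurable_active k) (h.measurable_delay k)
    (h.augVec_meas k) (fun i => h.augMass_meas k (Sum.inl i)) r

theorem measurable_newNoise (h : IsRandomPath μ ℱ G W A dF γ T D s x v m y N σ) (k : ℕ) :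
    Measurable fun ω => N ω (k + 1) ((s ω).active k) :=
  (measurable_index (h.measurable_active (k + 1) k) fun i => h.noise_meas (k + 1) i).mono
    (ℱ.le _) le_rfl

theorem memLp_newNoise (h : IsRandomPath μ ℱ G W A dF γ T D s x v m y N σ) (k : ℕ) :
    MemLp (fun ω => N ω (k + 1) ((s ω).active k)) 2 μ :=
  (memLp_two_of_lintegral (h.measurable_newNoise k).aestronglyMeasurable (sq_nonneg σ)
    (h.var k)).1

theorem integral_newNoise_sq_le (h : IsRandomPath μ ℱ G W A dF γ T D s x v m y N σ) (k : ℕ) :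
    ∫ ω, ‖N ω (k + 1) ((s ω).active k)‖ ^ 2 ∂μ ≤ σ ^ 2 :=
  (memLp_two_of_lintegral (h.measurable_newNoise k).aestronglyMeasurable (sq_nonneg σ)
    (h.var k)).2

theorem aesm_noise (h : IsRandomPath μ ℱ G W A dF γ T D s x v m y N σ) (k : ℕ) (j : V) :
    AEStronglyMeasurable (fun ω => N ω k j) μ :=
  ((h.noise_meas k j).mono (ℱ.le _) le_rfl).aestronglyMeasurable

theorem memLp_noise (h : IsRandomPath μ ℱ G W A dF γ T D s x v m y N σ) (k : ℕ) (j : V) :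
    MemLp (fun ω => N ω k j) 2 μ := by
  induction k with
  | zero => exact (memLp_two_of_lintegral (h.aesm_noise 0 j) (sq_nonneg σ) (h.var_zero j)).1
  | succ k ih =>
    refine MemLp.mono' (ih.norm.add (h.memLp_newNoise k).norm) (h.aesm_noise (k + 1) j)
      (ae_of_all _ fun ω => ?_)
    simp only [Pi.add_apply]
    by_cases hj : j = (s ω).active k
    · rw [hj]
      linarith [norm_nonneg (N ω k ((s ω).active k))]
    · rw [(h.path ω).N_succ k j hj]
      linarith [norm_nonneg (N ω (k + 1) ((s ω).active k))]

theorem memLp_step (hWA : IsMixingPair G W A mbar)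
    (hdF : ∀ i x y, ‖dF i x - dF i y‖ ≤ L i * ‖x - y‖)
    (h : IsRandomPath μ ℱ G W A dF γ T D s x v m y N σ) (k : ℕ) :
    (∀ r, MemLp (fun ω => augVec D (x ω) (v ω) k r) 2 μ) ∧
    (∀ r : MassIdx G D, MemLp (fun ω => augMass D (s ω) (m ω) k r) 2 μ) := by
  have haesm1 : ∀ k r, AEStronglyMeasurable (fun ω => augVec D (x ω) (v ω) k r) μ :=
    fun k r => ((h.augVec_meas k r).mono (ℱ.le _) le_rfl).aestronglyMeasurable
  have haesm2 : ∀ k (r : MassIdx G D),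
      AEStronglyMeasurable (fun ω => augMass D (s ω) (m ω) k r) μ :=
    fun k r => ((h.augMass_meas k r).mono (ℱ.le _) le_rfl).aestronglyMeasurable
  induction k with
  | zero =>
    refine ⟨fun r => ?_, fun r => ?_⟩
    · simp only [(h.path _).augVec_zero]
      exact memLp_const _
    · simp only [fun ω => augMass_zero (s := s ω) (h.path ω).m_zero r]
      rcases r with i | r
      · have h1 : MemLp (fun _ : Ω => dF i 0) 2 μ := memLp_const _
        exact h1.add (h.memLp_noise 0 i)
      · exact memLp_const (0 : Vec n)
  | succ k ih =>
    obtain ⟨ih1, ih2⟩ := ih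
    have h1 : ∀ r, MemLp (fun ω => augVec D (x ω) (v ω) (k + 1) r) 2 μ := by
      intro r
      refine memLp_linear_step (b := fun ω => |γ k| * ∑ i, ‖(m ω k).z i‖)
        (d := fun ω => -(γ k • (m ω k).z ((s ω).active k))) ih1
        ((memLp_finsetSum _ fun i _ => (ih2 (Sum.inl i)).norm).const_mul _) (fun ω => ?_)
        (fun ω c => ?_) (fun ω => ?_) (haesm1 _ r)
        (fun ω => (h.path ω).augVec_succ (h.admissible ω) k r)
      · rw [norm_neg, norm_smul, Real.norm_eq_abs]
        exact mul_le_mul_of_nonneg_left (Finset.single_le_sum (f := fun i => ‖(m ω k).z i‖)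
          (fun i _ => norm_nonneg _) (Finset.mem_univ _)) (abs_nonneg _)
      · have hM := consMatrix_rowStoch hWA (h.admissible ω) k
        rw [abs_of_nonneg (hM.nonneg _ _)]
        exact hM.le_one _ _
      · have hM := consMatrix_rowStoch hWA (h.admissible ω) k
        rw [abs_of_nonneg (hM.nonneg _ _)]
        exact hM.le_one _ _
    have hb : MemLp (fun ω => ∑ i, (‖dF i (x ω (k + 1) i)‖ + ‖dF i (x ω k i)‖
        + (‖N ω (k + 1) i‖ + ‖N ω k i‖))) 2 μ := by
      refine memLp_finsetSum _ fun i _ => ?_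
      have e1 : MemLp (fun ω => ‖dF i (x ω (k + 1) i)‖) 2 μ :=
        (memLp_comp_lipschitz hdF i (h1 (Sum.inl i))).norm
      have e2 : MemLp (fun ω => ‖dF i (x ω k i)‖) 2 μ :=
        (memLp_comp_lipschitz hdF i (ih1 (Sum.inl i))).norm
      exact (e1.add e2).add ((h.memLp_noise (k + 1) i).norm.add (h.memLp_noise k i).norm)
    refine ⟨h1, fun r => ?_⟩
    refine memLp_linear_step ih2 hb (fun ω => ?_)
      (fun ω c => ?_) (fun ω => ?_) (haesm2 _ r)
      (fun ω => augMass_succ ⟨_, (h.path ω).m_zero⟩ (h.path ω).m_succ (h.admissible ω) k r)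
    · refine le_trans ?_ (Finset.single_le_sum (f := fun i =>
        (‖dF i (x ω (k + 1) i)‖ + ‖dF i (x ω k i)‖ + (‖N ω (k + 1) i‖ + ‖N ω k i‖)))
        (fun i _ => by positivity) (Finset.mem_univ ((s ω).active k)))
      exact norm_add_le_of_le (norm_sub_le _ _) (norm_sub_le _ _)
    · have hM := massMatrix_colStoch (G := G) hWA (s ω) D k
      rw [abs_of_nonneg (hM.nonneg _ _)]
      exact hM.le_one _ _
    · have hM := massMatrix_colStoch (G := G) hWA (s ω) D k
      rw [abs_of_nonneg (hM.nonneg _ _)]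
      exact hM.le_one _ _

theorem memLp_augVec (h : IsRandomPath μ ℱ G W A dF γ T D s x v m y N σ)
    (hWA : IsMixingPair G W A mbar) (hdF : ∀ i x y, ‖dF i x - dF i y‖ ≤ L i * ‖x - y‖)
    (k : ℕ) (r : ConsIdx V D) : MemLp (fun ω => augVec D (x ω) (v ω) k r) 2 μ :=
  (memLp_step hWA hdF h k).1 r

theorem memLp_z (h : IsRandomPath μ ℱ G W A dF γ T D s x v m y N σ)
    (hWA : IsMixingPair G W A mbar) (hdF : ∀ i x y, ‖dF i x - dF i y‖ ≤ L i * ‖x - y‖)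
    (k : ℕ) (i : V) : MemLp (fun ω => (m ω k).z i) 2 μ :=
  (memLp_step hWA hdF h k).2 (Sum.inl i)

theorem measurable_memLp_y (h : IsRandomPath μ ℱ G W A dF γ T D s x v m y N σ)
    (hWA : IsMixingPair G W A mbar) (hdF : ∀ i x y, ‖dF i x - dF i y‖ ≤ L i * ‖x - y‖) (k : ℕ) :
    ∀ r : MassIdx G D, Measurable (fun ω => augMass D (s ω) (y ω) k r) ∧
      MemLp (fun ω => augMass D (s ω) (y ω) k r) 2 μ := by
  have hact : ∀ t i, MeasurableSet {ω | (s ω).active t = i} :=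
    fun t i => ℱ.le 0 _ (h.active_meas t i)
  have hdel : ∀ t j d, MeasurableSet {ω | (s ω).delay t j = d} :=
    fun t j d => ℱ.le 0 _ (h.delay_meas t j d)
  have hx : ∀ k i, Measurable fun ω => x ω k i :=
    fun k i => (h.augVec_meas k (Sum.inl i)).mono (ℱ.le _) le_rfl
  have hdFm : ∀ i, Measurable (dF i) := fun i => (continuous_of_lipschitz hdF i).measurable
  induction k with
  | zero =>
    intro r
    simp only [augMass_zero (h.path _).y_zero]
    exact ⟨measurable_const, memLp_const _⟩
  | succ k ih =>
    intro r
    have hmeas : Measurable fun ω => augMass D (s ω) (y ω) (k + 1) r := by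
      refine measurable_augMass_succ (fun ω => ⟨_, (h.path ω).y_zero⟩)
        (fun ω => (h.path ω).y_succ) h.admissible hact hdel (fun r => (ih r).1) ?_ r
      exact measurable_index (hact k)
        (f := fun i ω => dF i (x ω (k + 1) i) - dF i (x ω k i)) fun i =>
          ((hdFm i).comp (hx _ i)).sub ((hdFm i).comp (hx _ i))
    have hb : MemLp (fun ω => ∑ i, (‖dF i (x ω (k + 1) i)‖ + ‖dF i (x ω k i)‖)) 2 μ := by
      refine memLp_finsetSum _ fun i _ => ?_
      have e1 : MemLp (fun ω => ‖dF i (x ω (k + 1) i)‖) 2 μ :=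
        (memLp_comp_lipschitz hdF i (h.memLp_augVec hWA hdF (k + 1) (Sum.inl i))).norm
      have e2 : MemLp (fun ω => ‖dF i (x ω k i)‖) 2 μ :=
        (memLp_comp_lipschitz hdF i (h.memLp_augVec hWA hdF k (Sum.inl i))).norm
      exact e1.add e2
    refine ⟨hmeas, memLp_linear_step (fun r => (ih r).2) hb (fun ω => ?_)
      (fun ω c => ?_) (fun ω => ?_) hmeas.aestronglyMeasurable
      (fun ω => augMass_succ ⟨_, (h.path ω).y_zero⟩ (h.path ω).y_succ (h.admissible ω) k r)⟩
    · refine le_trans (norm_sub_le _ _) (Finset.single_le_sum (f := fun i =>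
        (‖dF i (x ω (k + 1) i)‖ + ‖dF i (x ω k i)‖))
        (fun i _ => by positivity) (Finset.mem_univ ((s ω).active k)))
    · have hM := massMatrix_colStoch (G := G) hWA (s ω) D k
      rw [abs_of_nonneg (hM.nonneg _ _)]
      exact hM.le_one _ _
    · have hM := massMatrix_colStoch (G := G) hWA (s ω) D k
      rw [abs_of_nonneg (hM.nonneg _ _)]
      exact hM.le_one _ _

end IsRandomPath

end

section

variable {V : Type*} [Fintype V] {G : Digraph V} {W A : Matrix V V ℝ} {mbar : ℝ} {T D n : ℕ}
  {dF : V → Vec n → Vec n} {γ : ℕ → ℝ} {L : V → ℝ≥0}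

/-! ### Moments of the noise -/

/-- At time `t`, agent `j` either still holds its noise of time `t₀`, or that of its last
activation since. -/
theorem IsPath.noise_eq_or {s : Schedule V} {x v : ℕ → V → Vec n} {m y : ℕ → Mass V n}
    {N : ℕ → V → Vec n} (h : IsPath G W A dF γ s x v m y N) (j : V) {t₀ t : ℕ} (ht : t₀ ≤ t) :
    (N t j = N t₀ j ∧ ∀ l, t₀ ≤ l → l < t → s.active l ≠ j) ∨
      ∃ l ∈ Finset.Ico t₀ t, N t j = N (l + 1) (s.active l) := by
  induction t, ht using Nat.le_induction with
  | base => exact Or.inl ⟨rfl, fun l h1 h2 => absurd h1 (by omega)⟩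
  | succ t ht ih =>
    by_cases hj : j = s.active t
    · exact Or.inr ⟨t, Finset.mem_Ico.mpr ⟨ht, Nat.lt_succ_self t⟩, by rw [hj]⟩
    · rw [h.N_succ t j hj]
      rcases ih with ⟨h1, h2⟩ | ⟨l, hl, h1⟩
      · refine Or.inl ⟨h1, fun l hl1 hl2 => ?_⟩
        rcases Nat.lt_succ_iff_lt_or_eq.mp hl2 with h3 | rfl
        · exact h2 l hl1 h3
        · exact Ne.symm hj
      · rw [Finset.mem_Ico] at hl
        exact Or.inr ⟨l, Finset.mem_Ico.mpr ⟨hl.1, hl.2.trans (Nat.lt_succ_self t)⟩, h1⟩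

/-- The noise held by an agent stems from one of the last `T` iterations or is its initial noise,
since the agent is active in each window of length `T`. -/
theorem IsPath.norm_noise_sq_le {s : Schedule V} {x v : ℕ → V → Vec n} {m y : ℕ → Mass V n}
    {N : ℕ → V → Vec n} (h : IsPath G W A dF γ s x v m y N) (hs : s.IsAdmissible G T D) (j : V)
    (t : ℕ) : ‖N t j‖ ^ 2 ≤ ‖N 0 j‖ ^ 2
      + ∑ l ∈ Finset.Ico (t - T) t, ‖N (l + 1) (s.active l)‖ ^ 2 := by
  have h0 : 0 ≤ ∑ l ∈ Finset.Ico (t - T) t, ‖N (l + 1) (s.active l)‖ ^ 2 :=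
    Finset.sum_nonneg fun _ _ => sq_nonneg _
  rcases h.noise_eq_or j (Nat.sub_le t T) with ⟨h1, h2⟩ | ⟨l, hl, h1⟩
  · rcases Nat.lt_or_ge t T with hT | hT
    · rw [h1, Nat.sub_eq_zero_of_le hT.le] at *
      linarith
    · obtain ⟨l, hl1, hl2, hl3⟩ := hs.activation (t - T) j
      exact absurd hl3 (h2 l hl1 (by omega))
  · rw [h1]
    have := Finset.single_le_sum (f := fun l => ‖N (l + 1) (s.active l)‖ ^ 2)
      (fun _ _ => sq_nonneg _) hl
    linarith [sq_nonneg ‖N 0 j‖]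

variable {Ω : Type*} {mΩ : MeasurableSpace Ω} {μ : Measure Ω} {ℱ : Filtration ℕ mΩ}
  {s : Ω → Schedule V} {x v : Ω → ℕ → V → Vec n} {m y : Ω → ℕ → Mass V n}
  {N : Ω → ℕ → V → Vec n} {σ : ℝ} [IsProbabilityMeasure μ]

theorem integrable_sq {E : Type*} [NormedAddCommGroup E] {f : Ω → E} (hf : MemLp f 2 μ) :
    Integrable (fun ω => ‖f ω‖ ^ 2) μ :=
  (memLp_two_iff_integrable_sq_norm hf.1).mp hf

namespace IsRandomPath

theorem integral_noise_sq_le (h : IsRandomPath μ ℱ G W A dF γ T D s x v m y N σ) (t : ℕ) (j : V) :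
    ∫ ω, ‖N ω t j‖ ^ 2 ∂μ ≤ (T + 1) * σ ^ 2 := by
  have hi := fun l => integrable_sq (h.memLp_newNoise l)
  have h0 := integrable_sq (h.memLp_noise 0 j)
  have h0' : ∫ ω, ‖N ω 0 j‖ ^ 2 ∂μ ≤ σ ^ 2 :=
    (memLp_two_of_lintegral (h.aesm_noise 0 j) (sq_nonneg σ) (h.var_zero j)).2
  calc _ ≤ ∫ ω, (‖N ω 0 j‖ ^ 2
          + ∑ l ∈ Finset.Ico (t - T) t, ‖N ω (l + 1) ((s ω).active l)‖ ^ 2) ∂μ :=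
        integral_mono (integrable_sq (h.memLp_noise t j))
          (h0.add (integrable_finsetSum _ fun l _ => hi l))
          fun ω => (h.path ω).norm_noise_sq_le (h.admissible ω) j t
    _ = ∫ ω, ‖N ω 0 j‖ ^ 2 ∂μ
          + ∑ l ∈ Finset.Ico (t - T) t, ∫ ω, ‖N ω (l + 1) ((s ω).active l)‖ ^ 2 ∂μ := by
        rw [integral_add h0 (integrable_finsetSum _ fun l _ => hi l),
          integral_finsetSum _ fun l _ => hi l]
    _ ≤ σ ^ 2 + ∑ l ∈ Finset.Ico (t - T) t, σ ^ 2 :=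
        add_le_add h0' (Finset.sum_le_sum fun l _ => h.integral_newNoise_sq_le l)
    _ ≤ (T + 1) * σ ^ 2 := by
        rw [Finset.sum_const, Nat.card_Ico, nsmul_eq_mul]
        have h1 : ((t - (t - T) : ℕ) : ℝ) ≤ T := by exact_mod_cast (by omega)
        nlinarith [sq_nonneg σ]

theorem memLp_noiseLen (h : IsRandomPath μ ℱ G W A dF γ T D s x v m y N σ) (t : ℕ) :
    MemLp (fun ω => noiseLen (N ω) t) 2 μ :=
  memLp_finsetSum _ fun j _ => (h.memLp_noise t j).norm

theorem integral_noiseLen_sq_le (h : IsRandomPath μ ℱ G W A dF γ T D s x v m y N σ) (t : ℕ) :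
    ∫ ω, noiseLen (N ω) t ^ 2 ∂μ ≤ (Fintype.card V : ℝ) ^ 2 * ((T + 1) * σ ^ 2) := by
  have hi := fun j => integrable_sq (h.memLp_noise t j)
  calc _ ≤ ∫ ω, (Fintype.card V : ℝ) * ∑ j, ‖N ω t j‖ ^ 2 ∂μ := by
        refine integral_mono (h.memLp_noiseLen t).integrable_sq
          ((integrable_finsetSum _ fun j _ => hi j).const_mul _) fun ω => ?_
        exact sq_sum_le_card_mul_sum_sq
    _ = (Fintype.card V : ℝ) * ∑ j, ∫ ω, ‖N ω t j‖ ^ 2 ∂μ := by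
        rw [integral_const_mul, integral_finsetSum _ fun j _ => hi j]
    _ ≤ (Fintype.card V : ℝ) * ∑ _j : V, ((T + 1) * σ ^ 2) :=
        mul_le_mul_of_nonneg_left (Finset.sum_le_sum fun j _ => h.integral_noise_sq_le t j)
          (Nat.cast_nonneg _)
    _ = _ := by rw [Finset.sum_const, Finset.card_univ, nsmul_eq_mul]; ring

/-- The accumulated noise has bounded second moment. -/
theorem integral_conv_noise_sq_le (h : IsRandomPath μ ℱ G W A dF γ T D s x v m y N σ)
    {q : ℝ} (hq : 0 ≤ q) (hq1 : q < 1) (k : ℕ) :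
    MemLp (fun ω => conv q (noiseLen (N ω)) k + noiseLen (N ω) k) 2 μ ∧
    ∫ ω, (conv q (noiseLen (N ω)) k + noiseLen (N ω) k) ^ 2 ∂μ
      ≤ (2 * (1 - q)⁻¹ ^ 2 + 2) * ((Fintype.card V : ℝ) ^ 2 * ((T + 1) * σ ^ 2)) := by
  set B := (Fintype.card V : ℝ) ^ 2 * ((T + 1) * σ ^ 2) with hB
  have hi := fun t => (h.memLp_noiseLen t).integrable_sq
  have hmem : MemLp (fun ω => conv q (noiseLen (N ω)) k + noiseLen (N ω) k) 2 μ :=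
    (memLp_finsetSum _ fun t _ => (h.memLp_noiseLen t).const_mul _).add (h.memLp_noiseLen k)
  refine ⟨hmem, ?_⟩
  have hθ : 0 ≤ (1 - q)⁻¹ := inv_nonneg.mpr (by linarith)
  have hc : Integrable (fun ω => conv q (fun t => noiseLen (N ω) t ^ 2) k) μ :=
    integrable_finsetSum _ fun t _ => (hi t).const_mul _
  have hB0 : 0 ≤ B := by positivity
  calc _ ≤ ∫ ω, (2 * (1 - q)⁻¹ * conv q (fun t => noiseLen (N ω) t ^ 2) k
          + 2 * noiseLen (N ω) k ^ 2) ∂μ := by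
        refine integral_mono hmem.integrable_sq ((hc.const_mul _).add ((hi k).const_mul _))
          fun ω => ?_
        have h1 := conv_sq_le hq hq1 (noiseLen (N ω)) k
        have h2 := sq_nonneg (conv q (noiseLen (N ω)) k - noiseLen (N ω) k)
        simp only
        nlinarith
    _ = 2 * (1 - q)⁻¹ * conv q (fun t => ∫ ω, noiseLen (N ω) t ^ 2 ∂μ) k
          + 2 * ∫ ω, noiseLen (N ω) k ^ 2 ∂μ := by
        rw [integral_add (hc.const_mul _) ((hi k).const_mul _), integral_const_mul,
          integral_const_mul]
        congr 2
        simp only [conv]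
        rw [integral_finsetSum _ fun t _ => (hi t).const_mul _]
        simp only [integral_const_mul]
    _ ≤ 2 * (1 - q)⁻¹ * ((1 - q)⁻¹ * B) + 2 * B := by
        have h1 : conv q (fun t => ∫ ω, noiseLen (N ω) t ^ 2 ∂μ) k ≤ (1 - q)⁻¹ * B := by
          refine (conv_mono hq (b := fun _ => B) (fun t => h.integral_noiseLen_sq_le t) k).trans ?_
          have h2 := mul_le_mul_of_nonneg_right (conv_one_le hq hq1 k) hB0
          simpa [conv, Finset.sum_mul] using h2
        have h2 := h.integral_noiseLen_sq_le k
        have h3 := mul_le_mul_of_nonneg_left h1 (mul_nonneg zero_le_two hθ)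
        linarith
    _ = _ := by ring

/-! ### The noise is orthogonal to the past -/

theorem memLp_inner {E : Type*} [NormedAddCommGroup E] [InnerProductSpace ℝ E] {f g : Ω → E}
    (hf : MemLp f 2 μ) (hg : MemLp g 2 μ) : Integrable (fun ω => inner ℝ (f ω) (g ω)) μ := by
  refine Integrable.mono' ((integrable_sq hf).add (integrable_sq hg)) (hf.1.inner hg.1)
    (ae_of_all _ fun ω => ?_)
  rw [Real.norm_eq_abs]
  refine (abs_real_inner_le_norm _ _).trans ?_
  simp only [Pi.add_apply]
  nlinarith [sq_nonneg (‖f ω‖ - ‖g ω‖), sq_nonneg ‖f ω‖, sq_nonneg ‖g ω‖]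

/-- The point of evaluation is known at time `k`, so that an unbiased gradient means noise of
conditional mean zero. -/
theorem condExp_newNoise (h : IsRandomPath μ ℱ G W A dF γ T D s x v m y N σ)
    (hWA : IsMixingPair G W A mbar) (hdF : ∀ i x y, ‖dF i x - dF i y‖ ≤ L i * ‖x - y‖) (k : ℕ) :
    μ[fun ω => N ω (k + 1) ((s ω).active k) | ℱ k] =ᵐ[μ] 0 := by
  have hxm : ∀ i, Measurable[ℱ k] fun ω => dF i (x ω (k + 1) i) := fun i =>
    (continuous_of_lipschitz hdF i).measurable.comp (h.measurable_augVec_next k (Sum.inl i))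
  have hqm : Measurable[ℱ k] fun ω => dF ((s ω).active k) (x ω (k + 1) ((s ω).active k)) :=
    measurable_index (h.measurable_active k k) hxm
  have hqi : MemLp (fun ω => dF ((s ω).active k) (x ω (k + 1) ((s ω).active k))) 2 μ :=
    memLp_index (f := fun i ω => dF i (x ω (k + 1) i))
      (fun i => ℱ.le 0 _ (h.active_meas k i)) (fun i => (hxm i).mono (ℱ.le _) le_rfl)
      fun i => memLp_comp_lipschitz hdF i (h.memLp_augVec hWA hdF (k + 1) (Sum.inl i))
  have hqi1 := hqi.integrable one_le_two
  have h1 := condExp_add hqi1 ((h.memLp_newNoise k).integrable one_le_two) (ℱ k)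
  rw [condExp_of_stronglyMeasurable (ℱ.le k) hqm.stronglyMeasurable hqi1] at h1
  filter_upwards [h1, h.unbiased k] with ω e1 e2
  have e3 : (fun ω => dF ((s ω).active k) (x ω (k + 1) ((s ω).active k))
      + N ω (k + 1) ((s ω).active k))
    = (fun ω => dF ((s ω).active k) (x ω (k + 1) ((s ω).active k)))
      + fun ω => N ω (k + 1) ((s ω).active k) := rfl
  rw [e3, e1] at e2
  simpa using e2

theorem integral_inner_newNoise (h : IsRandomPath μ ℱ G W A dF γ T D s x v m y N σ)
    (hWA : IsMixingPair G W A mbar) (hdF : ∀ i x y, ‖dF i x - dF i y‖ ≤ L i * ‖x - y‖) {k : ℕ}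
    {H : Ω → Vec n} (hH : Measurable[ℱ k] H) (hH2 : MemLp H 2 μ) :
    ∫ ω, inner ℝ (H ω) (N ω (k + 1) ((s ω).active k)) ∂μ = 0 := by
  have hi := memLp_inner hH2 (h.memLp_newNoise k)
  rw [← integral_condExp (ℱ.le k)]
  have h1 := condExp_bilin_of_stronglyMeasurable_left (m := ℱ k) (μ := μ) (innerSL ℝ (E := Vec n))
    hH.stronglyMeasurable (g := fun ω => N ω (k + 1) ((s ω).active k)) hi
    ((h.memLp_newNoise k).integrable one_le_two)
  refine (integral_congr_ae ?_).trans (integral_zero Ω ℝ)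
  filter_upwards [h1, h.condExp_newNoise hWA hdF k] with ω e1 e2
  rw [e2] at e1
  refine e1.trans ?_
  simp

/-- Noise which has arisen after time `t₀` is orthogonal to what is known at time `t₀`. -/
theorem integral_indicator_inner_noise (h : IsRandomPath μ ℱ G W A dF γ T D s x v m y N σ)
    (hWA : IsMixingPair G W A mbar) (hdF : ∀ i x y, ‖dF i x - dF i y‖ ≤ L i * ‖x - y‖)
    (j : V) {t₀ t : ℕ} (ht : t₀ ≤ t) :
    ∀ H : Ω → Vec n, Measurable[ℱ t₀] H → MemLp H 2 μ →
      ∫ ω, (if ∃ l, t₀ ≤ l ∧ l < t ∧ (s ω).active l = j then inner ℝ (H ω) (N ω t j) else 0) ∂μ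
        = 0 := by
  have hmeas : ∀ t, MeasurableSet {ω | ∃ l, t₀ ≤ l ∧ l < t ∧ (s ω).active l = j} := by
    intro t
    have : {ω | ∃ l, t₀ ≤ l ∧ l < t ∧ (s ω).active l = j}
        = ⋃ l ∈ Finset.Ico t₀ t, {ω | (s ω).active l = j} := by
      ext ω; simp [and_assoc]
    rw [this]
    exact Finset.measurableSet_biUnion _ fun l _ => ℱ.le 0 _ (h.active_meas l j)
  induction t, ht using Nat.le_induction with
  | base =>
    intro H _ _
    refine (integral_congr_ae (ae_of_all _ fun ω => ?_)).trans (integral_zero Ω ℝ)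
    exact if_neg (by rintro ⟨l, h1, h2, _⟩; omega)
  | succ t ht ih =>
    intro H hH hH2
    -- where `j` is active at time `t`, its noise is new; elsewhere it is that of time `t`. As the
    -- schedule is known at time `0`, both parts of `H` are known at time `t₀`
    have hS : MeasurableSet[ℱ t₀] {ω | (s ω).active t = j} := h.measurable_active t₀ t j
    have hS' := ℱ.le t₀ _ hS
    have hH1 : MemLp ({ω | (s ω).active t = j}.indicator H) 2 μ := hH2.indicator hS'
    have hH3 : MemLp ({ω | (s ω).active t = j}ᶜ.indicator H) 2 μ := hH2.indicator hS'.compl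
    have e1 := h.integral_inner_newNoise hWA hdF (k := t)
      ((hH.indicator hS).mono (ℱ.mono ht) le_rfl) hH1
    have e2 := ih _ (hH.indicator hS.compl) hH3
    have i1 := memLp_inner hH1 (h.memLp_newNoise t)
    have i2 : Integrable (fun ω => if ∃ l, t₀ ≤ l ∧ l < t ∧ (s ω).active l = j then
        inner ℝ ({ω | (s ω).active t = j}ᶜ.indicator H ω) (N ω t j) else 0) μ := by
      refine ((memLp_inner hH3 (h.memLp_noise t j)).indicator (hmeas t)).congr
        (ae_of_all _ fun ω => ?_)
      exact Set.indicator_apply _ _ _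
    have e3 := integral_add i1 i2
    rw [e1, e2, add_zero] at e3
    refine (integral_congr_ae (ae_of_all _ fun ω => ?_)).trans e3
    by_cases hj : (s ω).active t = j
    · have h1 : ∃ l, t₀ ≤ l ∧ l < t + 1 ∧ (s ω).active l = j := ⟨t, ht, Nat.lt_succ_self t, hj⟩
      have h2 : ω ∉ {ω | (s ω).active t = j}ᶜ := fun hc => hc hj
      rw [if_pos h1, Set.indicator_of_mem (show ω ∈ {ω | (s ω).active t = j} from hj),
        Set.indicator_of_notMem h2]
      simp [hj]
    · have h2 : ω ∈ {ω | (s ω).active t = j}ᶜ := hj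
      have h3 : (∃ l, t₀ ≤ l ∧ l < t + 1 ∧ (s ω).active l = j)
          ↔ ∃ l, t₀ ≤ l ∧ l < t ∧ (s ω).active l = j := by
        constructor
        · rintro ⟨l, h1, h2, h3⟩
          refine ⟨l, h1, ?_, h3⟩
          rcases Nat.lt_succ_iff_lt_or_eq.mp h2 with h4 | rfl
          · exact h4
          · exact absurd h3 hj
        · rintro ⟨l, h1, h2, h3⟩
          exact ⟨l, h1, h2.trans (Nat.lt_succ_self t), h3⟩
      rw [Set.indicator_of_notMem (show ω ∉ {ω | (s ω).active t = j} from hj),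
        Set.indicator_of_mem h2, (h.path ω).N_succ t j (Ne.symm hj)]
      simp only [h3, inner_zero_left, zero_add]

/-- Every agent is active between the times `t - T` and `t`, so that all noise held at time `t` has
arisen after time `t - T`. -/
theorem integral_inner_noise (h : IsRandomPath μ ℱ G W A dF γ T D s x v m y N σ)
    (hWA : IsMixingPair G W A mbar) (hdF : ∀ i x y, ‖dF i x - dF i y‖ ≤ L i * ‖x - y‖)
    (j : V) {t : ℕ} (ht : T ≤ t) {H : Ω → Vec n} (hH : Measurable[ℱ (t - T)] H)
    (hH2 : MemLp H 2 μ) : ∫ ω, inner ℝ (H ω) (N ω t j) ∂μ = 0 := by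
  rw [← h.integral_indicator_inner_noise hWA hdF j (Nat.sub_le t T) H hH hH2]
  refine integral_congr_ae (ae_of_all _ fun ω => ?_)
  obtain ⟨l, h1, h2, h3⟩ := (h.admissible ω).activation (t - T) j
  exact (if_pos ⟨l, h1, by omega, h3⟩).symm

end IsRandomPath

end

section

variable {V : Type*} [Fintype V] {G : Digraph V} {W A : Matrix V V ℝ} {mbar : ℝ} {T D n : ℕ}
  {dF : V → Vec n → Vec n} {γ : ℕ → ℝ} {L : V → ℝ≥0}

/-! ### Absorption for small step sizes -/

/-- If the step sizes are square summable, the quadratic errors `u` and `a` are eventually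
absorbed by the decrease `γ k * e k` of the bounded below sequence `Φ`. -/
theorem exists_sum_le_of_descent (hγ : ∀ k, 0 < γ k) (hγ_sq : Summable fun k => γ k ^ 2)
    {e u a r Φ : ℕ → ℝ} {b c₀ c₁ c₂ c₃ c₄ : ℝ} (he : ∀ k, 0 ≤ e k) (hu : ∀ k, 0 ≤ u k)
    (ha : ∀ k, 0 ≤ a k) (hr : ∀ k, 0 ≤ r k) (hΦ : ∀ k, b ≤ Φ k) (hc₀ : 0 < c₀) (hc₁ : 0 ≤ c₁)
    (hc₂ : 0 ≤ c₂) (hc₃ : 0 ≤ c₃) (hc₄ : 0 ≤ c₄)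
    (hua : ∀ K, ∑ k ∈ Finset.range K, u k ≤ c₁ + c₁ * ∑ k ∈ Finset.range K, a k)
    (hae : ∀ k, a k ≤ c₂ * (γ k ^ 2 * e k + γ k ^ 2))
    (hra : ∀ K, ∑ k ∈ Finset.range K, r k ≤ c₄ + c₄ * ∑ k ∈ Finset.range K, a k)
    (hdesc : ∀ᶠ k in atTop, c₀ * (γ k * e k) ≤ Φ k - Φ (k + 1) + c₃ * (γ k * u k) + r k) :
    ∃ C, 0 < C ∧ ∀ K, ∑ k ∈ Finset.range K, γ k * (u k + e k) ≤ C := by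
  -- the step sizes below which the quadratic errors are dominated
  set δ : ℝ := min 1 (c₀ / (2 * (c₄ * c₂ + c₃ * c₁ * c₂ + 1))) with hδ
  have hδ0 : 0 < δ := lt_min one_pos (by positivity)
  have hδ1 : δ ≤ 1 := min_le_left _ _
  have hδ2 : (c₄ * c₂ + c₃ * c₁ * c₂) * δ ≤ c₀ / 2 := by
    have h1 : δ ≤ c₀ / (2 * (c₄ * c₂ + c₃ * c₁ * c₂ + 1)) := min_le_right _ _
    rw [le_div_iff₀ (by positivity)] at h1
    linarith
  have hγ0 : Tendsto γ atTop (𝓝 0) := by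
    have h1 := (Real.continuous_sqrt.tendsto 0).comp hγ_sq.tendsto_atTop_zero
    simpa only [Function.comp_def, Real.sqrt_sq (hγ _).le, Real.sqrt_zero] using h1
  obtain ⟨Γ, hΓ⟩ := hγ0.bddAbove_range
  have hΓ' : ∀ k, γ k ≤ Γ := fun k => hΓ ⟨k, rfl⟩
  obtain ⟨K₀, hK₀⟩ := eventually_atTop.mp (hdesc.and (hγ0.eventually_le_const hδ0))
  set Q := ∑' k, γ k ^ 2 with hQ
  have hsum : ∀ K, ∑ k ∈ Finset.range K, γ k ^ 2 ≤ Q := fun K =>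
    hγ_sq.sum_le_tsum _ fun _ _ => sq_nonneg _
  set S : ℕ → ℝ := fun K => ∑ k ∈ Finset.range K, γ k * e k with hS
  have hge : ∀ k, 0 ≤ γ k * e k := fun k => mul_nonneg (hγ k).le (he k)
  have hA : ∀ K, K₀ ≤ K → ∑ k ∈ Finset.range K, a k
      ≤ ∑ k ∈ Finset.range K₀, a k + c₂ * δ * S K + c₂ * Q := by
    intro K hK
    rw [← Finset.sum_range_add_sum_Ico _ hK]
    have h1 : ∑ k ∈ Finset.Ico K₀ K, a k
        ≤ ∑ k ∈ Finset.Ico K₀ K, (c₂ * δ * (γ k * e k) + c₂ * γ k ^ 2) := by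
      refine Finset.sum_le_sum fun k hk => (hae k).trans ?_
      have h2 := mul_le_mul_of_nonneg_right (hK₀ k (Finset.mem_Ico.mp hk).1).2 (hge k)
      have h3 := mul_le_mul_of_nonneg_left h2 hc₂
      nlinarith
    have h2 : ∑ k ∈ Finset.Ico K₀ K, (c₂ * δ * (γ k * e k) + c₂ * γ k ^ 2)
        ≤ ∑ k ∈ Finset.range K, (c₂ * δ * (γ k * e k) + c₂ * γ k ^ 2) := by
      refine Finset.sum_le_sum_of_subset_of_nonneg (fun k hk => ?_) fun k _ _ => ?_
      · exact Finset.mem_range.mpr (Finset.mem_Ico.mp hk).2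
      · have := hge k
        positivity
    have h4 : ∑ k ∈ Finset.range K, (c₂ * δ * (γ k * e k) + c₂ * γ k ^ 2)
        = c₂ * δ * S K + c₂ * ∑ k ∈ Finset.range K, γ k ^ 2 := by
      rw [Finset.sum_add_distrib, ← Finset.mul_sum, ← Finset.mul_sum]
    have h3 := mul_le_mul_of_nonneg_left (hsum K) hc₂
    linarith
  set A₀ := ∑ k ∈ Finset.range K₀, a k with hA₀
  have hA₀0 : 0 ≤ A₀ := Finset.sum_nonneg fun k _ => ha k
  have hQ0 : 0 ≤ Q := tsum_nonneg fun k => sq_nonneg _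
  -- twice `c₅ / c₀` bounds the sums `S K`, once half of `c₀ * S K` has been absorbed
  set c₅ := c₀ * S K₀ + (Φ K₀ - b) + c₃ * c₁ * (1 + A₀ + c₂ * Q)
    + c₄ * (1 + A₀ + c₂ * Q) with hc₅
  have hS0 : ∀ K, 0 ≤ S K := fun K => Finset.sum_nonneg fun k _ => hge k
  have hSK : ∀ K, K₀ ≤ K → S K ≤ 2 * c₅ / c₀ := by
    intro K hK
    have h1 : c₀ * ∑ k ∈ Finset.Ico K₀ K, γ k * e k
        ≤ (Φ K₀ - Φ K) + c₃ * δ * ∑ k ∈ Finset.Ico K₀ K, u k + ∑ k ∈ Finset.Ico K₀ K, r k := by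
      rw [show Φ K₀ - Φ K = -Φ K - -Φ K₀ by ring,
        ← Finset.sum_Ico_sub (fun k => -Φ k) hK, Finset.mul_sum, Finset.mul_sum,
        ← Finset.sum_add_distrib, ← Finset.sum_add_distrib]
      refine Finset.sum_le_sum fun k hk => ?_
      obtain ⟨h2, h3⟩ := hK₀ k (Finset.mem_Ico.mp hk).1
      have h4 := mul_le_mul_of_nonneg_left (mul_le_mul_of_nonneg_right h3 (hu k)) hc₃
      linarith
    have hsub : Finset.Ico K₀ K ⊆ Finset.range K := fun k hk =>
      Finset.mem_range.mpr (Finset.mem_Ico.mp hk).2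
    have h2 : ∑ k ∈ Finset.Ico K₀ K, u k ≤ ∑ k ∈ Finset.range K, u k :=
      Finset.sum_le_sum_of_subset_of_nonneg hsub fun k _ _ => hu k
    have h3 : ∑ k ∈ Finset.Ico K₀ K, r k ≤ ∑ k ∈ Finset.range K, r k :=
      Finset.sum_le_sum_of_subset_of_nonneg hsub fun k _ _ => hr k
    have h4 : S K = S K₀ + ∑ k ∈ Finset.Ico K₀ K, γ k * e k :=
      (Finset.sum_range_add_sum_Ico _ hK).symm
    have h5 := hA K hK
    have h6 : c₃ * δ * ∑ k ∈ Finset.Ico K₀ K, u k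
        ≤ c₃ * c₁ * (1 + A₀ + c₂ * Q) + c₃ * c₁ * c₂ * δ * S K := by
      have h7 : ∑ k ∈ Finset.Ico K₀ K, u k ≤ c₁ * (1 + (A₀ + c₂ * δ * S K + c₂ * Q)) := by
        have := mul_le_mul_of_nonneg_left h5 hc₁
        linarith [hua K]
      have h8 : 0 ≤ ∑ k ∈ Finset.Ico K₀ K, u k := Finset.sum_nonneg fun k _ => hu k
      have h9 := mul_le_mul_of_nonneg_left h7 hc₃
      have h10 : c₃ * δ * ∑ k ∈ Finset.Ico K₀ K, u k ≤ c₃ * ∑ k ∈ Finset.Ico K₀ K, u k :=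
        mul_le_mul_of_nonneg_right (mul_le_of_le_one_right hc₃ hδ1) h8
      linarith
    have h7 : ∑ k ∈ Finset.Ico K₀ K, r k ≤ c₄ * (1 + A₀ + c₂ * Q) + c₄ * c₂ * δ * S K := by
      have := mul_le_mul_of_nonneg_left h5 hc₄
      linarith [hra K]
    have h8 : (c₄ * c₂ + c₃ * c₁ * c₂) * δ * S K ≤ c₀ / 2 * S K :=
      mul_le_mul_of_nonneg_right hδ2 (hS0 K)
    rw [le_div_iff₀ hc₀]
    have h9 := hΦ K
    have h10 : c₀ * S K = c₀ * S K₀ + c₀ * ∑ k ∈ Finset.Ico K₀ K, γ k * e k := by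
      rw [h4]; ring
    linarith
  set S₁ := 2 * c₅ / c₀ with hS₁
  have hS₁0 : 0 ≤ S₁ := (hS0 K₀).trans (hSK K₀ le_rfl)
  have hΓ0 : 0 ≤ Γ := (hγ 0).le.trans (hΓ' 0)
  set C := Γ * (c₁ + c₁ * (A₀ + c₂ * δ * S₁ + c₂ * Q)) + S₁ with hC
  have hC0 : 0 ≤ C := by positivity
  have hmain : ∀ K, K₀ ≤ K → ∑ k ∈ Finset.range K, γ k * (u k + e k) ≤ C := by
    intro K hK
    have h1 : ∑ k ∈ Finset.range K, γ k * u k ≤ Γ * ∑ k ∈ Finset.range K, u k := by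
      rw [Finset.mul_sum]
      exact Finset.sum_le_sum fun k _ => mul_le_mul_of_nonneg_right (hΓ' k) (hu k)
    have h2 : ∑ k ∈ Finset.range K, u k ≤ c₁ + c₁ * (A₀ + c₂ * δ * S₁ + c₂ * Q) := by
      have h3 := mul_le_mul_of_nonneg_left (hA K hK) hc₁
      have h4 := mul_le_mul_of_nonneg_left
        (mul_le_mul_of_nonneg_left (hSK K hK) (mul_nonneg hc₂ hδ0.le)) hc₁
      linarith [hua K]
    simp only [mul_add, Finset.sum_add_distrib]
    have h3 := mul_le_mul_of_nonneg_left h2 hΓ0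
    have h4 := hSK K hK
    simp only [hS] at h4
    linarith
  refine ⟨C + 1, by linarith, fun K => ?_⟩
  rcases le_total K₀ K with hK | hK
  · linarith [hmain K hK]
  · have h1 : ∑ k ∈ Finset.range K, γ k * (u k + e k)
        ≤ ∑ k ∈ Finset.range K₀, γ k * (u k + e k) :=
      Finset.sum_le_sum_of_subset_of_nonneg (Finset.range_mono hK) fun k _ _ =>
        mul_nonneg (hγ k).le (add_nonneg (hu k) (he k))
    linarith [hmain K₀ le_rfl]

/-! ### Expected errors -/

variable {Ω : Type*} {mΩ : MeasurableSpace Ω} {μ : Measure Ω} {ℱ : Filtration ℕ mΩ}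
  {s : Ω → Schedule V} {x v : Ω → ℕ → V → Vec n} {m y : Ω → ℕ → Mass V n}
  {N : Ω → ℕ → V → Vec n} {σ C q p : ℝ} {ξ : Ω → ℕ → MassIdx G D → ℝ}
  {ψ : Ω → ℕ → ConsIdx V D → ℝ}

theorem memLp_smul_of_abs_le_one {E : Type*} [NormedAddCommGroup E] [NormedSpace ℝ E] {c : Ω → ℝ}
    {f : Ω → E} (hc : Measurable c) (hc1 : ∀ ω, |c ω| ≤ 1) (hf : MemLp f 2 μ) :
    MemLp (fun ω => c ω • f ω) 2 μ := by
  refine hf.mono (hc.aestronglyMeasurable.smul hf.1) (ae_of_all _ fun ω => ?_)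
  rw [norm_smul, Real.norm_eq_abs]
  exact mul_le_of_le_one_left (norm_nonneg _) (hc1 ω)

theorem abs_le_one_of_mem_stdSimplex {I : Type*} [Fintype I] {w : I → ℝ}
    (h : w ∈ stdSimplex ℝ I) (i : I) : |w i| ≤ 1 := by
  rw [abs_of_nonneg (h.1 i)]
  exact le_one_of_mem_stdSimplex h i

namespace IsRandomPath

variable [IsProbabilityMeasure μ]

/-- The consensus weights are functions of the schedule, up to measurability. -/
theorem measurable_consWeight (h : IsRandomPath μ ℱ G W A dF γ T D s x v m y N σ)
    (hψ : ∀ ω, IsConsensusLimit G W (s ω) D C q (ψ ω)) (hq : 0 < q) (hq1 : q < 1) (k : ℕ)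
    (c : ConsIdx V D) : Measurable[ℱ 0] fun ω => ψ ω k c :=
  @measurable_of_tendsto_metrizable Ω ℝ (ℱ 0) _ _ _ _ _ _
    (fun r => measurable_prodFrom (measurable_consMatrix (W := W) (G := G) h.active_meas
      h.delay_meas) k r c c)
    (tendsto_pi_nhds.mpr fun ω => (hψ ω).tendsto hq hq1 k c c)

theorem measurable_center (h : IsRandomPath μ ℱ G W A dF γ T D s x v m y N σ)
    (hψ : ∀ ω, IsConsensusLimit G W (s ω) D C q (ψ ω)) (hq : 0 < q) (hq1 : q < 1) (k : ℕ) :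
    Measurable[ℱ k] fun ω => center (x ω) (v ω) (ψ ω) k :=
  Finset.measurable_sum _ fun c _ => ((h.measurable_consWeight hψ hq hq1 k c).mono
    (ℱ.mono (Nat.zero_le k)) le_rfl).smul (h.augVec_meas k c)

theorem memLp_center (h : IsRandomPath μ ℱ G W A dF γ T D s x v m y N σ)
    (hWA : IsMixingPair G W A mbar) (hdF : ∀ i x y, ‖dF i x - dF i y‖ ≤ L i * ‖x - y‖)
    (hψ : ∀ ω, IsConsensusLimit G W (s ω) D C q (ψ ω)) (hq : 0 < q) (hq1 : q < 1) (k : ℕ) :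
    MemLp (fun ω => center (x ω) (v ω) (ψ ω) k) 2 μ :=
  memLp_finsetSum _ fun c _ => memLp_smul_of_abs_le_one
    ((h.measurable_consWeight hψ hq hq1 k c).mono (ℱ.le 0) le_rfl)
    (fun ω => abs_le_one_of_mem_stdSimplex ((hψ ω).1 k) c) (h.memLp_augVec hWA hdF k c)

theorem integrable_errC (h : IsRandomPath μ ℱ G W A dF γ T D s x v m y N σ)
    (hWA : IsMixingPair G W A mbar) (hdF : ∀ i x y, ‖dF i x - dF i y‖ ≤ L i * ‖x - y‖)
    (hψ : ∀ ω, IsConsensusLimit G W (s ω) D C q (ψ ω)) (hq : 0 < q) (hq1 : q < 1) (k : ℕ) :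
    Integrable (fun ω => errC (augVec D (x ω) (v ω) k) (ψ ω k)) μ :=
  integrable_finsetSum _ fun r _ => integrable_sq
    ((h.memLp_augVec hWA hdF k r).sub (h.memLp_center hWA hdF hψ hq hq1 k))

theorem integrable_errZ (h : IsRandomPath μ ℱ G W A dF γ T D s x v m y N σ)
    (hWA : IsMixingPair G W A mbar) (hdF : ∀ i x y, ‖dF i x - dF i y‖ ≤ L i * ‖x - y‖) (k : ℕ) :
    Integrable (fun ω => errZ (y ω k) ((s ω).active k)) μ :=
  integrable_sq (memLp_index (f := fun i ω => (y ω k).z i)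
    (fun i => ℱ.le 0 _ (h.active_meas k i))
    (fun i => (h.measurable_memLp_y hWA hdF k (Sum.inl i)).1)
    fun i => (h.measurable_memLp_y hWA hdF k (Sum.inl i)).2)

theorem integrable_errT (h : IsRandomPath μ ℱ G W A dF γ T D s x v m y N σ)
    (hWA : IsMixingPair G W A mbar) (hdF : ∀ i x y, ‖dF i x - dF i y‖ ≤ L i * ‖x - y‖)
    (hξm : ∀ k r, Measurable fun ω => ξ ω k r)
    (hξ : ∀ ω, IsTrackingLimit G A (s ω) D C q (ξ ω)) (k : ℕ) :
    Integrable (fun ω => errT G (y ω k) (ξ ω k) ((s ω).active k)) μ := by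
  have hy := h.measurable_memLp_y hWA hdF k
  have htot : ∀ ω, (y ω k).total G = ∑ c : MassIdx G D, augMass D (s ω) (y ω) k c := fun ω =>
    total_eq_sum_augMass ⟨_, (h.path ω).y_zero⟩ (h.path ω).y_succ k
  have h1 : Measurable fun ω => (y ω k).total G := by
    simp only [htot]
    exact Finset.measurable_sum _ fun c _ => (hy c).1
  have h2 : MemLp (fun ω => (y ω k).total G) 2 μ := by
    simp only [htot]
    exact memLp_finsetSum _ fun c _ => (hy c).2
  exact integrable_sq (memLp_index
    (f := fun i ω => (y ω k).z i - ξ ω k (Sum.inl i) • (y ω k).total G)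
    (fun i => ℱ.le 0 _ (h.active_meas k i))
    (fun i => (hy (Sum.inl i)).1.sub ((hξm k _).smul h1))
    fun i => (hy (Sum.inl i)).2.sub (memLp_smul_of_abs_le_one (hξm k _)
      (fun ω => abs_le_one_of_mem_stdSimplex ((hξ ω).1 k) _) h2))

theorem memLp_moveLen (h : IsRandomPath μ ℱ G W A dF γ T D s x v m y N σ)
    (hWA : IsMixingPair G W A mbar) (hdF : ∀ i x y, ‖dF i x - dF i y‖ ≤ L i * ‖x - y‖) (k : ℕ) :
    MemLp (fun ω => moveLen γ (s ω) (m ω) k) 2 μ :=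
  (memLp_index (f := fun i ω => (m ω k).z i) (fun i => ℱ.le 0 _ (h.active_meas k i))
    (fun i => (h.augMass_meas k (Sum.inl i)).mono (ℱ.le k) le_rfl)
    fun i => h.memLp_z hWA hdF k i).norm.const_mul _

theorem memLp_conv_moveLen (h : IsRandomPath μ ℱ G W A dF γ T D s x v m y N σ)
    (hWA : IsMixingPair G W A mbar) (hdF : ∀ i x y, ‖dF i x - dF i y‖ ≤ L i * ‖x - y‖) (k : ℕ) :
    MemLp (fun ω => conv p (moveLen γ (s ω) (m ω)) k) 2 μ :=
  memLp_finsetSum _ fun t _ => (h.memLp_moveLen hWA hdF t).const_mul _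

/-- The tracked gradient is the exact one up to the accumulated noise, whose second moment is
bounded. -/
theorem integral_moveLen_sq_le (h : IsRandomPath μ ℱ G W A dF γ T D s x v m y N σ)
    (hWA : IsMixingPair G W A mbar) (hdF : ∀ i x y, ‖dF i x - dF i y‖ ≤ L i * ‖x - y‖)
    (hξ : ∀ ω, IsTrackingLimit G A (s ω) D C q (ξ ω)) (hC : 0 < C) (hq : 0 < q) (hq1 : q < 1)
    (k : ℕ) :
    ∫ ω, moveLen γ (s ω) (m ω) k ^ 2 ∂μ
      ≤ (2 + 2 * (2 * C + 1) ^ 2 * ((2 * (1 - q)⁻¹ ^ 2 + 2)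
          * ((Fintype.card V : ℝ) ^ 2 * ((T + 1) * σ ^ 2))))
        * (γ k ^ 2 * ∫ ω, errZ (y ω k) ((s ω).active k) ∂μ + γ k ^ 2) := by
  set B := (2 * (1 - q)⁻¹ ^ 2 + 2) * ((Fintype.card V : ℝ) ^ 2 * ((T + 1) * σ ^ 2)) with hB
  have hB0 : 0 ≤ B := by positivity
  obtain ⟨hn1, hn2⟩ := h.integral_conv_noise_sq_le hq.le hq1 k
  rw [← hB] at hn2
  have hz := h.integrable_errZ hWA hdF k
  have hz0 : 0 ≤ ∫ ω, errZ (y ω k) ((s ω).active k) ∂μ :=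
    integral_nonneg fun ω => sq_nonneg _
  calc _ ≤ ∫ ω, (2 * γ k ^ 2 * errZ (y ω k) ((s ω).active k) + 2 * (2 * C + 1) ^ 2 * γ k ^ 2
          * (conv q (noiseLen (N ω)) k + noiseLen (N ω) k) ^ 2) ∂μ := by
        refine integral_mono (h.memLp_moveLen hWA hdF k).integrable_sq
          ((hz.const_mul _).add (hn1.integrable_sq.const_mul _)) fun ω => ?_
        have h1 := (h.path ω).norm_z_sub_le (h.admissible ω) (hξ ω) hC hq hq1 k
        set w := (2 * C + 1) * (conv q (noiseLen (N ω)) k + noiseLen (N ω) k) with hw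
        have h2 : ‖(m ω k).z ((s ω).active k)‖ ≤ ‖(y ω k).z ((s ω).active k)‖ + w := by
          have := norm_sub_norm_le ((m ω k).z ((s ω).active k)) ((y ω k).z ((s ω).active k))
          linarith
        have h3 := pow_le_pow_left₀ (norm_nonneg _) h2 2
        have h4 : (‖(y ω k).z ((s ω).active k)‖ + w) ^ 2
            ≤ 2 * errZ (y ω k) ((s ω).active k) + 2 * w ^ 2 := by
          rw [errZ]
          nlinarith [sq_nonneg (‖(y ω k).z ((s ω).active k)‖ - w)]
        have h5 := mul_le_mul_of_nonneg_left (h3.trans h4) (sq_nonneg (γ k))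
        simp only [moveLen, mul_pow]
        rw [hw, mul_pow] at h5
        linarith
    _ = 2 * γ k ^ 2 * ∫ ω, errZ (y ω k) ((s ω).active k) ∂μ + 2 * (2 * C + 1) ^ 2 * γ k ^ 2
          * ∫ ω, (conv q (noiseLen (N ω)) k + noiseLen (N ω) k) ^ 2 ∂μ := by
        rw [integral_add (hz.const_mul _) (hn1.integrable_sq.const_mul _), integral_const_mul,
          integral_const_mul]
    _ ≤ _ := by
        have h1 := mul_le_mul_of_nonneg_left hn2
          (show 0 ≤ 2 * (2 * C + 1) ^ 2 * γ k ^ 2 by positivity)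
        have h2 : 0 ≤ 2 * (2 * C + 1) ^ 2 * B
            * (γ k ^ 2 * ∫ ω, errZ (y ω k) ((s ω).active k) ∂μ) := by
          positivity
        nlinarith [sq_nonneg (γ k)]

/-- The objective grows at most quadratically. -/
theorem integrable_objective_center (h : IsRandomPath μ ℱ G W A dF γ T D s x v m y N σ)
    (hWA : IsMixingPair G W A mbar) (hdF : ∀ i x y, ‖dF i x - dF i y‖ ≤ L i * ‖x - y‖)
    (hψ : ∀ ω, IsConsensusLimit G W (s ω) D C q (ψ ω)) (hq : 0 < q) (hq1 : q < 1)
    {F : Vec n → ℝ} (hF : ∀ x, HasGradientAt F (∑ i, dF i x) x) (k : ℕ) :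
    Integrable (fun ω => F (center (x ω) (v ω) (ψ ω) k)) μ := by
  have hc := h.memLp_center hWA hdF hψ hq hq1 k
  have hcont : Continuous F := continuous_iff_continuousAt.mpr fun x => (hF x).continuousAt
  have hΛ0 : 0 ≤ ∑ i, (L i : ℝ) := Finset.sum_nonneg fun j _ => (L j).coe_nonneg
  refine Integrable.mono' (g := fun ω => (|F 0| + ‖∑ i, dF i 0‖ ^ 2)
      + ((∑ i, (L i : ℝ)) + 1) * ‖center (x ω) (v ω) (ψ ω) k‖ ^ 2)
    ((integrable_const _).add ((integrable_sq hc).const_mul _))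
    (hcont.comp_aestronglyMeasurable hc.1) (ae_of_all _ fun ω => ?_)
  set c := center (x ω) (v ω) (ψ ω) k
  have h1 := abs_le.mp (abs_sub_sub_inner_le hΛ0 hF (fun x y => by
    rw [← Finset.sum_sub_distrib, Finset.sum_mul]
    exact norm_sum_le_of_le _ fun i _ => hdF i x y) 0 c)
  rw [sub_zero] at h1
  have h2 := abs_le.mp (abs_real_inner_le_norm (∑ i, dF i 0) c)
  have h3 : ‖∑ i, dF i 0‖ * ‖c‖ ≤ ‖∑ i, dF i 0‖ ^ 2 + ‖c‖ ^ 2 := by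
    nlinarith [sq_nonneg (‖∑ i, dF i 0‖ - ‖c‖), sq_nonneg ‖∑ i, dF i 0‖, sq_nonneg ‖c‖]
  have h4 := neg_abs_le (F 0)
  have h5 := le_abs_self (F 0)
  rw [Real.norm_eq_abs, abs_le]
  constructor <;> linarith [h1.1, h1.2, h2.1, h2.2]

/-! ### The expected noise in the descent inequality -/

theorem measurable_noiseCoef (h : IsRandomPath μ ℱ G W A dF γ T D s x v m y N σ) (k t : ℕ)
    (j : V) : Measurable[ℱ 0] fun ω => noiseCoef G A (s ω) D k t j := by
  have hP := fun t r a c => measurable_prodFrom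
    (measurable_massMatrix (G := G) (A := A) (D := D) h.active_meas h.delay_meas) t r a c
  have hI := fun t r => measurable_index (h.active_meas k)
    (f := fun i ω => prodFrom (massMatrix G A (s ω) D) t r (Sum.inl i) (Sum.inl j))
    fun i => hP t r _ _
  simp only [noiseCoef]
  refine Measurable.add ?_ (Measurable.ite ?_ measurable_const measurable_const)
  · split_ifs
    · exact measurable_const
    · exact (hI _ _).sub (hI _ _)
  · exact (MeasurableSet.const (t = k)).inter (measurableSet_eq_active h.active_meas k j)

/-- The noise terms of the descent inequality are integrable; they have mean zero if the noise
has arisen after the point at which the gradient is taken. The finitely many others are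
discounted. -/
theorem integral_noise_term (h : IsRandomPath μ ℱ G W A dF γ T D s x v m y N σ)
    (hWA : IsMixingPair G W A mbar) (hdF : ∀ i x y, ‖dF i x - dF i y‖ ≤ L i * ‖x - y‖)
    (hξ : ∀ ω, IsTrackingLimit G A (s ω) D C q (ξ ω))
    (hψ : ∀ ω, IsConsensusLimit G W (s ω) D C q (ψ ω)) (hC : 0 < C) (hq : 0 < q) (hq1 : q < 1)
    {t k : ℕ} (htk : t ≤ k) (j : V) :
    Integrable (fun ω => ψ ω k (Sum.inl ((s ω).active k)) * noiseCoef G A (s ω) D k t j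
      * inner ℝ (∑ i, dF i (center (x ω) (v ω) (ψ ω) (t - T))) (N ω t j)) μ ∧
    -(if t < T then (2 * C + 1) * (q ^ T)⁻¹ * (‖∑ i, dF i 0‖ * (1 + (T + 1) * σ ^ 2)) * q ^ k
        else 0)
      ≤ ∫ ω, ψ ω k (Sum.inl ((s ω).active k)) * noiseCoef G A (s ω) D k t j
        * inner ℝ (∑ i, dF i (center (x ω) (v ω) (ψ ω) (t - T))) (N ω t j) ∂μ := by
  set c : Ω → ℝ := fun ω => ψ ω k (Sum.inl ((s ω).active k)) * noiseCoef G A (s ω) D k t j with hc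
  set u : Ω → Vec n := fun ω => ∑ i, dF i (center (x ω) (v ω) (ψ ω) (t - T)) with hu
  have hcm : Measurable[ℱ 0] c :=
    (measurable_index (h.active_meas k) (f := fun i ω => ψ ω k (Sum.inl i))
      fun i => h.measurable_consWeight hψ hq hq1 k _).mul (h.measurable_noiseCoef k t j)
  have hc1 : ∀ ω, |c ω| ≤ (2 * C + 1) * q ^ (k - t) := fun ω => by
    rw [hc, abs_mul]
    refine (mul_le_of_le_one_left (abs_nonneg _)
      (abs_le_one_of_mem_stdSimplex ((hψ ω).1 k) _)).trans ?_
    exact abs_noiseCoef_le (hξ ω) hC hq hq1 htk j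
  have hum : Measurable[ℱ (t - T)] u := Finset.measurable_sum _ fun i _ =>
    (continuous_of_lipschitz hdF i).measurable.comp (h.measurable_center hψ hq hq1 (t - T))
  have hu2 : MemLp u 2 μ := memLp_finsetSum _ fun i _ =>
    memLp_comp_lipschitz hdF i (h.memLp_center hWA hdF hψ hq hq1 (t - T))
  have hHm : Measurable[ℱ (t - T)] fun ω => c ω • u ω :=
    (hcm.mono (ℱ.mono (Nat.zero_le _)) le_rfl).smul hum
  have hH2 : MemLp (fun ω => c ω • u ω) 2 μ := by
    refine (hu2.norm.const_mul ((2 * C + 1) * q ^ (k - t))).mono'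
      (hHm.mono (ℱ.le _) le_rfl).aestronglyMeasurable (ae_of_all _ fun ω => ?_)
    rw [norm_smul, Real.norm_eq_abs]
    exact mul_le_mul_of_nonneg_right (hc1 ω) (norm_nonneg _)
  have e : (fun ω => c ω * inner ℝ (u ω) (N ω t j)) = fun ω => inner ℝ (c ω • u ω) (N ω t j) := by
    ext ω
    rw [real_inner_smul_left]
  have hN := h.memLp_noise t j
  have hi : Integrable (fun ω => c ω * inner ℝ (u ω) (N ω t j)) μ := by
    rw [e]
    exact memLp_inner hH2 hN
  refine ⟨hi, ?_⟩
  split_ifs with htT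
  -- for `t < T` the gradient is taken at the initial center `0`, and `q ^ (k - t)` is at most a
  -- constant times `q ^ k`
  · have hu0 : ∀ ω, u ω = ∑ i, dF i 0 := fun ω => by
      simp only [hu, Nat.sub_eq_zero_of_le htT.le, (h.path ω).center_zero]
    set b := (2 * C + 1) * (q ^ T)⁻¹ * q ^ k * ‖∑ i, dF i 0‖ with hb
    have hqk : q ^ (k - t) ≤ (q ^ T)⁻¹ * q ^ k := by
      rw [inv_mul_eq_div, le_div_iff₀ (by positivity), ← pow_add]
      exact pow_le_pow_of_le_one hq.le hq1.le (by omega)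
    have hN2 := (integrable_sq hN).const_mul b
    have h1 : ∀ ω, -(b + b * ‖N ω t j‖ ^ 2) ≤ c ω * inner ℝ (u ω) (N ω t j) := fun ω => by
      refine neg_le_of_abs_le ?_
      rw [abs_mul, hu0]
      calc _ ≤ ((2 * C + 1) * ((q ^ T)⁻¹ * q ^ k)) * (‖∑ i, dF i 0‖ * ‖N ω t j‖) :=
            mul_le_mul ((hc1 ω).trans (mul_le_mul_of_nonneg_left hqk (by positivity)))
              (abs_real_inner_le_norm _ _) (abs_nonneg _) (by positivity)
        _ = b * ‖N ω t j‖ := by rw [hb]; ring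
        _ ≤ b * (1 + ‖N ω t j‖ ^ 2) := by
            refine mul_le_mul_of_nonneg_left ?_ (by positivity)
            nlinarith [sq_nonneg (‖N ω t j‖ - 1), sq_nonneg ‖N ω t j‖]
        _ = _ := by ring
    have h2 := integral_mono ((integrable_const b).add hN2).neg hi h1
    refine le_trans ?_ h2
    simp only [Pi.neg_apply, Pi.add_apply]
    rw [integral_neg, integral_add (integrable_const b) hN2, integral_const_mul b, integral_const]
    simp only [probReal_univ, one_smul]
    have h3 := mul_le_mul_of_nonneg_left (h.integral_noise_sq_le t j)
      (show 0 ≤ b by positivity)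
    refine le_of_eq_of_le ?_ (neg_le_neg (add_le_add_right h3 b))
    rw [hb]
    ring
  · rw [e, h.integral_inner_noise hWA hdF j (not_lt.mp htT) hHm hH2, neg_zero]

/-- The expected noise in the descent inequality decays geometrically. -/
theorem integral_noise_sum (h : IsRandomPath μ ℱ G W A dF γ T D s x v m y N σ)
    (hWA : IsMixingPair G W A mbar) (hdF : ∀ i x y, ‖dF i x - dF i y‖ ≤ L i * ‖x - y‖)
    (hξ : ∀ ω, IsTrackingLimit G A (s ω) D C q (ξ ω))
    (hψ : ∀ ω, IsConsensusLimit G W (s ω) D C q (ψ ω)) (hC : 0 < C) (hq : 0 < q) (hq1 : q < 1) :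
    ∃ κ, 0 ≤ κ ∧ ∀ k,
      Integrable (fun ω => ∑ t ∈ Finset.range (k + 1), ∑ j, ψ ω k (Sum.inl ((s ω).active k))
        * noiseCoef G A (s ω) D k t j
        * inner ℝ (∑ i, dF i (center (x ω) (v ω) (ψ ω) (t - T))) (N ω t j)) μ ∧
      -(κ * q ^ k) ≤ ∫ ω, ∑ t ∈ Finset.range (k + 1), ∑ j, ψ ω k (Sum.inl ((s ω).active k))
        * noiseCoef G A (s ω) D k t j
        * inner ℝ (∑ i, dF i (center (x ω) (v ω) (ψ ω) (t - T))) (N ω t j) ∂μ := by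
  set κ₁ := (2 * C + 1) * (q ^ T)⁻¹ * (‖∑ i, dF i 0‖ * (1 + (T + 1) * σ ^ 2)) with hκ₁
  have hκ₁0 : 0 ≤ κ₁ := by positivity
  refine ⟨T * (Fintype.card V * κ₁), by positivity, fun k => ?_⟩
  have hterm := fun t (ht : t ∈ Finset.range (k + 1)) (j : V) =>
    h.integral_noise_term hWA hdF hξ hψ hC hq hq1 (Nat.lt_succ_iff.mp (Finset.mem_range.mp ht)) j
  have hint := fun t ht => integrable_finsetSum Finset.univ fun j _ => (hterm t ht j).1
  refine ⟨integrable_finsetSum _ hint, ?_⟩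
  rw [integral_finsetSum _ hint]
  calc -(T * (Fintype.card V * κ₁) * q ^ k)
      ≤ ∑ t ∈ Finset.range (k + 1), ∑ _j : V, -(if t < T then κ₁ * q ^ k else 0) := by
        simp only [Finset.sum_const, Finset.card_univ, nsmul_eq_mul, ← Finset.mul_sum,
          Finset.sum_neg_distrib, ← Finset.sum_filter]
        have h1 : (((Finset.range (k + 1)).filter (· < T)).card : ℝ) ≤ T := by
          have := Finset.card_le_card (s := (Finset.range (k + 1)).filter (· < T))
            (t := Finset.range T) fun t ht => Finset.mem_range.mpr (Finset.mem_filter.mp ht).2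
          rw [Finset.card_range] at this
          exact_mod_cast this
        have h2 := mul_le_mul_of_nonneg_right h1
          (show 0 ≤ Fintype.card V * κ₁ * q ^ k by positivity)
        linarith
    _ ≤ _ := by
        refine Finset.sum_le_sum fun t ht => ?_
        rw [integral_finsetSum _ fun j _ => (hterm t ht j).1]
        exact Finset.sum_le_sum fun j _ => (hterm t ht j).2

/-! ### The ergodic bound -/

/-- Both weights of every agent are bounded away from zero, from some time on and uniformly in
the outcome. -/
theorem exists_le_weights [Nonempty V] (h : IsRandomPath μ ℱ G W A dF γ T D s x v m y N σ)
    (hG : StronglyConnected G) (hWA : IsMixingPair G W A mbar)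
    (hξ : ∀ ω, IsTrackingLimit G A (s ω) D C q (ξ ω))
    (hψ : ∀ ω, IsConsensusLimit G W (s ω) D C q (ψ ω)) (hq : 0 < q) (hq1 : q < 1) :
    ∃ η, 0 < η ∧ ∀ᶠ k in atTop, ∀ ω i, η ≤ ξ ω k (Sum.inl i) ∧ η ≤ ψ ω k (Sum.inl i) := by
  obtain ⟨R, η, -, hη, -, hlow⟩ := exists_entry_lower_bound hG hWA T D
  have hlim : Tendsto (fun k => C * q ^ k) atTop (𝓝 0) := by
    simpa using (tendsto_pow_atTop_nhds_zero_of_lt_one hq.le hq1).const_mul C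
  refine ⟨η / 2, half_pos hη, ?_⟩
  filter_upwards [hlim.eventually_le_const (half_pos hη), eventually_ge_atTop R] with k hk hkR ω i
  obtain ⟨h1, h2⟩ := hlow (s ω) (h.admissible ω)
  constructor
  · have h3 := (abs_le.mp ((hξ ω).2 0 k (Nat.zero_le k) i i)).2
    have h4 := h1 0 k hkR i (Sum.inl i)
    rw [Nat.sub_zero] at h3
    linarith
  · have h3 := (hψ ω).le_weight hq hq1 (fun t r hr a => h2 t r hr a i) k
    linarith

theorem sum_integral_conv_moveLen_sq_le (h : IsRandomPath μ ℱ G W A dF γ T D s x v m y N σ)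
    (hWA : IsMixingPair G W A mbar) (hdF : ∀ i x y, ‖dF i x - dF i y‖ ≤ L i * ‖x - y‖)
    (hp : 0 ≤ p) (hp1 : p < 1) (K : ℕ) :
    ∑ k ∈ Finset.range K, ∫ ω, conv p (moveLen γ (s ω) (m ω)) k ^ 2 ∂μ
      ≤ (1 - p)⁻¹ ^ 2 * ∑ k ∈ Finset.range K, ∫ ω, moveLen γ (s ω) (m ω) k ^ 2 ∂μ := by
  have h1 := fun k => (h.memLp_conv_moveLen (p := p) hWA hdF k).integrable_sq
  have h2 := fun k => (h.memLp_moveLen hWA hdF k).integrable_sq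
  rw [← integral_finsetSum _ fun k _ => h1 k, ← integral_finsetSum _ fun k _ => h2 k,
    ← integral_const_mul]
  exact integral_mono (integrable_finsetSum _ fun k _ => h1 k)
    ((integrable_finsetSum _ fun k _ => h2 k).const_mul _)
    fun ω => sum_conv_sq_le hp hp1 _ K

/-- The expected consensus and tracking errors are summable up to the squared moves. -/
theorem exists_sum_integral_err_le [Nonempty V]
    (h : IsRandomPath μ ℱ G W A dF γ T D s x v m y N σ)
    (hWA : IsMixingPair G W A mbar) (hdF : ∀ i x y, ‖dF i x - dF i y‖ ≤ L i * ‖x - y‖)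
    (hγ : ∀ k, 0 < γ k) (hξm : ∀ k r, Measurable fun ω => ξ ω k r)
    (hξ : ∀ ω, IsTrackingLimit G A (s ω) D C q (ξ ω))
    (hψ : ∀ ω, IsConsensusLimit G W (s ω) D C q (ψ ω)) (hC : 0 < C) (hq : 0 < q) (hq1 : q < 1) :
    ∃ c, 0 ≤ c ∧ ∀ K, ∑ k ∈ Finset.range K,
        (∫ ω, errC (augVec D (x ω) (v ω) k) (ψ ω k) ∂μ
          + ∫ ω, errT G (y ω k) (ξ ω k) ((s ω).active k) ∂μ)
      ≤ c + c * ∑ k ∈ Finset.range K, ∫ ω, moveLen γ (s ω) (m ω) k ^ 2 ∂μ := by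
  set c' := Fintype.card (ConsIdx V D) * C ^ 2 * (1 - q)⁻¹ ^ 2 with hc'
  set c₁ := 2 * (C * ∑ j, ‖dF j 0‖) ^ 2 * (1 - q)⁻¹ with hc₁
  set c₂ := 2 * (C * ∑ j, (L j : ℝ)) ^ 2 * (1 - q)⁻¹ ^ 2
    * (2 + 8 * C ^ 2 * (1 - q)⁻¹ ^ 2) with hc₂
  have hθ : 0 ≤ (1 - q)⁻¹ := inv_nonneg.mpr (by linarith)
  refine ⟨c' + c₁ + c₂, by positivity, fun K => ?_⟩
  have iC := fun k => h.integrable_errC hWA hdF hψ hq hq1 k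
  have iT := fun k => h.integrable_errT hWA hdF hξm hξ k
  have ia := fun k => (h.memLp_moveLen hWA hdF k).integrable_sq
  have hC' : ∑ k ∈ Finset.range K, ∫ ω, errC (augVec D (x ω) (v ω) k) (ψ ω k) ∂μ
      ≤ c' * ∑ k ∈ Finset.range K, ∫ ω, moveLen γ (s ω) (m ω) k ^ 2 ∂μ := by
    rw [← integral_finsetSum _ fun k _ => iC k, ← integral_finsetSum _ fun k _ => ia k,
      ← integral_const_mul]
    exact integral_mono (integrable_finsetSum _ fun k _ => iC k)
      ((integrable_finsetSum _ fun k _ => ia k).const_mul _)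
      fun ω => (h.path ω).sum_errC_le (h.admissible ω) hγ (hψ ω) hq hq1 K
  have hT' : ∑ k ∈ Finset.range K, ∫ ω, errT G (y ω k) (ξ ω k) ((s ω).active k) ∂μ
      ≤ c₁ + c₂ * ∑ k ∈ Finset.range K, ∫ ω, moveLen γ (s ω) (m ω) k ^ 2 ∂μ := by
    have ha := (integrable_finsetSum (Finset.range K) fun k _ => ia k).const_mul c₂
    have e1 : ∫ ω, (c₁ + c₂ * ∑ k ∈ Finset.range K, moveLen γ (s ω) (m ω) k ^ 2) ∂μ
        = c₁ + c₂ * ∑ k ∈ Finset.range K, ∫ ω, moveLen γ (s ω) (m ω) k ^ 2 ∂μ := by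
      rw [integral_add (integrable_const c₁) ha, integral_const_mul c₂,
        integral_finsetSum _ fun k _ => ia k, integral_const, probReal_univ, one_smul]
    rw [← e1, ← integral_finsetSum _ fun k _ => iT k]
    exact integral_mono (integrable_finsetSum _ fun k _ => iT k)
      ((integrable_const c₁).add ha)
      fun ω => (h.path ω).sum_errT_le hWA (h.admissible ω) hγ hdF (hψ ω) (hξ ω) hC hq hq1 K
  have ha0 : 0 ≤ ∑ k ∈ Finset.range K, ∫ ω, moveLen γ (s ω) (m ω) k ^ 2 ∂μ :=
    Finset.sum_nonneg fun k _ => integral_nonneg fun ω => sq_nonneg _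
  rw [Finset.sum_add_distrib]
  have h1 : 0 ≤ c' := by positivity
  have h2 : 0 ≤ c₁ := by positivity
  have h3 : 0 ≤ c₂ := by positivity
  nlinarith [mul_nonneg h2 ha0]

/-- The descent inequality in expectation. -/
theorem integral_descent [Nonempty V] (h : IsRandomPath μ ℱ G W A dF γ T D s x v m y N σ)
    (hWA : IsMixingPair G W A mbar) (hγ : ∀ k, 0 < γ k)
    (hdF : ∀ i x y, ‖dF i x - dF i y‖ ≤ L i * ‖x - y‖)
    (hξm : ∀ k r, Measurable fun ω => ξ ω k r)
    (hξ : ∀ ω, IsTrackingLimit G A (s ω) D C q (ξ ω))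
    (hψ : ∀ ω, IsConsensusLimit G W (s ω) D C q (ψ ω)) (hC : 0 < C) (hq : 0 < q) (hq1 : q < 1)
    (hp : 0 < p) (hp1 : p < 1) (hpq : p ^ 2 = q)
    {F : Vec n → ℝ} (hF : ∀ x, HasGradientAt F (∑ i, dF i x) x) {η κ : ℝ} (hη : 0 < η) {k : ℕ}
    (hw : ∀ ω i, η ≤ ξ ω k (Sum.inl i) ∧ η ≤ ψ ω k (Sum.inl i))
    (hκ : Integrable (fun ω => ∑ t ∈ Finset.range (k + 1), ∑ j,
        ψ ω k (Sum.inl ((s ω).active k)) * noiseCoef G A (s ω) D k t j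
        * inner ℝ (∑ i, dF i (center (x ω) (v ω) (ψ ω) (t - T))) (N ω t j)) μ ∧
      -(κ * q ^ k) ≤ ∫ ω, ∑ t ∈ Finset.range (k + 1), ∑ j,
        ψ ω k (Sum.inl ((s ω).active k)) * noiseCoef G A (s ω) D k t j
        * inner ℝ (∑ i, dF i (center (x ω) (v ω) (ψ ω) (t - T))) (N ω t j) ∂μ) :
    η / 2 * (γ k * ∫ ω, errZ (y ω k) ((s ω).active k) ∂μ)
      ≤ ∫ ω, F (center (x ω) (v ω) (ψ ω) k) ∂μ - ∫ ω, F (center (x ω) (v ω) (ψ ω) (k + 1)) ∂μ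
        + η⁻¹ * ((∑ i, (L i : ℝ)) ^ 2 + 1)
          * (γ k * (∫ ω, errC (augVec D (x ω) (v ω) k) (ψ ω k) ∂μ
            + ∫ ω, errT G (y ω k) (ξ ω k) ((s ω).active k) ∂μ))
        + ((∑ i, (L i : ℝ)) * ∫ ω, moveLen γ (s ω) (m ω) k ^ 2 ∂μ
          + (2 * C + 1) * (∑ i, (L i : ℝ)) * (p ^ T)⁻¹ *
            (γ k ^ 2 * ((2 * (1 - p)⁻¹ ^ 2 + 2)
              * ((Fintype.card V : ℝ) ^ 2 * ((T + 1) * σ ^ 2)))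
              + ∫ ω, conv p (moveLen γ (s ω) (m ω)) k ^ 2 ∂μ)
          + γ k * (κ * q ^ k)) := by
  set Λ := ∑ i, (L i : ℝ) with hΛ
  have hΛ0 : 0 ≤ Λ := Finset.sum_nonneg fun j _ => (L j).coe_nonneg
  set c := (2 * C + 1) * Λ * (p ^ T)⁻¹ with hc
  have hc0 : 0 ≤ c := by positivity
  set M : Ω → ℝ := fun ω => ∑ t ∈ Finset.range (k + 1), ∑ j,
    ψ ω k (Sum.inl ((s ω).active k)) * noiseCoef G A (s ω) D k t j
      * inner ℝ (∑ i, dF i (center (x ω) (v ω) (ψ ω) (t - T))) (N ω t j) with hM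
  obtain ⟨hn1, hn2⟩ := h.integral_conv_noise_sq_le hp.le hp1 k
  have iZ := h.integrable_errZ hWA hdF k
  have iC := h.integrable_errC hWA hdF hψ hq hq1 k
  have iT := h.integrable_errT hWA hdF hξm hξ k
  have ia := (h.memLp_moveLen hWA hdF k).integrable_sq
  have iv := (h.memLp_conv_moveLen (p := p) hWA hdF k).integrable_sq
  have iF := fun k => h.integrable_objective_center hWA hdF hψ hq hq1 hF k
  have in2 := hn1.integrable_sq
  have j1 : Integrable (fun ω => F (center (x ω) (v ω) (ψ ω) k)
      - F (center (x ω) (v ω) (ψ ω) (k + 1))) μ := (iF k).sub (iF (k + 1))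
  have j2 : Integrable (fun ω => Λ ^ 2 * errC (augVec D (x ω) (v ω) k) (ψ ω k)
      + errT G (y ω k) (ξ ω k) ((s ω).active k)) μ := (iC.const_mul _).add iT
  have j3 : Integrable (fun ω => F (center (x ω) (v ω) (ψ ω) k)
      - F (center (x ω) (v ω) (ψ ω) (k + 1))
      + γ k * (η⁻¹ * (Λ ^ 2 * errC (augVec D (x ω) (v ω) k) (ψ ω k)
        + errT G (y ω k) (ξ ω k) ((s ω).active k)))) μ :=
    j1.add ((j2.const_mul _).const_mul _)
  have j4 : Integrable (fun ω => F (center (x ω) (v ω) (ψ ω) k)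
      - F (center (x ω) (v ω) (ψ ω) (k + 1))
      + γ k * (η⁻¹ * (Λ ^ 2 * errC (augVec D (x ω) (v ω) k) (ψ ω k)
        + errT G (y ω k) (ξ ω k) ((s ω).active k)))
      + Λ * moveLen γ (s ω) (m ω) k ^ 2) μ := j3.add (ia.const_mul _)
  have j5 : Integrable (fun ω => γ k ^ 2 * (conv p (noiseLen (N ω)) k + noiseLen (N ω) k) ^ 2
      + conv p (moveLen γ (s ω) (m ω)) k ^ 2) μ := (in2.const_mul _).add iv
  have j6 : Integrable (fun ω => F (center (x ω) (v ω) (ψ ω) k)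
      - F (center (x ω) (v ω) (ψ ω) (k + 1))
      + γ k * (η⁻¹ * (Λ ^ 2 * errC (augVec D (x ω) (v ω) k) (ψ ω k)
        + errT G (y ω k) (ξ ω k) ((s ω).active k)))
      + Λ * moveLen γ (s ω) (m ω) k ^ 2
      + c * (γ k ^ 2 * (conv p (noiseLen (N ω)) k + noiseLen (N ω) k) ^ 2
      + conv p (moveLen γ (s ω) (m ω)) k ^ 2)) μ := j4.add (j5.const_mul _)
  have key := integral_mono ((iZ.const_mul (η / 2)).const_mul (γ k))
    (j6.sub (hκ.1.const_mul (γ k))) fun ω => (h.path ω).descent hWA (h.admissible ω) hγ hdF (hψ ω)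
      (hξ ω) hC hq hq1 hp hp1 hpq hF hη (hw ω _).1 (hw ω _).2
  simp only [Pi.sub_apply] at key
  rw [integral_sub j6 (hκ.1.const_mul (γ k)), integral_add j4 (j5.const_mul _),
    integral_add j3 (ia.const_mul _), integral_add j1 ((j2.const_mul _).const_mul _),
    integral_sub (iF k) (iF (k + 1))] at key
  simp only [integral_const_mul] at key
  rw [integral_add (iC.const_mul _) iT, integral_add (in2.const_mul _) iv] at key
  simp only [integral_const_mul] at key
  set eC := ∫ ω, errC (augVec D (x ω) (v ω) k) (ψ ω k) ∂μ with heC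
  set eT := ∫ ω, errT G (y ω k) (ξ ω k) ((s ω).active k) ∂μ with heT
  have heC0 : 0 ≤ eC := integral_nonneg fun ω => Finset.sum_nonneg fun _ _ => sq_nonneg _
  have heT0 : 0 ≤ eT := integral_nonneg fun ω => sq_nonneg _
  have h1 : γ k * (η⁻¹ * (Λ ^ 2 * eC + eT)) ≤ η⁻¹ * (Λ ^ 2 + 1) * (γ k * (eC + eT)) := by
    have h2 : γ k * η⁻¹ * (Λ ^ 2 * eC + eT) ≤ γ k * η⁻¹ * ((Λ ^ 2 + 1) * (eC + eT)) := by
      have := (hγ k).le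
      refine mul_le_mul_of_nonneg_left ?_ (by positivity)
      nlinarith [mul_nonneg (sq_nonneg Λ) heT0]
    linarith
  have h2 := mul_le_mul_of_nonneg_left
    (mul_le_mul_of_nonneg_left hn2 (sq_nonneg (γ k))) hc0
  have h3 := mul_le_mul_of_nonneg_left hκ.2 (hγ k).le
  linarith

/-- The partial sums of the expected errors, weighted by the step sizes, are bounded along every
random trajectory. -/
theorem exists_ergodic_bound [Nonempty V] (h : IsRandomPath μ ℱ G W A dF γ T D s x v m y N σ)
    (hG : StronglyConnected G) (hWA : IsMixingPair G W A mbar)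
    (hdF : ∀ i x y, ‖dF i x - dF i y‖ ≤ L i * ‖x - y‖)
    {F : Vec n → ℝ} (hF : ∀ x, HasGradientAt F (∑ i, dF i x) x) {b : ℝ} (hb : ∀ x, b ≤ F x)
    (hγ : ∀ k, 0 < γ k) (hγ_sq : Summable fun k => γ k ^ 2)
    (hlim : IsMixingLimits G W A s D ξ ψ) :
    (∀ k, Integrable (fun ω => errT G (y ω k) (ξ ω k) ((s ω).active k)
      + errC (augVec D (x ω) (v ω) k) (ψ ω k) + errZ (y ω k) ((s ω).active k)) μ) ∧
    ∃ B, 0 < B ∧ ∀ K, ∑ k ∈ Finset.range K, γ k *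
      ∫ ω, (errT G (y ω k) (ξ ω k) ((s ω).active k)
        + errC (augVec D (x ω) (v ω) k) (ψ ω k) + errZ (y ω k) ((s ω).active k)) ∂μ ≤ B := by
  obtain ⟨hξm, -, C, q, hC, hq, hq1, hlim⟩ := hlim
  have hξ := fun ω => (hlim ω).1
  have hψ := fun ω => (hlim ω).2
  -- the rate `q` is split into two factors `p`, one for the noise and one for the moves since then
  set p := √q with hp'
  have hp : 0 < p := Real.sqrt_pos.mpr hq
  have hpq : p ^ 2 = q := Real.sq_sqrt hq.le
  have hp1 : p < 1 := by rw [hp', Real.sqrt_lt' one_pos]; simpa using hq1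
  have hθ : 0 ≤ (1 - q)⁻¹ := inv_nonneg.mpr (by linarith)
  have iZ := h.integrable_errZ hWA hdF
  have iC := h.integrable_errC hWA hdF hψ hq hq1
  have iT := h.integrable_errT hWA hdF hξm hξ
  obtain ⟨η, hη, hw⟩ := h.exists_le_weights hG hWA hξ hψ hq hq1
  obtain ⟨κ, hκ0, hκ⟩ := h.integral_noise_sum hWA hdF hξ hψ hC hq hq1
  obtain ⟨c₁, hc₁, hua⟩ := h.exists_sum_integral_err_le hWA hdF hγ hξm hξ hψ hC hq hq1
  refine ⟨fun k => ((iT k).add (iC k)).add (iZ k), ?_⟩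
  set Λ := ∑ i, (L i : ℝ) with hΛ
  have hΛ0 : 0 ≤ Λ := Finset.sum_nonneg fun j _ => (L j).coe_nonneg
  set c := (2 * C + 1) * Λ * (p ^ T)⁻¹ with hc
  have hc0 : 0 ≤ c := by positivity
  set B := (2 * (1 - p)⁻¹ ^ 2 + 2) * ((Fintype.card V : ℝ) ^ 2 * ((T + 1) * σ ^ 2)) with hB
  have hB0 : 0 ≤ B := by positivity
  set Q := ∑' k, γ k ^ 2 with hQ
  have hQ0 : 0 ≤ Q := tsum_nonneg fun k => sq_nonneg _
  have ha0 : ∀ k, 0 ≤ ∫ ω, moveLen γ (s ω) (m ω) k ^ 2 ∂μ :=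
    fun k => integral_nonneg fun ω => sq_nonneg _
  have hv0 : ∀ k, 0 ≤ ∫ ω, conv p (moveLen γ (s ω) (m ω)) k ^ 2 ∂μ :=
    fun k => integral_nonneg fun ω => sq_nonneg _
  have hra : ∀ K, ∑ k ∈ Finset.range K, (Λ * ∫ ω, moveLen γ (s ω) (m ω) k ^ 2 ∂μ
      + c * (γ k ^ 2 * B + ∫ ω, conv p (moveLen γ (s ω) (m ω)) k ^ 2 ∂μ) + γ k * (κ * q ^ k))
      ≤ ((Λ + c * (1 - p)⁻¹ ^ 2) + (c * (B * Q) + κ * (Q + (1 - q)⁻¹)))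
        + ((Λ + c * (1 - p)⁻¹ ^ 2) + (c * (B * Q) + κ * (Q + (1 - q)⁻¹)))
          * ∑ k ∈ Finset.range K, ∫ ω, moveLen γ (s ω) (m ω) k ^ 2 ∂μ := by
    intro K
    have h1 := h.sum_integral_conv_moveLen_sq_le hWA hdF hp.le hp1 K
    have h2 : ∑ k ∈ Finset.range K, γ k ^ 2 ≤ Q := hγ_sq.sum_le_tsum _ fun _ _ => sq_nonneg _
    have h3 : ∑ k ∈ Finset.range K, γ k * (κ * q ^ k) ≤ κ * (Q + (1 - q)⁻¹) := by
      calc _ ≤ ∑ k ∈ Finset.range K, κ * (γ k ^ 2 + q ^ k) := by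
            refine Finset.sum_le_sum fun k _ => ?_
            have h4 : q ^ k ≤ 1 := pow_le_one₀ hq.le hq1.le
            have h5 : 0 < q ^ k := by positivity
            have h6 : γ k * q ^ k ≤ γ k ^ 2 + q ^ k := by
              nlinarith [sq_nonneg (γ k - q ^ k), sq_nonneg (γ k)]
            have := mul_le_mul_of_nonneg_left h6 hκ0
            linarith
        _ ≤ _ := by
            rw [← Finset.mul_sum, Finset.sum_add_distrib]
            refine mul_le_mul_of_nonneg_left (add_le_add h2 ?_) hκ0
            rw [← tsum_geometric_of_lt_one hq.le hq1]
            exact (summable_geometric_of_lt_one hq.le hq1).sum_le_tsum _ fun _ _ => by positivity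
    have h4 : 0 ≤ ∑ k ∈ Finset.range K, ∫ ω, moveLen γ (s ω) (m ω) k ^ 2 ∂μ :=
      Finset.sum_nonneg fun k _ => ha0 k
    simp only [Finset.sum_add_distrib, ← Finset.mul_sum, mul_add c, ← Finset.sum_mul]
    simp only [Finset.mul_sum] at h3 ⊢
    simp only [← Finset.mul_sum] at h3 ⊢
    have h5 := mul_le_mul_of_nonneg_left h1 hc0
    have h6 := mul_le_mul_of_nonneg_left (mul_le_mul_of_nonneg_right h2 hB0) hc0
    have h7 : 0 ≤ (c * (B * Q) + κ * (Q + (1 - q)⁻¹)) *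
        ∑ k ∈ Finset.range K, ∫ ω, moveLen γ (s ω) (m ω) k ^ 2 ∂μ :=
      mul_nonneg (by positivity) h4
    have h8 : 0 ≤ Λ + c * (1 - p)⁻¹ ^ 2 := by positivity
    linarith
  obtain ⟨B', hB', hfin⟩ := exists_sum_le_of_descent hγ hγ_sq
    (e := fun k => ∫ ω, errZ (y ω k) ((s ω).active k) ∂μ)
    (u := fun k => ∫ ω, errC (augVec D (x ω) (v ω) k) (ψ ω k) ∂μ
      + ∫ ω, errT G (y ω k) (ξ ω k) ((s ω).active k) ∂μ)
    (a := fun k => ∫ ω, moveLen γ (s ω) (m ω) k ^ 2 ∂μ)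
    (r := fun k => Λ * ∫ ω, moveLen γ (s ω) (m ω) k ^ 2 ∂μ
      + c * (γ k ^ 2 * B + ∫ ω, conv p (moveLen γ (s ω) (m ω)) k ^ 2 ∂μ) + γ k * (κ * q ^ k))
    (Φ := fun k => ∫ ω, F (center (x ω) (v ω) (ψ ω) k) ∂μ) (b := b) (c₀ := η / 2) (c₁ := c₁)
    (c₄ := (Λ + c * (1 - p)⁻¹ ^ 2) + (c * (B * Q) + κ * (Q + (1 - q)⁻¹)))
    (fun k => integral_nonneg fun ω => sq_nonneg _)
    (fun k => add_nonneg (integral_nonneg fun ω => Finset.sum_nonneg fun _ _ => sq_nonneg _)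
      (integral_nonneg fun ω => sq_nonneg _)) ha0 (fun k => by
        have := ha0 k
        have := hv0 k
        have := (hγ k).le
        positivity)
    (fun k => by
      have h1 := integral_mono (μ := μ) (integrable_const b)
        (h.integrable_objective_center hWA hdF hψ hq hq1 hF k) fun ω => hb _
      simpa using h1)
    (half_pos hη) hc₁ (by positivity) (by positivity) (by positivity) hua
    (h.integral_moveLen_sq_le hWA hdF hξ hC hq hq1) hra
    (hw.mono fun k hk => h.integral_descent hWA hγ hdF hξm hξ hψ hC hq hq1 hp hp1 hpq hF hη hk
      (hκ k))
  refine ⟨B', hB', fun K => le_trans (le_of_eq ?_) (hfin K)⟩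
  refine Finset.sum_congr rfl fun k _ => ?_
  rw [integral_add (f := fun ω => errT G (y ω k) (ξ ω k) ((s ω).active k)
    + errC (augVec D (x ω) (v ω) k) (ψ ω k)) ((iT k).add (iC k)) (iZ k),
    integral_add (iT k) (iC k)]
  ring

end IsRandomPath

end

end

end AsyncSGT

theorem mainTheorem1
    {V : Type*} [Fintype V] {n : ℕ}
    -- network, mixing matrices, bounds on activations and delays
    (G : Digraph V) (hG : AsyncSGT.StronglyConnected G)
    (W A : Matrix V V ℝ) (mbar : ℝ) (hWA : AsyncSGT.IsMixingPair G W A mbar) (T D : ℕ)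
    -- local objectives
    {Θ : Type*} [MeasurableSpace Θ] (P : Measure Θ) [IsProbabilityMeasure P]
    (f : V → AsyncSGT.Vec n → Θ → ℝ) (L : V → ℝ≥0)
    (hf_int : ∀ i x, Integrable (f i x) P)
    (hf_smooth : ∀ i, ∀ᵐ θ ∂P, Differentiable ℝ (fun x => f i x θ) ∧
      LipschitzWith (L i) (gradient fun x => f i x θ))
    (hf_below : ∃ b : ℝ, ∀ x, b ≤ ∑ i, AsyncSGT.localObj P f i x)
    -- stochastic gradient estimates
    {Z : Type*} [MeasurableSpace Z] (g : V → AsyncSGT.Vec n → Z → AsyncSGT.Vec n)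
    (hg : ∀ i, Measurable (Function.uncurry (g i)))
    -- step sizes
    (γ : ℕ → ℝ) (hγ_pos : ∀ k, 0 < γ k)
    (hγ_sum : Tendsto (fun k => ∑ l ∈ Finset.range k, γ l) atTop atTop)
    (hγ_sq : Summable fun k => γ k ^ 2)
    -- schedule and samples: the schedule is known at time 0, the k-th sample at time k + 1
    {Ω : Type*} {mΩ : MeasurableSpace Ω} (μ : Measure Ω) [IsProbabilityMeasure μ]
    (ℱ : Filtration ℕ mΩ) (s : Ω → AsyncSGT.Schedule V) (ζ₀ : Ω → Z) (ζ : ℕ → Ω → Z)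
    (hs : ∀ ω, (s ω).IsAdmissible G T D)
    (hs_active : ∀ k i, MeasurableSet[ℱ 0] {ω | (s ω).active k = i})
    (hs_delay : ∀ k j d, MeasurableSet[ℱ 0] {ω | (s ω).delay k j = d})
    (hζ₀ : Measurable[ℱ 0] ζ₀) (hζ : ∀ k, Measurable[ℱ (k + 1)] (ζ k))
    -- unbiased estimates of bounded variance
    (σ : ℝ)
    (hvar₀ : ∀ i, ∫⁻ ω, ‖g i 0 (ζ₀ ω) - AsyncSGT.localGrad P f i 0‖ₑ ^ 2 ∂μ
      ≤ ENNReal.ofReal (σ ^ 2))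
    (hunbiased : ∀ k,
      μ[fun ω => g ((s ω).active k)
          (AsyncSGT.queryPoint G W A g γ (s ω) (ζ₀ ω) (fun t => ζ t ω) k) (ζ k ω) | ℱ k]
        =ᵐ[μ] fun ω => AsyncSGT.localGrad P f ((s ω).active k)
          (AsyncSGT.queryPoint G W A g γ (s ω) (ζ₀ ω) (fun t => ζ t ω) k))
    (hvar : ∀ k,
      ∫⁻ ω, ‖g ((s ω).active k)
            (AsyncSGT.queryPoint G W A g γ (s ω) (ζ₀ ω) (fun t => ζ t ω) k) (ζ k ω)
          - AsyncSGT.localGrad P f ((s ω).active k)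
            (AsyncSGT.queryPoint G W A g γ (s ω) (ζ₀ ω) (fun t => ζ t ω) k)‖ₑ ^ 2 ∂μ
        ≤ ENNReal.ofReal (σ ^ 2)) :
    -- the limit vectors exist, and for all of them the ergodic bound holds
    (∃ (ξ : Ω → ℕ → AsyncSGT.MassIdx G D → ℝ) (ψ : Ω → ℕ → AsyncSGT.ConsIdx V D → ℝ),
      AsyncSGT.IsMixingLimits G W A s D ξ ψ) ∧
    ∀ (ξ : Ω → ℕ → AsyncSGT.MassIdx G D → ℝ) (ψ : Ω → ℕ → AsyncSGT.ConsIdx V D → ℝ),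
      AsyncSGT.IsMixingLimits G W A s D ξ ψ →
      (∀ k, Integrable (fun ω => AsyncSGT.errSum G W A g (AsyncSGT.localGrad P f) γ
        (s ω) (ζ₀ ω) (fun t => ζ t ω) (ξ ω) (ψ ω) k) μ) ∧
      ∃ C : ℝ, 0 < C ∧ ∀ k : ℕ,
        (∑ l ∈ Finset.range (k + 1), γ l *
            ∫ ω, AsyncSGT.errSum G W A g (AsyncSGT.localGrad P f) γ
              (s ω) (ζ₀ ω) (fun t => ζ t ω) (ξ ω) (ψ ω) l ∂μ)
          / (∑ l ∈ Finset.range (k + 1), γ l)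
        ≤ C / ∑ l ∈ Finset.range (k + 1), γ l := by
  -- an outcome exists, and with it an active agent
  have hV : Nonempty V := by
    obtain ⟨ω⟩ := nonempty_of_isProbabilityMeasure μ
    exact ⟨(s ω).active 0⟩
  refine ⟨AsyncSGT.exists_isMixingLimits hG hWA hs (fun k i => ℱ.le 0 _ (hs_active k i))
    fun k j d => ℱ.le 0 _ (hs_delay k j d), fun ξ ψ hlim => ?_⟩
  have hdF := AsyncSGT.norm_localGrad_sub_le hf_int hf_smooth
  obtain ⟨b, hb⟩ := hf_below
  have hF : ∀ x, HasGradientAt (fun x => ∑ i, AsyncSGT.localObj P f i x)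
      (∑ i, AsyncSGT.localGrad P f i x) x := fun x => by
    rw [hasGradientAt_iff_hasFDerivAt, map_sum]
    exact HasFDerivAt.fun_sum fun i _ =>
      (AsyncSGT.hasGradientAt_localObj hf_int hf_smooth i x).hasFDerivAt
  obtain ⟨hint, B, hB, hbound⟩ := (AsyncSGT.isRandomPath_run hg hdF hs hs_active hs_delay hζ₀ hζ
    hvar₀ hunbiased hvar).exists_ergodic_bound hG hWA hdF hF hb hγ_pos hγ_sq hlim
  exact ⟨hint, B, hB, fun k => div_le_div_of_nonneg_right (hbound (k + 1))
    (Finset.sum_nonneg fun l _ => (hγ_pos l).le)⟩
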